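/- **Setting.** Fix a horizon $T$, an inventory bound $L$ and a finite set $\mathcal A\subset[0,\bar a]$ of prices. In period $t=1,\dots,T$ the inventory is $X_t\in\{0,\dots,L\}$, a price $A_t\in\mathcal A$ is drawn from a policy (which may be randomised and depend on the history and on $X_t$), the demand is $D_t\sim\mathrm{Poisson}(\lambda_t(A_t))$ given $A_t$, independently of $X_t$ and of the past, the reward is $R_t=A_t\min(D_t,X_t)$, and $X_{t+1}=X_t-\min(X_t,D_t)$. Assume $0\le\lambda_{min}\le\lambda_t(a)\le\lambda_{max}$, and that $a\mapsto\lambda_t(a)$ is non-increasing. $\mathbb E^\pi$ is expectation under the policy $\pi$, $\mathbb P^\pi_t(a)$ is the probability that $A_t=a$ under $\pi$, $\pi^*$ is any policy maximising $\mathbb E^\pi[\sum_tR_t]$, $V_1^\pi(x)=\mathbb E^\pi[\sum_tR_t\mid X_1=x]$, $V_1^*(x)=\sup_\pi V_1^\pi(x)$, and the regret of $\pi$ is $\mu^\pi=\mathbb E[V_1^*(X_1)-V_1^\pi(X_1)]$. The data $\mathcal D_N$ are $N\ge1$ independent trajectories $(X_{i,t},A_{i,t},D_{i,t})_{t\le T}$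 of a (possibly history-dependent) behavior policy $\pi^b$. **Algorithm.** Let $N_t(a)=\#\{i:A_{i,t}=a\}$, $\mathcal A_t^{\mathcal D_N}=\{a:N_t(a)>0\}$, and for $a\in\mathcal A_t^{\mathcal D_N}$ let $\widehat\lambda_t(a)=N_t(a)^{-1}\sum_iD_{i,t}\mathbf 1(A_{i,t}=a)$ and $\delta_t(a)=c\sqrt{\log N_t(a)/N_t(a)}$. Let $\Omega_t(a)=[\widehat\lambda^L_t(a),\widehat\lambda^U_t(a)]$, where $\widehat\lambda^L_t(a)$ is the maximum of $\max(\widehat\lambda_t(a')-\delta_t(a'),\lambda_{min})$ over $a'\in\mathcal A_t^{\mathcal D_N}$ with $a'\ge a$ ($\lambda_{min}$ if there is none), and $\widehat\lambda^U_t(a)$ is the minimum of $\min(\widehat\lambda_t(a')+\delta_t(a'),\lambda_{max})$ over $a'\in\mathcal A_t^{\mathcal D_N}$ with $a'\le a$ ($\lambda_{max}$ if there is none). Put $\widehat V_{T+1}=0$ and, for $t=T,\dots,1$, $\widehat Q_t(x,a)=\min_{\lambda\in\Omega_t(a)}\mathbb E_{D\sim\mathrm{Poisson}(\lambda)}[a\min(D,x)+\widehat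 V_{t+1}(x-\min(x,D))]$ (with $\widehat V_{t+1}(0)=0$) and $\widehat V_t(x)=\max_a\widehat Q_t(x,a)$. The refined pessimistic policy $\widehat\pi^{\mathbf{pess}}$ posts a price $\widehat a_t(x)\in\operatorname{argmax}_a\widehat Q_t(x,a)$ (ties broken arbitrarily); $\mu^{\mathbf{pess}}$ is its regret. **Bound.** Let $\mathcal M_t=\{a:\mathbb P_t^{\pi^*}(a)>0\Rightarrow\mathbb P_t^{\pi^b}(a)>0\}$ and $\kappa_t=\sum_{a:\,\mathbb P_t^{\pi^b}(a)>0}(1-\mathbb P_t^{\pi^b}(a))^N$. Let $a_t^U$ be the largest observed price $\le a$ and $a_t^L$ the smallest observed price $\ge a$ in $\mathcal A_t^{\mathcal D_N}$ (both equal $a$ if $a$ is observed), and let $\eta_t(a)=\lambda_t(a_t^U)-\lambda_t(a_t^L)+2\delta_t(a_t^U)+2\delta_t(a_t^L)$ if both exist, $\lambda_{max}-\lambda_t(a_t^L)+2\delta_t(a_t^L)$ if only $a_t^L$ exists, $\lambda_t(a_t^U)+2\delta_t(a_t^U)$ if only $a_t^U$ exists. For fixed data put $B=F+S$ with $$F=\sum_{t=1}^T\mathbb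 E^{\pi^b}\Big[\tfrac{\mathbb P_t^{\pi^*}(A_t)}{\mathbb P_t^{\pi^b}(A_t)}\sqrt{\tfrac{\log N_t(A_t)}{N_t(A_t)}}\,\mathbf 1(A_t\in\mathcal M_t)\Big],\qquad S=\sum_{t=1}^T\mathbb E^{\pi^*}\big[\eta_t(A_t)\mathbf 1(A_t\notin\mathcal M_t)\big]$$ (the term of a price with $N_t=0$ in $F$ being $0$). **Theorem.** There is $c_0>0$, depending only on $\lambda_{max}$, such that for every $c\ge c_0$, $\lambda_{min}\le\lambda_{max}$, $L$ and $\bar a$ the following hold. 1. There is $C>0$, depending only on these parameters, such that for all $T$, $N\ge 1$, $\mathcal A\subset[0,\bar a]$ and all processes and $\pi^*$ as above, the probability that $\mu^{\mathbf{pess}}\le C\,B$ is at least $1-\sum_{t=1}^T\big(\mathbb E\big[\sum_{a\in\mathcal A_t^{\mathcal D_N}}N_t(a)^{-1}\big]+\kappa_t\big)$. 2. The bound is attainable. Let $\lambda_{min}<\lambda_{max}$, $L\ge1$, $\bar a>0$ and $T\ge1$. There is $c'>0$ such that: (a) there are a price set $\mathcal A\subset(0,\bar a]$ and, for each $N$,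 a process as above, with strictly decreasing $\lambda_t$ and with $c'\,\mathbb P_t^{\pi^*}(a)\le\mathbb P_t^{\pi^b}(a)$ for all $t$, $a$ and every optimal $\pi^*$ (so $S=0$), for which the probability that $F\ge c'\sqrt{\log N/N}$ and $\mu^{\mathbf{pess}}\ge c'B$ tends to $1$ as $N\to\infty$, uniformly in the optimal $\pi^*$; (b) there is $w_0>0$ such that for every scale $w\in(0,w_0]$ there are a price set $\mathcal A\subset(0,\bar a]$ and two processes as above with strictly decreasing demand parameters, which differ in these parameters but induce the same distribution of the data, such that for one of them the probability that $c'w\le S\le w$ and $\mu^{\mathbf{pess}}\ge c'B$ tends to $1$ as $N\to\infty$, uniformly in the optimal $\pi^*$. -/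

import Mathlib

open MeasureTheory ProbabilityTheory
open scoped NNReal ENNReal

noncomputable section

namespace OfflinePricing

/-- One period of a trajectory: inventory level in `{0, …, L}`, price in the finite set `𝒜`,
demand in `ℕ`. -/
abbrev Step (L : ℕ) (𝒜 : Finset ℝ) : Type := Fin (L + 1) × 𝒜 × ℕ

/-- A (randomised, history-dependent) policy. Periods are numbered `0, 1, 2, …`; in period `t` it
maps the past `t` steps and the current inventory level to a distribution over the prices. -/
abbrev Policy (L : ℕ) (𝒜 : Finset ℝ) : Type :=
  (t : ℕ) → (Fin t → Step L 𝒜) → Fin (L + 1) → PMF 𝒜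

/-- Inventory after demand `d` at level `x`: `x - min x d`, without replenishment. -/
def nextLevel {L : ℕ} (x : Fin (L + 1)) (d : ℕ) : Fin (L + 1) :=
  ⟨(x : ℕ) - min (x : ℕ) d, lt_of_le_of_lt (Nat.sub_le _ _) x.isLt⟩

/-- A data-generating process: the law of the initial inventory, the Poisson demand parameters
`lam t a`, and the behavior policy. -/
structure Model (L : ℕ) (𝒜 : Finset ℝ) where
  start : PMF (Fin (L + 1))
  lam : ℕ → 𝒜 → ℝ≥0
  behavior : Policy L 𝒜

/-- A data set of `N` trajectories over `T` periods. -/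
abbrev Data (T N L : ℕ) (𝒜 : Finset ℝ) : Type := Fin N → Fin T → Step L 𝒜

/-- The Markov policy that posts the price `act t x` in period `t` at inventory level `x`. -/
def markovPolicy {L : ℕ} {𝒜 : Finset ℝ} (act : ℕ → Fin (L + 1) → 𝒜) : Policy L 𝒜 :=
  fun t _ x => PMF.pure (act t x)

/-- `∑_{t} min(D_t, X_t) * A_t`. -/
def totalReward {T L : ℕ} {𝒜 : Finset ℝ} (w : Fin T → Step L 𝒜) : ℝ :=
  ∑ t, (min (w t).2.2 ((w t).1 : ℕ) : ℝ) * ((w t).2.1 : ℝ)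

namespace Model

variable {L : ℕ} {𝒜 : Finset ℝ}

/-- Demand parameters lie in `[lmin, lmax]` and are non-increasing in the price, in each of the
`T` periods. -/
structure Admissible (M : Model L 𝒜) (T : ℕ) (lmin lmax : ℝ≥0) : Prop where
  lower : ∀ t < T, ∀ a, lmin ≤ M.lam t a
  upper : ∀ t < T, ∀ a, M.lam t a ≤ lmax
  mono : ∀ t < T, Antitone (M.lam t)

/-- Joint law of the first `n` steps and of the inventory level after them, under the policy `π`,
when the initial inventory has law `s`. -/
def pathPMF (M : Model L 𝒜) (s : PMF (Fin (L + 1))) (π : Policy L 𝒜) :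
    (n : ℕ) → PMF ((Fin n → Step L 𝒜) × Fin (L + 1))
  | 0 => s.map fun x => (fun i => i.elim0, x)
  | n + 1 => (pathPMF M s π n).bind fun h =>
      (π n h.1 h.2).bind fun a =>
        (poissonMeasure (M.lam n a)).toPMF.map fun d =>
          (Fin.snoc (α := fun _ => Step L 𝒜) h.1 (h.2, a, d), nextLevel h.2 d)

/-- Law of the trajectory over `T` periods. -/
def trajLaw (M : Model L 𝒜) (T : ℕ) (s : PMF (Fin (L + 1))) (π : Policy L 𝒜) :
    Measure (Fin T → Step L 𝒜) :=
  ((M.pathPMF s π T).map Prod.fst).toMeasure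

/-- Law of one trajectory of the offline data. -/
def behaviorLaw (M : Model L 𝒜) (T : ℕ) : Measure (Fin T → Step L 𝒜) :=
  M.trajLaw T M.start M.behavior

/-- Law of the offline data: `N` independent trajectories under the behavior policy. -/
def dataLaw (M : Model L 𝒜) (T N : ℕ) : Measure (Data T N L 𝒜) :=
  Measure.pi fun _ => M.behaviorLaw T

/-- `V₁^π(x)`: expected total reward of `π` over `T` periods, starting from inventory `x`. -/
def value (M : Model L 𝒜) (T : ℕ) (π : Policy L 𝒜) (x : Fin (L + 1)) : ℝ :=
  ∫ w, totalReward w ∂(M.trajLaw T (PMF.pure x) π)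

/-- `V₁^*(x)`. -/
def optValue (M : Model L 𝒜) (T : ℕ) (x : Fin (L + 1)) : ℝ :=
  ⨆ π : Policy L 𝒜, M.value T π x

/-- The regret `E[V₁^*(X₁) - V₁^π(X₁)]`. -/
def regret (M : Model L 𝒜) (T : ℕ) (π : Policy L 𝒜) : ℝ :=
  ∫ x, (M.optValue T x - M.value T π x) ∂M.start.toMeasure

/-- `π` maximises the expected total reward among all policies. -/
def IsOptimal (M : Model L 𝒜) (T : ℕ) (π : Policy L 𝒜) : Prop :=
  ∀ π' : Policy L 𝒜,
    ∫ w, totalReward w ∂(M.trajLaw T M.start π') ≤ ∫ w, totalReward w ∂(M.trajLaw T M.start π)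

/-- `P_t^π(a)`: probability that the price in period `t` is `a` under `π`. -/
def priceProb (M : Model L 𝒜) (T : ℕ) (π : Policy L 𝒜) (t : Fin T) (a : 𝒜) : ℝ :=
  (M.trajLaw T M.start π).real {w | (w t).2.1 = a}

open Classical in
/-- `κ_t = ∑ (1 - P_t^b(a))^N` over the prices `a` with `P_t^b(a) > 0`. -/
def kappa (M : Model L 𝒜) (T N : ℕ) (t : Fin T) : ℝ :=
  ∑ a ∈ Finset.univ.filter (fun a : 𝒜 => 0 < M.priceProb T M.behavior t a),
    (1 - M.priceProb T M.behavior t a) ^ N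

end Model

section Estimation

variable {T N L : ℕ} {𝒜 : Finset ℝ}

/-- `N_t(a)`. -/
def count (𝒟 : Data T N L 𝒜) (t : Fin T) (a : 𝒜) : ℕ :=
  (Finset.univ.filter fun i => (𝒟 i t).2.1 = a).card

/-- The prices observed in period `t`. -/
def observed (𝒟 : Data T N L 𝒜) (t : Fin T) : Finset 𝒜 :=
  Finset.univ.filter fun a => 0 < count 𝒟 t a

/-- Average demand in period `t` over the `N_t(a)` trajectories with price `a`. -/
def lamHat (𝒟 : Data T N L 𝒜) (t : Fin T) (a : 𝒜) : ℝ :=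
  (∑ i, if (𝒟 i t).2.1 = a then ((𝒟 i t).2.2 : ℝ) else 0) / count 𝒟 t a

/-- `√(log N_t(a) / N_t(a))`. -/
def rate (𝒟 : Data T N L 𝒜) (t : Fin T) (a : 𝒜) : ℝ :=
  Real.sqrt (Real.log (count 𝒟 t a) / count 𝒟 t a)

/-- `δ_t(a)`. -/
def delta (c : ℝ) (𝒟 : Data T N L 𝒜) (t : Fin T) (a : 𝒜) : ℝ := c * rate 𝒟 t a

/-- Observed prices `≥ a`. -/
def obsAbove (𝒟 : Data T N L 𝒜) (t : Fin T) (a : 𝒜) : Finset 𝒜 :=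
  (observed 𝒟 t).filter fun a' => a ≤ a'

/-- Observed prices `≤ a`. -/
def obsBelow (𝒟 : Data T N L 𝒜) (t : Fin T) (a : 𝒜) : Finset 𝒜 :=
  (observed 𝒟 t).filter fun a' => a' ≤ a

/-- Lower end of the refined interval `Ω_t(a)`. -/
def lamLower (c : ℝ) (lmin : ℝ≥0) (𝒟 : Data T N L 𝒜) (t : Fin T) (a : 𝒜) : ℝ :=
  if h : (obsAbove 𝒟 t a).Nonempty then
    (obsAbove 𝒟 t a).sup' h fun a' => max (lamHat 𝒟 t a' - delta c 𝒟 t a') lmin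
  else lmin

/-- Upper end of the refined interval `Ω_t(a)`. -/
def lamUpper (c : ℝ) (lmax : ℝ≥0) (𝒟 : Data T N L 𝒜) (t : Fin T) (a : 𝒜) : ℝ :=
  if h : (obsBelow 𝒟 t a).Nonempty then
    (obsBelow 𝒟 t a).inf' h fun a' => min (lamHat 𝒟 t a' + delta c 𝒟 t a') lmax
  else lmax

/-- Poisson weight `e^{-l} l^d / d!`. -/
def poissonWeight (l : ℝ) (d : ℕ) : ℝ := Real.exp (-l) * l ^ d / d.factorial

/-- Bellman operator with demand parameter `l`, applied to the continuation value `V` (with the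
convention that an empty inventory has value `0`). -/
def bellman (l : ℝ) (V : Fin (L + 1) → ℝ) (x : Fin (L + 1)) (a : ℝ) : ℝ :=
  ∑ d ∈ Finset.range ((x : ℕ) + 1), poissonWeight l d * (d * a)
    + a * (x : ℕ) * ∑' d : ℕ, poissonWeight l ((x : ℕ) + 1 + d)
    + ∑ d ∈ Finset.range (x : ℕ), V (nextLevel x d) * poissonWeight l d

/-- Minimum over `l ∈ Ω_t(a)` of the Bellman operator applied to `V`. -/
def worstBellman (c : ℝ) (lmin lmax : ℝ≥0) (𝒟 : Data T N L 𝒜) (t : Fin T)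
    (V : Fin (L + 1) → ℝ) (x : Fin (L + 1)) (a : 𝒜) : ℝ :=
  sInf ((fun l : ℝ => bellman l V x (a : ℝ)) ''
    Set.Icc (lamLower c lmin 𝒟 t a) (lamUpper c lmax 𝒟 t a))

/-- Pessimistic value function, by backward recursion from `0` after the last period. -/
def pessValue (c : ℝ) (lmin lmax : ℝ≥0) (𝒟 : Data T N L 𝒜) (t : ℕ) (x : Fin (L + 1)) : ℝ :=
  if h : t < T then
    ⨆ a : 𝒜, worstBellman c lmin lmax 𝒟 ⟨t, h⟩ (fun y => pessValue c lmin lmax 𝒟 (t + 1) y) x a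
  else 0
termination_by T - t

/-- Pessimistic Q-function. -/
def pessQ (c : ℝ) (lmin lmax : ℝ≥0) (𝒟 : Data T N L 𝒜) (t : Fin T) (x : Fin (L + 1))
    (a : 𝒜) : ℝ :=
  worstBellman c lmin lmax 𝒟 t (pessValue c lmin lmax 𝒟 ((t : ℕ) + 1)) x a

/-- `act` is an output of the refined pessimistic algorithm on the data `𝒟`: a maximiser of the
pessimistic Q-function at every period and inventory level, with ties broken in any way. -/
def IsPessimistic (c : ℝ) (lmin lmax : ℝ≥0) (𝒟 : Data T N L 𝒜)
    (act : ℕ → Fin (L + 1) → 𝒜) : Prop :=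
  ∀ (t : Fin T) (x : Fin (L + 1)) (a : 𝒜),
    pessQ c lmin lmax 𝒟 t x a ≤ pessQ c lmin lmax 𝒟 t x (act t x)

/-- `η_t(a)`. The largest observed price `≤ a` is `a` itself if `a` is observed, and otherwise the
closest observed price below `a`; similarly above. If no price at all is observed (so `N = 0`) the
value is irrelevant. -/
def eta (M : Model L 𝒜) (c : ℝ) (lmax : ℝ≥0) (𝒟 : Data T N L 𝒜) (t : Fin T) (a : 𝒜) : ℝ :=
  if hU : (obsBelow 𝒟 t a).Nonempty then
    let aU := (obsBelow 𝒟 t a).max' hU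
    if hL : (obsAbove 𝒟 t a).Nonempty then
      let aL := (obsAbove 𝒟 t a).min' hL
      (M.lam t aU : ℝ) - M.lam t aL + 2 * delta c 𝒟 t aU + 2 * delta c 𝒟 t aL
    else (M.lam t aU : ℝ) + 2 * delta c 𝒟 t aU
  else if hL : (obsAbove 𝒟 t a).Nonempty then
    let aL := (obsAbove 𝒟 t a).min' hL
    (lmax : ℝ) - M.lam t aL + 2 * delta c 𝒟 t aL
  else 0

/-- `M_t`: the prices `a` such that `P_t^{π*}(a) > 0` implies `P_t^b(a) > 0`. -/
def covered (M : Model L 𝒜) (T : ℕ) (πs : Policy L 𝒜) (t : Fin T) : Set 𝒜 :=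
  {a | 0 < M.priceProb T πs t a → 0 < M.priceProb T M.behavior t a}

/-- Estimation part of the regret bound; the data are fixed, and the expectation is over a
trajectory of the behavior policy. -/
def estimationTerm (M : Model L 𝒜) (πs : Policy L 𝒜) (𝒟 : Data T N L 𝒜) : ℝ :=
  ∑ t : Fin T, ∫ w, (covered M T πs t).indicator
      (fun a => M.priceProb T πs t a / M.priceProb T M.behavior t a * rate 𝒟 t a) (w t).2.1
    ∂(M.behaviorLaw T)

/-- Partial-identification part of the regret bound; the data are fixed, and the expectation is
over a trajectory of `πs`. -/
def identificationTerm (M : Model L 𝒜) (c : ℝ) (lmax : ℝ≥0) (πs : Policy L 𝒜)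
    (𝒟 : Data T N L 𝒜) : ℝ :=
  ∑ t : Fin T, ∫ w, (covered M T πs t)ᶜ.indicator (fun a => eta M c lmax 𝒟 t a) (w t).2.1
    ∂(M.trajLaw T M.start πs)

/-- The regret bound, up to a constant factor. -/
def regretBound (M : Model L 𝒜) (c : ℝ) (lmax : ℝ≥0) (πs : Policy L 𝒜)
    (𝒟 : Data T N L 𝒜) : ℝ :=
  estimationTerm M πs 𝒟 + identificationTerm M c lmax πs 𝒟

end Estimation

end OfflinePricing

end

/-!
By the performance difference identity the regret of a policy is the expected sum of its
suboptimality gaps. As long as every confidence interval contains the true demand parameter, the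
pessimistic value is at most the value of the pessimistic policy, so that the same identity, applied
to the pessimistic value functions along the optimal policy, leaves only the errors of replacing the
demand parameters by the worst ones in the intervals. The Bellman operator is Lipschitz in the
parameter, and an interval is short when its price was posted; otherwise monotonicity bounds its
length by `eta`. Conditionally on which trajectories post a given price in a given period, its
demands are independent Poisson variables, so a Chernoff bound shows that its interval fails with
probability at most `1 / n` after `n` observations; summing over prices and adding the probability
`kappa` that some price with positive probability is never observed gives the stated probability.

Both terms are attained with one unit in stock in the last period, where the choice of a price `a`
only matters through the unit revenue `a * (1 - exp (-λ))`. For the estimation term, the better of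
two prices is posted so much more rarely than the other that the difference of the confidence radii
hides its advantage, of the order of `√(log N / N)`; for the identification term, the best of three
prices is never posted.
-/

noncomputable section

namespace OfflinePricing

/-! ### Laws along a trajectory -/

section FiniteExpectation

variable {α β : Type*} [MeasurableSpace β]

theorem integral_map_toMeasure [MeasurableSpace α] [DiscreteMeasurableSpace α]
    [DiscreteMeasurableSpace β] (p : PMF α) (g : α → β) (f : β → ℝ) :
    ∫ y, f y ∂(p.map g).toMeasure = ∫ x, f (g x) ∂p.toMeasure := by
  rw [← PMF.toMeasure_map _ _ .of_discrete, integral_map Measurable.of_discrete.aemeasurable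
    Measurable.of_discrete.aestronglyMeasurable]

theorem toMeasure_bind [Fintype α] (p : PMF α) (q : α → PMF β) :
    (p.bind q).toMeasure = ∑ a, p a • (q a).toMeasure := by
  ext s hs
  simp [PMF.toMeasure_bind_apply _ _ _ hs, tsum_fintype]

variable [Finite α]

theorem integrable_bind_toMeasure (p : PMF α) {q : α → PMF β} {f : β → ℝ}
    (hf : ∀ a, Integrable f (q a).toMeasure) : Integrable f (p.bind q).toMeasure := by
  have := Fintype.ofFinite α
  rw [toMeasure_bind, integrable_finsetSum_measure]
  exact fun a _ => (hf a).smul_measure (p.apply_ne_top a)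

variable [MeasurableSpace α] [MeasurableSingletonClass α]

theorem integral_bind_toMeasure (p : PMF α) {q : α → PMF β} {f : β → ℝ}
    (hf : ∀ a, Integrable f (q a).toMeasure) :
    ∫ y, f y ∂(p.bind q).toMeasure = ∫ a, ∫ y, f y ∂(q a).toMeasure ∂p.toMeasure := by
  have := Fintype.ofFinite α
  rw [toMeasure_bind, PMF.integral_eq_sum,
    integral_finsetSum_measure fun a _ => (hf a).smul_measure (p.apply_ne_top a)]
  simp only [integral_smul_measure]

theorem toReal_mul_le_integral (p : PMF α) {f : α → ℝ} (hf : ∀ a, 0 ≤ f a) (a : α) :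
    (p a).toReal * f a ≤ ∫ b, f b ∂p.toMeasure := by
  have := Fintype.ofFinite α
  rw [PMF.integral_eq_sum]
  exact Finset.single_le_sum (f := fun b => (p b).toReal * f b)
    (fun b _ => mul_nonneg ENNReal.toReal_nonneg (hf b)) (Finset.mem_univ a)

end FiniteExpectation

theorem integrable_of_forall_abs_le {α : Type*} [MeasurableSpace α] [DiscreteMeasurableSpace α]
    (μ : Measure α) [IsFiniteMeasure μ] {f : α → ℝ} {K : ℝ}
    (hf : ∀ a, |f a| ≤ K) : Integrable f μ :=
  .of_bound Measurable.of_discrete.aestronglyMeasurable K (.of_forall hf)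

theorem integrable_nextLevel {L : ℕ} (μ : Measure ℕ) [IsFiniteMeasure μ] (V : Fin (L + 1) → ℝ)
    (x : Fin (L + 1)) : Integrable (fun d : ℕ => V (nextLevel x d)) μ :=
  integrable_of_forall_abs_le μ fun d =>
    Finset.single_le_sum (f := fun y => |V y|) (fun _ _ => abs_nonneg _)
      (Finset.mem_univ (nextLevel x d))

namespace Model

variable {L : ℕ} {𝒜 : Finset ℝ}

/-- Joint law of inventory level and price in period `n`, under `π` and initial law `s`. -/
def jointLaw (M : Model L 𝒜) (s : PMF (Fin (L + 1))) (π : Policy L 𝒜) (n : ℕ) :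
    PMF (Fin (L + 1) × 𝒜) :=
  (M.pathPMF s π n).bind fun h => (π n h.1 h.2).map fun a => (h.2, a)

/-- Law of the inventory level in period `n`, under `π` and initial law `s`. -/
def levelLaw (M : Model L 𝒜) (s : PMF (Fin (L + 1))) (π : Policy L 𝒜) (n : ℕ) :
    PMF (Fin (L + 1)) :=
  (M.pathPMF s π n).map Prod.snd

/-- Law of the step (level, price and demand) of period `n`, under `π` and initial law `s`. -/
def stepLaw (M : Model L 𝒜) (s : PMF (Fin (L + 1))) (π : Policy L 𝒜) (n : ℕ) :
    PMF (Step L 𝒜) :=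
  (M.jointLaw s π n).bind fun z =>
    (poissonMeasure (M.lam n z.2)).toPMF.map fun d => (z.1, z.2, d)

variable (M : Model L 𝒜) (s : PMF (Fin (L + 1))) (π : Policy L 𝒜) {T : ℕ} (t : Fin T)

theorem pathPMF_eq_bind (n : ℕ) :
    M.pathPMF s π n = s.bind fun x => M.pathPMF (PMF.pure x) π n := by
  induction n with
  | zero =>
    simp only [pathPMF, PMF.pure_map]
    rfl
  | succ n ih => rw [pathPMF, ih, PMF.bind_bind]; rfl

theorem jointLaw_eq_bind (n : ℕ) :
    M.jointLaw s π n = s.bind fun x => M.jointLaw (PMF.pure x) π n := by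
  rw [jointLaw, pathPMF_eq_bind, PMF.bind_bind]
  rfl

theorem levelLaw_zero : M.levelLaw s π 0 = s := by
  simp only [levelLaw, pathPMF, PMF.map_comp]
  exact PMF.map_id s

theorem levelLaw_succ (n : ℕ) :
    M.levelLaw s π (n + 1) = (M.stepLaw s π n).map fun z => nextLevel z.1 z.2.2 := by
  simp only [levelLaw, pathPMF, stepLaw, jointLaw, PMF.map_bind, PMF.bind_bind, PMF.map_comp,
    PMF.bind_map, Function.comp_def]

theorem map_fst_jointLaw (n : ℕ) : (M.jointLaw s π n).map Prod.fst = M.levelLaw s π n := by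
  simp only [levelLaw, jointLaw, PMF.map_bind, PMF.map_comp, Function.comp_def]
  rw [← PMF.bind_pure_comp]
  congr 1
  funext h
  exact PMF.map_const _ _

theorem map_snd_stepLaw (n : ℕ) :
    (M.stepLaw s π n).map (fun z => z.2.1) = (M.jointLaw s π n).map Prod.snd := by
  simp only [stepLaw, PMF.map_bind, PMF.map_comp, Function.comp_def]
  rw [← PMF.bind_pure_comp]
  congr 1
  funext z
  exact PMF.map_const _ _

theorem jointLaw_markovPolicy (act : ℕ → Fin (L + 1) → 𝒜) (n : ℕ) :
    M.jointLaw s (markovPolicy act) n =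
      (M.levelLaw s (markovPolicy act) n).map fun x => (x, act n x) := by
  simp only [levelLaw, jointLaw, markovPolicy, PMF.map_comp, PMF.pure_map]
  rw [← PMF.bind_pure_comp]
  rfl

theorem map_eval_pathPMF : ((M.pathPMF s π T).map Prod.fst).map (· t) = M.stepLaw s π t := by
  induction T with
  | zero => exact t.elim0
  | succ T ih =>
    simp only [pathPMF, PMF.map_comp, PMF.map_bind, Function.comp_def]
    refine Fin.lastCases ?_ (fun t => ?_) t
    · simp only [Fin.snoc_last, Fin.val_last, stepLaw, jointLaw, PMF.bind_bind, PMF.bind_map,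
        Function.comp_def]
    · simp only [Fin.snoc_castSucc, Fin.val_castSucc, ← ih t, PMF.map_comp]
      rw [← PMF.bind_pure_comp]
      congr 1
      funext h
      have : ∀ a, PMF.map (fun _ : ℕ => h.1 t) (poissonMeasure (M.lam T a)).toPMF
          = PMF.pure (h.1 t) := fun a => PMF.map_const _ _
      simp only [this, PMF.bind_const, Function.comp_apply]

theorem map_eval_trajLaw :
    (M.trajLaw T s π).map (fun w => w t) = (M.stepLaw s π t).toMeasure := by
  rw [trajLaw, PMF.toMeasure_map _ _ (measurable_pi_apply t), map_eval_pathPMF]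

instance : IsProbabilityMeasure (M.trajLaw T s π) := by
  unfold trajLaw; infer_instance

instance : IsProbabilityMeasure (M.behaviorLaw T) := by
  unfold behaviorLaw; infer_instance

instance (N : ℕ) : IsProbabilityMeasure (M.dataLaw T N) := by
  unfold dataLaw; infer_instance

theorem integrable_map_poisson {β : Type*} [MeasurableSpace β] [DiscreteMeasurableSpace β]
    [Countable β] {l : ℝ≥0} (g : ℕ → β) {f : β → ℝ}
    (hf : Integrable (fun d => f (g d)) (poissonMeasure l)) :
    Integrable f ((poissonMeasure l).toPMF.map g).toMeasure := by
  rwa [← PMF.toMeasure_map _ _ .of_discrete, Measure.toPMF_toMeasure,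
    integrable_map_measure .of_discrete Measurable.of_discrete.aemeasurable]

theorem integral_stepLaw (n : ℕ) {g : Step L 𝒜 → ℝ}
    (hg : ∀ x a, Integrable (fun d => g (x, a, d)) (poissonMeasure (M.lam n a))) :
    ∫ y, g y ∂(M.stepLaw s π n).toMeasure =
      ∫ z, ∫ d, g (z.1, z.2, d) ∂(poissonMeasure (M.lam n z.2))
        ∂(M.jointLaw s π n).toMeasure := by
  have h (z : Fin (L + 1) × 𝒜) : Integrable g
      ((poissonMeasure (M.lam n z.2)).toPMF.map fun d => (z.1, z.2, d)).toMeasure :=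
    integrable_map_poisson _ (hg z.1 z.2)
  rw [stepLaw, integral_bind_toMeasure _ h]
  simp only [integral_map_toMeasure, Measure.toPMF_toMeasure]

theorem integrable_eval_trajLaw {g : Step L 𝒜 → ℝ}
    (hg : ∀ x a, Integrable (fun d => g (x, a, d)) (poissonMeasure (M.lam t a))) :
    Integrable (fun w => g (w t)) (M.trajLaw T s π) := by
  refine (integrable_map_measure (g := g) .of_discrete (measurable_pi_apply t).aemeasurable).1 ?_
  rw [map_eval_trajLaw, stepLaw]
  exact integrable_bind_toMeasure _ fun z =>
    integrable_map_poisson (fun d => (z.1, z.2, d)) (f := g) (hg z.1 z.2)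

theorem integral_eval_trajLaw {g : Step L 𝒜 → ℝ}
    (hg : ∀ x a, Integrable (fun d => g (x, a, d)) (poissonMeasure (M.lam t a))) :
    ∫ w, g (w t) ∂(M.trajLaw T s π) =
      ∫ z, ∫ d, g (z.1, z.2, d) ∂(poissonMeasure (M.lam t z.2))
        ∂(M.jointLaw s π t).toMeasure := by
  rw [← M.integral_stepLaw s π t hg, ← map_eval_trajLaw,
    integral_map (measurable_pi_apply t).aemeasurable .of_discrete]

theorem integral_levelLaw (n : ℕ) (f : Fin (L + 1) → ℝ) :
    ∫ x, f x ∂(M.levelLaw s π n).toMeasure = ∫ z, f z.1 ∂(M.jointLaw s π n).toMeasure := by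
  rw [← map_fst_jointLaw, integral_map_toMeasure]

theorem integral_levelLaw_succ (n : ℕ) (f : Fin (L + 1) → ℝ) :
    ∫ x, f x ∂(M.levelLaw s π (n + 1)).toMeasure =
      ∫ z, ∫ d, f (nextLevel z.1 d) ∂(poissonMeasure (M.lam n z.2))
        ∂(M.jointLaw s π n).toMeasure := by
  rw [levelLaw_succ, integral_map_toMeasure, integral_stepLaw]
  exact fun x a => integrable_nextLevel _ f x

theorem integral_jointLaw_markovPolicy (act : ℕ → Fin (L + 1) → 𝒜) (n : ℕ)
    (f : Fin (L + 1) × 𝒜 → ℝ) :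
    ∫ z, f z ∂(M.jointLaw s (markovPolicy act) n).toMeasure =
      ∫ x, f (x, act n x) ∂(M.levelLaw s (markovPolicy act) n).toMeasure := by
  rw [jointLaw_markovPolicy, integral_map_toMeasure]

theorem priceProb_eq (a : 𝒜) :
    M.priceProb T π t a = ((M.jointLaw M.start π t).map Prod.snd a).toReal := by
  rw [← map_snd_stepLaw, ← PMF.toMeasure_apply_singleton _ _ (.of_discrete),
    ← PMF.toMeasure_map _ _ .of_discrete, ← map_eval_trajLaw,
    Measure.map_apply .of_discrete .of_discrete,
    Measure.map_apply (measurable_pi_apply t) .of_discrete]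
  rfl

theorem toReal_jointLaw_le_priceProb (z : Fin (L + 1) × 𝒜) :
    (M.jointLaw M.start π t z).toReal ≤ M.priceProb T π t z.2 := by
  rw [priceProb_eq]
  refine ENNReal.toReal_mono (PMF.apply_ne_top _ _) ?_
  rw [PMF.map_apply]
  exact le_of_eq_of_le (if_pos rfl).symm (ENNReal.le_tsum z)

theorem integral_jointLaw_snd (g : 𝒜 → ℝ) :
    ∫ z, g z.2 ∂(M.jointLaw M.start π t).toMeasure = ∑ a, M.priceProb T π t a * g a := by
  rw [← integral_map_toMeasure _ Prod.snd g, PMF.integral_eq_sum]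
  simp only [priceProb_eq, smul_eq_mul]

theorem integral_price (g : 𝒜 → ℝ) :
    ∫ w, g (w t).2.1 ∂(M.trajLaw T M.start π) = ∑ a, M.priceProb T π t a * g a := by
  rw [M.integral_eval_trajLaw M.start π t (g := fun y : Step L 𝒜 => g y.2.1)
    fun _ _ => by simp, ← integral_jointLaw_snd]
  simp only [integral_const, probReal_univ, one_smul]

theorem priceProb_nonneg (a : 𝒜) : 0 ≤ M.priceProb T π t a :=
  measureReal_nonneg

theorem sum_priceProb : ∑ a, M.priceProb T π t a = 1 := by
  simpa using (M.integral_price π t fun _ => 1).symm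

end Model

/-! ### Poisson weights and the Bellman operator -/

theorem poissonWeight_nonneg {l : ℝ} (hl : 0 ≤ l) (d : ℕ) : 0 ≤ poissonWeight l d := by
  unfold poissonWeight; positivity

theorem hasSum_poissonWeight (l : ℝ) : HasSum (poissonWeight l) 1 := by
  have h := (NormedSpace.expSeries_div_hasSum_exp l).mul_left (Real.exp (-l))
  rw [← Real.exp_eq_exp_ℝ, ← Real.exp_add, neg_add_cancel, Real.exp_zero] at h
  unfold poissonWeight
  simpa only [mul_div_assoc] using h

theorem poissonWeight_le_one {l : ℝ} (hl : 0 ≤ l) (d : ℕ) : poissonWeight l d ≤ 1 :=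
  le_hasSum (hasSum_poissonWeight l) d fun _ _ => poissonWeight_nonneg hl _

theorem poissonWeight_zero (l : ℝ) : poissonWeight l 0 = Real.exp (-l) := by
  simp [poissonWeight]

theorem hasDerivAt_poissonWeight_zero (l : ℝ) :
    HasDerivAt (fun l => poissonWeight l 0) (-poissonWeight l 0) l := by
  simp only [poissonWeight_zero]
  simpa using (hasDerivAt_neg l).exp

theorem hasDerivAt_poissonWeight_succ (l : ℝ) (d : ℕ) :
    HasDerivAt (fun l => poissonWeight l (d + 1))
      (poissonWeight l d - poissonWeight l (d + 1)) l := by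
  have h := (((hasDerivAt_neg l).exp).mul (hasDerivAt_pow (d + 1) l)).div_const
    ((d + 1).factorial : ℝ)
  refine h.congr_deriv ?_
  simp only [poissonWeight, Nat.factorial_succ]
  have := Nat.factorial_ne_zero d
  push_cast
  field_simp
  ring

theorem abs_poissonWeight_sub_le {l l' : ℝ} (hl : 0 ≤ l) (hl' : 0 ≤ l') (d : ℕ) :
    |poissonWeight l d - poissonWeight l' d| ≤ |l - l'| := by
  obtain ⟨f', hf', hbound⟩ : ∃ f' : ℝ → ℝ,
      (∀ y, HasDerivAt (fun l => poissonWeight l d) (f' y) y) ∧ ∀ y, 0 ≤ y → ‖f' y‖ ≤ 1 := by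
    cases d with
    | zero =>
      refine ⟨_, hasDerivAt_poissonWeight_zero, fun y hy => ?_⟩
      rw [norm_neg, Real.norm_of_nonneg (poissonWeight_nonneg hy 0)]
      exact poissonWeight_le_one hy 0
    | succ d =>
      refine ⟨_, fun y => hasDerivAt_poissonWeight_succ y d, fun y hy => ?_⟩
      rw [Real.norm_eq_abs, abs_sub_le_iff]
      constructor <;> linarith [poissonWeight_nonneg hy d, poissonWeight_nonneg hy (d + 1),
        poissonWeight_le_one hy d, poissonWeight_le_one hy (d + 1)]
  simpa using (convex_Ici (0 : ℝ)).norm_image_sub_le_of_norm_hasDerivWithin_le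
    (fun y _ => (hf' y).hasDerivWithinAt) hbound hl' hl

theorem tsum_poissonWeight_tail (l : ℝ) (k : ℕ) :
    ∑' d, poissonWeight l (k + d) = 1 - ∑ d ∈ Finset.range k, poissonWeight l d := by
  have h := (hasSum_poissonWeight l).summable.sum_add_tsum_nat_add k
  rw [(hasSum_poissonWeight l).tsum_eq] at h
  simp_rw [add_comm k]
  linarith

section Bellman

variable {L : ℕ}

theorem nextLevel_of_le {x : Fin (L + 1)} {d : ℕ} (h : (x : ℕ) ≤ d) : nextLevel x d = 0 := by
  ext; simp [nextLevel, h]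

theorem cast_nextLevel (x : Fin (L + 1)) (d : ℕ) :
    ((nextLevel x d : ℕ) : ℝ) = (x : ℕ) - min (d : ℝ) (x : ℕ) := by
  rw [nextLevel, Nat.cast_sub (min_le_left _ _), Nat.cast_min, min_comm]

/-- Writing `min d x = x - (x - d)⁺` and using that the weights sum to one turns the Bellman
operator into a finite sum. -/
theorem bellman_eq (l : ℝ) (V : Fin (L + 1) → ℝ) (x : Fin (L + 1)) (a : ℝ) :
    bellman l V x a = a * (x : ℕ) + ∑ d ∈ Finset.range (x : ℕ),
      poissonWeight l d * (V (nextLevel x d) - a * ((x : ℕ) - d)) := by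
  have h : ∑ d ∈ Finset.range (x : ℕ), poissonWeight l d * (V (nextLevel x d) - a * ((x : ℕ) - d))
      = ∑ d ∈ Finset.range (x : ℕ), V (nextLevel x d) * poissonWeight l d
        - a * (x : ℕ) * ∑ d ∈ Finset.range (x : ℕ), poissonWeight l d
        + ∑ d ∈ Finset.range (x : ℕ), poissonWeight l d * (d * a) := by
    rw [Finset.mul_sum, ← Finset.sum_sub_distrib, ← Finset.sum_add_distrib]
    exact Finset.sum_congr rfl fun d _ => by ring
  rw [bellman, tsum_poissonWeight_tail, Finset.sum_range_succ, Finset.sum_range_succ, h]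
  ring

theorem bellman_zero (l : ℝ) (V : Fin (L + 1) → ℝ) (a : ℝ) : bellman l V 0 a = 0 := by
  simp [bellman_eq]

theorem bellman_of_val_eq_one (l : ℝ) (V : Fin (L + 1) → ℝ) {x : Fin (L + 1)}
    (hx : (x : ℕ) = 1) (a : ℝ) :
    bellman l V x a = a * (1 - Real.exp (-l)) + V (nextLevel x 0) * Real.exp (-l) := by
  rw [bellman_eq, hx, Finset.sum_range_one, poissonWeight_zero]
  push_cast
  ring

theorem integrable_reward (μ : Measure ℕ) [IsFiniteMeasure μ] (x : Fin (L + 1)) (a : ℝ) :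
    Integrable (fun d : ℕ => min (d : ℝ) (x : ℕ) * a) μ := by
  refine integrable_of_forall_abs_le μ (K := (x : ℕ) * |a|) fun d => ?_
  rw [abs_mul, abs_of_nonneg (by positivity)]
  gcongr
  exact min_le_right _ _

theorem bellman_eq_integral (l : ℝ≥0) {V : Fin (L + 1) → ℝ} (hV : V 0 = 0) (x : Fin (L + 1))
    (a : ℝ) : bellman l V x a =
      ∫ d : ℕ, (min (d : ℝ) (x : ℕ) * a + V (nextLevel x d)) ∂(poissonMeasure l) := by
  set g : ℕ → ℝ := fun d => min (d : ℝ) (x : ℕ) * a + V (nextLevel x d) with hg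
  have hint : HasSum (fun d => poissonWeight l d * g d) (∫ d, g d ∂(poissonMeasure l)) :=
    hasSum_integral_poissonMeasure
      ((integrable_reward (poissonMeasure l) x a).add (integrable_nextLevel (poissonMeasure l) V x))
  have htail : HasSum (fun d => poissonWeight l d * (g d - a * (x : ℕ)))
      (∑ d ∈ Finset.range (x : ℕ), poissonWeight l d * (g d - a * (x : ℕ))) := by
    refine hasSum_sum_of_ne_finset_zero fun d hd => ?_
    have hxd : (x : ℕ) ≤ d := by simpa using hd
    simp only [hg, nextLevel_of_le hxd, hV, min_eq_right (Nat.cast_le.2 hxd : ((x : ℕ) : ℝ) ≤ d)]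
    ring
  have hsplit : (fun d => poissonWeight l d * g d) =
      fun d => a * (x : ℕ) * poissonWeight l d + poissonWeight l d * (g d - a * (x : ℕ)) := by
    funext d
    ring
  rw [hsplit] at hint
  rw [hint.unique (((hasSum_poissonWeight (l : ℝ)).mul_left (a * (x : ℕ))).add htail), mul_one,
    bellman_eq]
  congr 1
  refine Finset.sum_congr rfl fun d hd => ?_
  have hdx : (d : ℝ) ≤ (x : ℕ) := Nat.cast_le.2 (Finset.mem_range.1 hd).le
  simp only [hg, min_eq_left hdx]
  ring

/-- `V x` lies between `0` and `K` per unit of the inventory `x`: the value functions of a problem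
with prices in `[0, K]` have this property. -/
def ValueBound (K : ℝ) (V : Fin (L + 1) → ℝ) : Prop := ∀ x, 0 ≤ V x ∧ V x ≤ K * (x : ℕ)

theorem ValueBound.apply_zero {K : ℝ} {V : Fin (L + 1) → ℝ} (h : ValueBound K V) : V 0 = 0 :=
  le_antisymm (by simpa using (h 0).2) (h 0).1

theorem valueBound_zero {K : ℝ} (hK : 0 ≤ K) : ValueBound K (0 : Fin (L + 1) → ℝ) :=
  fun _ => ⟨le_rfl, by simpa using by positivity⟩

theorem ValueBound.bellman {K a : ℝ} (ha : 0 ≤ a) (haK : a ≤ K) {V : Fin (L + 1) → ℝ}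
    (h : ValueBound K V) {l : ℝ} (hl : 0 ≤ l) : ValueBound K fun x => bellman l V x a := by
  intro x
  lift l to ℝ≥0 using hl
  dsimp only
  rw [bellman_eq_integral l h.apply_zero]
  constructor
  · exact integral_nonneg fun d => add_nonneg (by positivity) (h _).1
  · have hle (d : ℕ) : min (d : ℝ) (x : ℕ) * a + V (nextLevel x d) ≤ K * (x : ℕ) := by
      have hV := (h (nextLevel x d)).2
      rw [cast_nextLevel] at hV
      have hsold : min (d : ℝ) (x : ℕ) * a ≤ min (d : ℝ) (x : ℕ) * K := by gcongr
      linarith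
    calc _ ≤ ∫ _, K * (x : ℕ) ∂(poissonMeasure l) := integral_mono
          ((integrable_reward (poissonMeasure l) x a).add
            (integrable_nextLevel (poissonMeasure l) V x)) (integrable_const _) hle
      _ = K * (x : ℕ) := by simp

theorem ValueBound.abs_bellman_sub_le {K a : ℝ} (ha : 0 ≤ a) (haK : a ≤ K)
    {V : Fin (L + 1) → ℝ} (h : ValueBound K V) {l l' : ℝ} (hl : 0 ≤ l) (hl' : 0 ≤ l')
    (x : Fin (L + 1)) :
    |OfflinePricing.bellman l V x a - OfflinePricing.bellman l' V x a|
      ≤ K * L ^ 2 * |l - l'| := by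
  have hK : 0 ≤ K := ha.trans haK
  have hx : ((x : ℕ) : ℝ) ≤ L := by exact_mod_cast Nat.lt_succ_iff.1 x.isLt
  have hterm (d : ℕ) (hd : d < (x : ℕ)) : |V (nextLevel x d) - a * ((x : ℕ) - d)| ≤ K * L := by
    have hdx : (d : ℝ) ≤ (x : ℕ) := Nat.cast_le.2 hd.le
    have hV := h (nextLevel x d)
    rw [cast_nextLevel, min_eq_left hdx] at hV
    have hle : K * ((x : ℕ) - d) ≤ K * L := by gcongr; linarith [Nat.cast_nonneg (α := ℝ) d]
    have hprice : a * ((x : ℕ) - d) ≤ K * ((x : ℕ) - d) := by gcongr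
    have hnonneg : 0 ≤ a * ((x : ℕ) - d : ℝ) := mul_nonneg ha (by linarith)
    rw [abs_le]
    constructor <;> linarith [hV.1, hV.2]
  rw [bellman_eq, bellman_eq, add_sub_add_left_eq_sub, ← Finset.sum_sub_distrib]
  calc _ ≤ ∑ _d ∈ Finset.range (x : ℕ), |l - l'| * (K * L) := by
        refine (Finset.abs_sum_le_sum_abs _ _).trans (Finset.sum_le_sum fun d hd => ?_)
        rw [← sub_mul, abs_mul]
        exact mul_le_mul (abs_poissonWeight_sub_le hl hl' d) (hterm d (Finset.mem_range.1 hd))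
          (abs_nonneg _) (abs_nonneg _)
    _ = (x : ℕ) * (|l - l'| * (K * L)) := by simp
    _ ≤ L * (|l - l'| * (K * L)) := by gcongr
    _ = K * L ^ 2 * |l - l'| := by ring

end Bellman

/-! ### Dynamic programming -/

namespace Model

variable {L : ℕ} {𝒜 : Finset ℝ} (M : Model L 𝒜) (s : PMF (Fin (L + 1))) (π : Policy L 𝒜) (T : ℕ)

theorem integral_totalReward_eq_sum :
    ∫ w, totalReward w ∂(M.trajLaw T s π) = ∑ t ∈ Finset.range T, ∫ z,
      ∫ d : ℕ, min (d : ℝ) (z.1 : ℕ) * (z.2 : ℝ) ∂(poissonMeasure (M.lam t z.2))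
        ∂(M.jointLaw s π t).toMeasure := by
  let reward : Step L 𝒜 → ℝ := fun y => min (y.2.2 : ℝ) (y.1 : ℕ) * (y.2.1 : ℝ)
  rw [Finset.sum_range]
  exact (integral_finsetSum _ fun t _ => M.integrable_eval_trajLaw s π t (g := reward)
    fun x a => integrable_reward _ x a).trans <| Finset.sum_congr rfl fun t _ =>
      M.integral_eval_trajLaw s π t (g := reward) fun x a => integrable_reward _ x a

/-- Performance difference: the Bellman errors of `V` telescope along a trajectory. -/
theorem integral_totalReward_eq_add_sum_bellman_sub {V : ℕ → Fin (L + 1) → ℝ}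
    (hV : ∀ t, V t 0 = 0) (hT : V T = 0) :
    ∫ w, totalReward w ∂(M.trajLaw T s π) = ∫ x, V 0 x ∂s.toMeasure +
      ∑ t ∈ Finset.range T, ∫ z, (bellman (M.lam t z.2) (V (t + 1)) z.1 z.2 - V t z.1)
        ∂(M.jointLaw s π t).toMeasure := by
  have hstep (t : ℕ) : ∫ z, (bellman (M.lam t z.2) (V (t + 1)) z.1 z.2 - V t z.1)
        ∂(M.jointLaw s π t).toMeasure =
      ∫ z, ∫ d : ℕ, min (d : ℝ) (z.1 : ℕ) * (z.2 : ℝ) ∂(poissonMeasure (M.lam t z.2))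
        ∂(M.jointLaw s π t).toMeasure +
      (∫ x, V (t + 1) x ∂(M.levelLaw s π (t + 1)).toMeasure -
        ∫ x, V t x ∂(M.levelLaw s π t).toMeasure) := by
    rw [integral_levelLaw_succ, integral_levelLaw, ← integral_sub .of_finite .of_finite,
      ← integral_add .of_finite .of_finite]
    refine integral_congr_ae (.of_forall fun z => ?_)
    dsimp only
    rw [bellman_eq_integral _ (hV _), integral_add (integrable_reward _ _ _)
      (integrable_nextLevel _ _ _)]
    ring
  simp only [hstep]
  rw [Finset.sum_add_distrib, ← integral_totalReward_eq_sum,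
    Finset.sum_range_sub (fun t => ∫ x, V t x ∂(M.levelLaw s π t).toMeasure), hT, levelLaw_zero]
  simp

/-- Optimal value from period `t` on, defined by the Bellman recursion. -/
def optVal (t : ℕ) (x : Fin (L + 1)) : ℝ :=
  if t < T then ⨆ a : 𝒜, bellman (M.lam t a) (fun y => optVal (t + 1) y) x a else 0
termination_by T - t

/-- The suboptimality gap of posting the price `z.2` at level `z.1` in period `t`. -/
def gap (t : ℕ) (z : Fin (L + 1) × 𝒜) : ℝ :=
  M.optVal T t z.1 - bellman (M.lam t z.2) (M.optVal T (t + 1)) z.1 z.2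

variable {T} in
theorem optVal_of_lt {t : ℕ} (ht : t < T) (x : Fin (L + 1)) :
    M.optVal T t x = ⨆ a : 𝒜, bellman (M.lam t a) (M.optVal T (t + 1)) x a := by
  rw [optVal, if_pos ht]

theorem optVal_self : M.optVal T T = 0 := by
  funext x
  rw [optVal, if_neg (lt_irrefl _)]
  rfl

theorem optVal_apply_zero (t : ℕ) : M.optVal T t 0 = 0 := by
  rw [optVal]
  split_ifs
  · simp only [bellman_zero, Real.iSup_const_zero]
  · rfl

variable {T} in
theorem gap_nonneg {t : ℕ} (ht : t < T) (z : Fin (L + 1) × 𝒜) : 0 ≤ M.gap T t z := by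
  rw [gap, sub_nonneg, optVal_of_lt M ht]
  exact le_ciSup (f := fun a : 𝒜 => bellman (M.lam t a) (M.optVal T (t + 1)) z.1 a)
    (Set.finite_range _).bddAbove z.2

theorem integral_totalReward_eq_sub_sum_gap :
    ∫ w, totalReward w ∂(M.trajLaw T s π) = ∫ x, M.optVal T 0 x ∂s.toMeasure -
      ∑ t ∈ Finset.range T, ∫ z, M.gap T t z ∂(M.jointLaw s π t).toMeasure := by
  rw [M.integral_totalReward_eq_add_sum_bellman_sub s π T (M.optVal_apply_zero T) (M.optVal_self T),
    sub_eq_add_neg, ← Finset.sum_neg_distrib]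
  simp only [← integral_neg, gap, neg_sub]

theorem value_eq_sub_sum_gap (x : Fin (L + 1)) :
    M.value T π x = M.optVal T 0 x -
      ∑ t ∈ Finset.range T, ∫ z, M.gap T t z ∂(M.jointLaw (PMF.pure x) π t).toMeasure := by
  rw [value, integral_totalReward_eq_sub_sum_gap, PMF.toMeasure_pure, integral_dirac]

variable [Nonempty 𝒜]

theorem exists_gap_eq_zero :
    ∃ act : ℕ → Fin (L + 1) → 𝒜, ∀ t < T, ∀ x, M.gap T t (x, act t x) = 0 := by
  choose act hact using fun (t : ℕ) (x : Fin (L + 1)) => exists_eq_ciSup_of_finite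
    (f := fun a : 𝒜 => bellman (M.lam t a) (M.optVal T (t + 1)) x a)
  refine ⟨act, fun t ht x => ?_⟩
  rw [gap, M.optVal_of_lt ht, ← hact t x, sub_self]

theorem exists_integral_totalReward_eq_optVal :
    ∃ π : Policy L 𝒜, ∀ s : PMF (Fin (L + 1)),
      ∫ w, totalReward w ∂(M.trajLaw T s π) = ∫ x, M.optVal T 0 x ∂s.toMeasure := by
  obtain ⟨act, hact⟩ := M.exists_gap_eq_zero T
  refine ⟨markovPolicy act, fun s => ?_⟩
  rw [integral_totalReward_eq_sub_sum_gap, sub_eq_self]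
  refine Finset.sum_eq_zero fun t ht => ?_
  simp only [integral_jointLaw_markovPolicy, hact t (Finset.mem_range.1 ht), integral_zero]

theorem optValue_eq_optVal (x : Fin (L + 1)) : M.optValue T x = M.optVal T 0 x := by
  obtain ⟨πs, hπs⟩ := M.exists_integral_totalReward_eq_optVal T
  have hle (π : Policy L 𝒜) : M.value T π x ≤ M.optVal T 0 x := by
    rw [value_eq_sub_sum_gap, sub_le_self_iff]
    exact Finset.sum_nonneg fun t ht => integral_nonneg (M.gap_nonneg (Finset.mem_range.1 ht))
  have hattained : M.value T πs x = M.optVal T 0 x := by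
    rw [value, hπs, PMF.toMeasure_pure, integral_dirac]
  have : Nonempty (Policy L 𝒜) := ⟨πs⟩
  refine le_antisymm (ciSup_le hle) (hattained ▸ ?_)
  exact le_ciSup (f := fun π => M.value T π x) ⟨_, Set.forall_mem_range.2 hle⟩ πs

theorem regret_eq_sum_gap :
    M.regret T π = ∑ t ∈ Finset.range T, ∫ z, M.gap T t z ∂(M.jointLaw M.start π t).toMeasure := by
  simp only [regret, optValue_eq_optVal, value_eq_sub_sum_gap, sub_sub_cancel]
  rw [integral_finsetSum _ fun _ _ => .of_finite]
  refine Finset.sum_congr rfl fun t _ => ?_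
  rw [M.jointLaw_eq_bind M.start, integral_bind_toMeasure _ fun _ => .of_finite]

variable {M π T}

theorem IsOptimal.integral_totalReward {πs : Policy L 𝒜} (h : M.IsOptimal T πs) :
    ∫ w, totalReward w ∂(M.trajLaw T M.start πs) =
      ∫ x, M.optVal T 0 x ∂M.start.toMeasure := by
  obtain ⟨π, hπ⟩ := M.exists_integral_totalReward_eq_optVal T
  refine le_antisymm ?_ (hπ M.start ▸ h π)
  rw [integral_totalReward_eq_sub_sum_gap, sub_le_self_iff]
  exact Finset.sum_nonneg fun t ht => integral_nonneg (M.gap_nonneg (Finset.mem_range.1 ht))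

theorem IsOptimal.regret_eq_sub {πs : Policy L 𝒜} (h : M.IsOptimal T πs) :
    M.regret T π = ∫ w, totalReward w ∂(M.trajLaw T M.start πs) -
      ∫ w, totalReward w ∂(M.trajLaw T M.start π) := by
  rw [h.integral_totalReward, M.integral_totalReward_eq_sub_sum_gap _ π, sub_sub_cancel,
    regret_eq_sum_gap]

theorem integral_gap_le_regret {t : ℕ} (ht : t < T) :
    ∫ z, M.gap T t z ∂(M.jointLaw M.start π t).toMeasure ≤ M.regret T π := by
  rw [regret_eq_sum_gap]
  exact Finset.single_le_sum (f := fun t => ∫ z, M.gap T t z ∂(M.jointLaw M.start π t).toMeasure)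
    (fun t ht => integral_nonneg (M.gap_nonneg (Finset.mem_range.1 ht))) (Finset.mem_range.2 ht)

theorem levelLaw_mul_gap_le_regret {t : ℕ} (ht : t < T) (act : ℕ → Fin (L + 1) → 𝒜)
    (x : Fin (L + 1)) :
    (M.levelLaw M.start (markovPolicy act) t x).toReal * M.gap T t (x, act t x) ≤
      M.regret T (markovPolicy act) := by
  refine le_trans ?_ (integral_gap_le_regret ht)
  rw [integral_jointLaw_markovPolicy]
  exact toReal_mul_le_integral _ (fun x => M.gap_nonneg ht (x, act t x)) x

theorem IsOptimal.jointLaw_eq_zero_of_gap_pos (h : M.IsOptimal T π) {t : ℕ} (ht : t < T)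
    {z : Fin (L + 1) × 𝒜} (hz : 0 < M.gap T t z) : M.jointLaw M.start π t z = 0 := by
  have hregret : M.regret T π = 0 := by rw [h.regret_eq_sub, sub_self]
  have hle := (toReal_mul_le_integral (M.jointLaw M.start π t) (M.gap_nonneg ht) z).trans
    ((integral_gap_le_regret ht).trans hregret.le)
  have hzero := le_antisymm (nonpos_of_mul_nonpos_left hle hz) ENNReal.toReal_nonneg
  exact ((ENNReal.toReal_eq_zero_iff _).1 hzero).resolve_right (PMF.apply_ne_top _ _)

end Model

/-! ### Independent samples falling in a set -/

section Hits

variable {ι Ω : Type*} [Fintype ι]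

open Classical in
/-- The indices of the sample points that fall in `A`. Conditioning on this random set keeps the
sample points independent. -/
def hits (A : Set Ω) (ω : ι → Ω) : Finset ι := {i | ω i ∈ A}

theorem mem_hits {A : Set Ω} {ω : ι → Ω} {i : ι} : i ∈ hits A ω ↔ ω i ∈ A := by
  simp [hits]

open Classical in
theorem setOf_hits_eq (A : Set Ω) (I : Finset ι) :
    {ω : ι → Ω | hits A ω = I} = Set.univ.pi fun i => if i ∈ I then A else Aᶜ := by
  ext ω
  simp only [Set.mem_ofPred_eq, Finset.ext_iff, mem_hits, Set.mem_univ_pi]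
  refine forall_congr' fun i => ?_
  split_ifs with h <;> simp [h]

theorem cast_card_hits (A : Set Ω) (ω : ι → Ω) :
    ((hits A ω).card : ℝ) = ∑ i, A.indicator 1 (ω i) := by
  classical
  simp [hits, Set.indicator_apply]

open Classical in
theorem exp_sum_eq_prod_ite (g : Ω → ℝ) (I : Finset ι) (ω : ι → Ω) :
    Real.exp (∑ i ∈ I, g (ω i)) = ∏ i, if i ∈ I then Real.exp (g (ω i)) else 1 := by
  rw [Real.exp_sum, Finset.prod_ite_mem, Finset.univ_inter]

variable [MeasurableSpace Ω]

theorem measurableSet_hits_eq {A : Set Ω} (hA : MeasurableSet A) (I : Finset ι) :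
    MeasurableSet {ω : ι → Ω | hits A ω = I} := by
  classical
  rw [setOf_hits_eq]
  refine .univ_pi fun i => ?_
  split_ifs
  exacts [hA, hA.compl]

variable (μ : Measure Ω) [IsProbabilityMeasure μ] {A : Set Ω} (hA : MeasurableSet A)

open Classical in
theorem measureReal_hits_eq (A : Set Ω) (I : Finset ι) :
    (Measure.pi fun _ => μ).real {ω : ι → Ω | hits A ω = I} =
      ∏ i, μ.real (if i ∈ I then A else Aᶜ) := by
  rw [setOf_hits_eq, measureReal_def, Measure.pi_pi, ENNReal.toReal_prod]
  rfl

theorem integrableOn_exp_sum_hits {g : Ω → ℝ}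
    (hg : IntegrableOn (fun x => Real.exp (g x)) A μ) (I : Finset ι) :
    IntegrableOn (fun ω : ι → Ω => Real.exp (∑ i ∈ I, g (ω i))) {ω | hits A ω = I}
      (Measure.pi fun _ => μ) := by
  classical
  simp only [exp_sum_eq_prod_ite]
  rw [IntegrableOn, setOf_hits_eq, Measure.restrict_pi_pi]
  refine Integrable.fintype_prod (f := fun i x => if i ∈ I then Real.exp (g x) else 1) fun i => ?_
  split_ifs
  exacts [hg, integrable_const 1]

theorem setIntegral_exp_sum_hits_le {g : Ω → ℝ} {ψ : ℝ}
    (hψ : ∫ x in A, Real.exp (g x) ∂μ ≤ Real.exp ψ * μ.real A) (I : Finset ι) :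
    ∫ ω in {ω | hits A ω = I}, Real.exp (∑ i ∈ I, g (ω i)) ∂(Measure.pi fun _ => μ) ≤
      Real.exp (I.card * ψ) * (Measure.pi fun _ => μ).real {ω : ι → Ω | hits A ω = I} := by
  classical
  simp only [exp_sum_eq_prod_ite]
  rw [measureReal_hits_eq, setOf_hits_eq, Measure.restrict_pi_pi,
    integral_fintype_prod_eq_prod (fun i x => if i ∈ I then Real.exp (g x) else 1)]
  have hfactor : ∀ i, ∫ x in if i ∈ I then A else Aᶜ, (if i ∈ I then Real.exp (g x) else 1) ∂μ ≤
      (if i ∈ I then Real.exp ψ else 1) * μ.real (if i ∈ I then A else Aᶜ) := fun i => by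
    split_ifs
    · exact hψ
    · simp
  refine (Finset.prod_le_prod (fun i _ => integral_nonneg fun x => ?_)
    fun i _ => hfactor i).trans_eq ?_
  · positivity
  · rw [Finset.prod_mul_distrib, Finset.prod_ite_mem, Finset.univ_inter, Finset.prod_const,
      ← Real.exp_nat_mul]

include hA

theorem measureReal_hits_eq_empty :
    (Measure.pi fun _ => μ).real {ω : ι → Ω | hits A ω = ∅} =
      (1 - μ.real A) ^ Fintype.card ι := by
  simp [measureReal_hits_eq, probReal_compl_eq_one_sub hA]

theorem sum_mul_measureReal_hits (f : Finset ι → ℝ) :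
    ∑ I, f I * (Measure.pi fun _ => μ).real {ω : ι → Ω | hits A ω = I} =
      ∫ ω : ι → Ω, f (hits A ω) ∂(Measure.pi fun _ => μ) := by
  classical
  have hf : ∀ ω : ι → Ω, f (hits A ω) = ∑ I, f I * {ω | hits A ω = I}.indicator 1 ω := fun ω => by
    simp [Set.indicator_apply]
  simp only [hf]
  rw [integral_finsetSum _ fun I _ =>
    ((integrable_const 1).indicator (measurableSet_hits_eq hA I)).const_mul _]
  simp only [integral_const_mul, integral_indicator_one (measurableSet_hits_eq hA _)]

theorem measureReal_le_integral_hits (p : Finset ι → Prop) [DecidablePred p] {f : Finset ι → ℝ}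
    {E : Set (ι → Ω)}
    (h : ∀ I, p I → (Measure.pi fun _ => μ).real {ω | hits A ω = I ∧ ω ∈ E} ≤
      f I * (Measure.pi fun _ => μ).real {ω : ι → Ω | hits A ω = I}) :
    (Measure.pi fun _ => μ).real {ω | p (hits A ω) ∧ ω ∈ E} ≤
      ∫ ω : ι → Ω, (if p (hits A ω) then f (hits A ω) else 0) ∂(Measure.pi fun _ => μ) := by
  classical
  have hsub : {ω : ι → Ω | p (hits A ω) ∧ ω ∈ E} ⊆
      ⋃ I ∈ Finset.univ.filter p, {ω | hits A ω = I ∧ ω ∈ E} := fun ω hω => by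
    simpa using hω
  rw [← sum_mul_measureReal_hits μ hA fun I => if p I then f I else 0]
  simp only [ite_mul, zero_mul, ← Finset.sum_filter]
  refine (measureReal_mono hsub (measure_ne_top _ _)).trans
    ((measureReal_biUnion_finset_le _ _).trans (Finset.sum_le_sum fun I hI => h I ?_))
  simpa using hI

theorem measureReal_hits_eq_and_le_sum {g : Ω → ℝ}
    (hg : IntegrableOn (fun x => Real.exp (g x)) A μ) {ψ : ℝ}
    (hψ : ∫ x in A, Real.exp (g x) ∂μ ≤ Real.exp ψ * μ.real A) (I : Finset ι) (r : ℝ) :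
    (Measure.pi fun _ => μ).real {ω : ι → Ω | hits A ω = I ∧ r ≤ ∑ i ∈ I, g (ω i)} ≤
      Real.exp (I.card * ψ - r) *
        (Measure.pi fun _ => μ).real {ω : ι → Ω | hits A ω = I} := by
  have hmarkov := mul_meas_ge_le_integral_of_nonneg (ae_of_all _ fun _ => Real.exp_nonneg _)
    (integrableOn_exp_sum_hits μ hg I) (Real.exp r)
  have hset : {ω : ι → Ω | Real.exp r ≤ Real.exp (∑ i ∈ I, g (ω i))} ∩ {ω | hits A ω = I} =
      {ω | hits A ω = I ∧ r ≤ ∑ i ∈ I, g (ω i)} := by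
    ext ω; simp [and_comm]
  rw [measureReal_restrict_apply' (measurableSet_hits_eq hA I), hset] at hmarkov
  rw [Real.exp_sub, div_mul_eq_mul_div, le_div_iff₀' (Real.exp_pos r)]
  exact hmarkov.trans (setIntegral_exp_sum_hits_le μ hψ I)

theorem memLp_card_hits :
    MemLp (fun ω : ι → Ω => ((hits A ω).card : ℝ)) 2 (Measure.pi fun _ => μ) := by
  simp only [cast_card_hits]
  exact memLp_finsetSum _ fun i _ => (memLp_indicator_const 2 hA 1 (by simp)).comp_measurePreserving
    (measurePreserving_eval (fun _ => μ) i)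

theorem integral_card_hits :
    ∫ ω : ι → Ω, ((hits A ω).card : ℝ) ∂(Measure.pi fun _ => μ) =
      Fintype.card ι * μ.real A := by
  have hY : Integrable (A.indicator (1 : Ω → ℝ)) μ := (integrable_const 1).indicator hA
  simp only [cast_card_hits]
  rw [integral_finsetSum _ fun i _ => integrable_comp_eval hY]
  simp [integral_comp_eval (μ := fun _ => μ) hY.1, integral_indicator_one hA]

theorem variance_card_hits_le :
    Var[fun ω : ι → Ω => ((hits A ω).card : ℝ); Measure.pi fun _ => μ] ≤ Fintype.card ι := by
  have hY : MemLp (A.indicator (1 : Ω → ℝ)) 2 μ := memLp_indicator_const 2 hA 1 (by simp)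
  have hvar : Var[A.indicator 1; μ] ≤ 1 := by
    refine (variance_le_sq_of_bounded (a := 0) (b := 1) (ae_of_all _ fun x => ?_)
      hY.1.aemeasurable).trans (by norm_num)
    by_cases hx : x ∈ A <;> simp [hx]
  have hsum : (fun ω : ι → Ω => ((hits A ω).card : ℝ)) = ∑ i, fun ω => A.indicator 1 (ω i) := by
    funext ω; rw [cast_card_hits, Finset.sum_apply]
  rw [hsum, variance_sum_pi (X := fun _ => A.indicator 1) fun _ => hY]
  simpa using Finset.sum_le_sum fun (i : ι) (_ : i ∈ Finset.univ) => hvar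

theorem measureReal_card_hits_deviation_le {s : ℝ} (hs : 0 < s) :
    (Measure.pi fun _ => μ).real {ω : ι → Ω |
        s * Fintype.card ι < |((hits A ω).card : ℝ) - Fintype.card ι * μ.real A|} ≤
      1 / s ^ 2 / Fintype.card ι := by
  rcases isEmpty_or_nonempty ι with h | h
  · simp [hits]
  have : (0 : ℝ) < Fintype.card ι := by exact_mod_cast Fintype.card_pos
  have hcheb := meas_ge_le_variance_div_sq (memLp_card_hits (ι := ι) μ hA)
    (c := s * Fintype.card ι) (by positivity)
  rw [integral_card_hits μ hA] at hcheb
  refine (measureReal_mono (fun ω h => ?_) (measure_ne_top _ _)).trans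
    ((ENNReal.toReal_le_of_le_ofReal (div_nonneg (variance_nonneg _ _) (by positivity)) hcheb).trans
      ?_)
  · exact (Set.mem_ofPred_eq ▸ h : _ < _).le
  · calc Var[fun ω : ι → Ω => ((hits A ω).card : ℝ); Measure.pi fun _ => μ] /
          (s * Fintype.card ι) ^ 2
        ≤ Fintype.card ι / (s * Fintype.card ι) ^ 2 := by
          gcongr
          exact variance_card_hits_le μ hA
      _ = 1 / s ^ 2 / Fintype.card ι := by field_simp

end Hits

/-! ### Concentration of the demand estimates -/

theorem hasSum_poisson_exp (l : ℝ≥0) (θ : ℝ) :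
    HasSum (fun d : ℕ => (Real.exp (-l) * (l : ℝ) ^ d / d.factorial) *
      Real.exp (θ * ((d : ℝ) - l))) (Real.exp (l * (Real.exp θ - 1 - θ))) := by
  have h := (NormedSpace.expSeries_div_hasSum_exp ((l : ℝ) * Real.exp θ)).mul_left
    (Real.exp (-l) * Real.exp (-(θ * l)))
  have hexp : -(l : ℝ) + -(θ * l) + l * Real.exp θ = l * (Real.exp θ - 1 - θ) := by ring
  rw [← Real.exp_eq_exp_ℝ, ← Real.exp_add, ← Real.exp_add, hexp] at h
  refine h.congr_fun fun d => ?_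
  rw [mul_pow, ← Real.exp_nat_mul, show θ * ((d : ℝ) - l) = -(θ * l) + d * θ by ring, Real.exp_add,
    Real.exp_add]
  ring

theorem integrable_poisson_exp (l : ℝ≥0) (θ : ℝ) :
    Integrable (fun d : ℕ => Real.exp (θ * ((d : ℝ) - l))) (poissonMeasure l) := by
  rw [integrable_poissonMeasure_iff]
  simpa only [Real.norm_eq_abs, Real.abs_exp] using (hasSum_poisson_exp l θ).summable

theorem integral_poisson_exp (l : ℝ≥0) (θ : ℝ) :
    ∫ d : ℕ, Real.exp (θ * ((d : ℝ) - l)) ∂(poissonMeasure l) =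
      Real.exp (l * (Real.exp θ - 1 - θ)) := by
  rw [integral_poissonMeasure]
  simpa only [smul_eq_mul] using (hasSum_poisson_exp l θ).tsum_eq

/-- The union bound over both tails needs the extra factor `1 / 2`. -/
theorem exp_chernoff_exponent_le {n : ℕ} (hn : 2 ≤ n) {l c : ℝ} (hl : 0 ≤ l) (hc : l + 2 ≤ c)
    {θ : ℝ} (hθ : θ ^ 2 = Real.log n / n) :
    Real.exp (n * (l * (Real.exp θ - 1 - θ)) - n * (c * (Real.log n / n))) ≤ (n : ℝ)⁻¹ / 2 := by
  have hn0 : (0 : ℝ) < n := by positivity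
  have : 0 ≤ Real.log n := Real.log_natCast_nonneg n
  have hθ1 : |θ| ≤ 1 := by
    rw [← sq_le_one_iff_abs_le_one, hθ, div_le_one hn0]
    exact (Real.log_le_sub_one_of_pos hn0).trans (by linarith)
  have hcumulant : Real.exp θ - 1 - θ ≤ Real.log n / n :=
    hθ ▸ (abs_le.1 (Real.abs_exp_sub_one_sub_id_le hθ1)).2
  calc Real.exp (n * (l * (Real.exp θ - 1 - θ)) - n * (c * (Real.log n / n)))
      ≤ Real.exp (n * (l * (Real.log n / n)) - n * (c * (Real.log n / n))) := by gcongr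
    _ = Real.exp (-((c - l) * Real.log n)) := by congr 1; field_simp; ring
    _ ≤ Real.exp (-(2 * Real.log n)) := by gcongr; linarith
    _ = (n : ℝ)⁻¹ / n := by
        rw [Real.exp_neg, two_mul, Real.exp_add, Real.exp_log hn0, mul_inv, div_eq_mul_inv]
    _ ≤ (n : ℝ)⁻¹ / 2 := by gcongr; exact_mod_cast hn

variable {T N L : ℕ} {𝒜 : Finset ℝ}

instance : DiscreteMeasurableSpace (Data T N L 𝒜) :=
  have : MeasurableSingletonClass (Data T N L 𝒜) := Pi.instMeasurableSingletonClass
  have : Countable (Data T N L 𝒜) := inferInstanceAs (Countable (Fin N → Fin T → Step L 𝒜))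
  MeasurableSingletonClass.toDiscreteMeasurableSpace

/-- The event that the price `a` is posted in period `t`. -/
def posts (L : ℕ) (t : Fin T) (a : 𝒜) : Set (Fin T → Step L 𝒜) := {w | (w t).2.1 = a}

theorem count_eq_card_hits (𝒟 : Data T N L 𝒜) (t : Fin T) (a : 𝒜) :
    count 𝒟 t a = (hits (posts L t a) 𝒟).card := by
  simp only [count, hits, posts, Set.mem_ofPred_eq]
  congr

theorem count_mul_lamHat_sub {𝒟 : Data T N L 𝒜} {t : Fin T} {a : 𝒜} (h : 0 < count 𝒟 t a)
    (l : ℝ) :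
    count 𝒟 t a * (lamHat 𝒟 t a - l) =
      ∑ i ∈ hits (posts L t a) 𝒟, (((𝒟 i t).2.2 : ℝ) - l) := by
  classical
  have hcount : (count 𝒟 t a : ℝ) ≠ 0 := by positivity
  rw [Finset.sum_sub_distrib, Finset.sum_const, ← count_eq_card_hits, lamHat, mul_sub,
    mul_div_cancel₀ _ hcount, nsmul_eq_mul, hits, Finset.sum_filter]
  exact congrArg (· - _) (Finset.sum_congr rfl fun i _ => by congr)

namespace Model

variable (M : Model L 𝒜) (t : Fin T) (a : 𝒜)

theorem integrable_ite_exp (θ : ℝ) (b : 𝒜) :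
    Integrable (fun d : ℕ => if b = a then Real.exp (θ * ((d : ℝ) - M.lam t a)) else 0)
      (poissonMeasure (M.lam t b)) := by
  by_cases h : b = a
  · simpa only [h, if_true] using integrable_poisson_exp (M.lam t a) θ
  · simp [h]

theorem indicator_posts (g : ℕ → ℝ) (w : Fin T → Step L 𝒜) :
    (posts L t a).indicator (fun w => g (w t).2.2) w =
      if (w t).2.1 = a then g (w t).2.2 else 0 := by
  simp only [Set.indicator_apply, posts, Set.mem_ofPred_eq]

theorem integrableOn_posts_exp (θ : ℝ) :
    IntegrableOn (fun w => Real.exp (θ * (((w t).2.2 : ℝ) - M.lam t a))) (posts L t a)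
      (M.behaviorLaw T) := by
  rw [← integrable_indicator_iff .of_discrete]
  exact (M.integrable_eval_trajLaw M.start M.behavior t
    (g := fun y => if y.2.1 = a then Real.exp (θ * ((y.2.2 : ℝ) - M.lam t a)) else 0)
    fun _ => M.integrable_ite_exp t a θ).congr (ae_of_all _ fun w =>
      (indicator_posts t a (fun d => Real.exp (θ * ((d : ℝ) - M.lam t a))) w).symm)

theorem setIntegral_posts_exp (θ : ℝ) :
    ∫ w in posts L t a, Real.exp (θ * (((w t).2.2 : ℝ) - M.lam t a)) ∂(M.behaviorLaw T) =
      Real.exp (M.lam t a * (Real.exp θ - 1 - θ)) * M.priceProb T M.behavior t a := by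
  have hprob : M.priceProb T M.behavior t a = ∑ b, M.priceProb T M.behavior t b *
      if b = a then 1 else 0 := by simp
  rw [← integral_indicator .of_discrete]
  simp only [indicator_posts t a fun d => Real.exp (θ * ((d : ℝ) - M.lam t a))]
  rw [hprob, ← integral_price, ← integral_const_mul, behaviorLaw]
  refine (M.integral_eval_trajLaw M.start M.behavior t
    (g := fun y => if y.2.1 = a then Real.exp (θ * ((y.2.2 : ℝ) - M.lam t a)) else 0)
    fun _ => M.integrable_ite_exp t a θ).trans ?_
  rw [M.integral_eval_trajLaw M.start M.behavior t
    (g := fun y => Real.exp (M.lam t a * (Real.exp θ - 1 - θ)) * if y.2.1 = a then 1 else 0)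
    fun _ _ => by simp]
  refine integral_congr_ae (ae_of_all _ fun z => ?_)
  by_cases h : z.2 = a
  · simp only [h, if_true, integral_poisson_exp, mul_one, integral_const, probReal_univ, one_smul]
  · simp [h]

theorem measureReal_hits_posts_eq_and_le (θ r : ℝ) (I : Finset (Fin N)) :
    (M.dataLaw T N).real {𝒟 | hits (posts L t a) 𝒟 = I ∧
        r ≤ θ * ∑ i ∈ I, (((𝒟 i t).2.2 : ℝ) - M.lam t a)} ≤
      Real.exp (I.card * (M.lam t a * (Real.exp θ - 1 - θ)) - r) *
        (M.dataLaw T N).real {𝒟 | hits (posts L t a) 𝒟 = I} := by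
  simp only [Finset.mul_sum]
  exact measureReal_hits_eq_and_le_sum (M.behaviorLaw T) .of_discrete
    (M.integrableOn_posts_exp t a θ) (M.setIntegral_posts_exp t a θ).le I r

theorem measureReal_count_eq_zero :
    (M.dataLaw T N).real {𝒟 | count 𝒟 t a = 0} = (1 - M.priceProb T M.behavior t a) ^ N := by
  simp only [count_eq_card_hits, Finset.card_eq_zero]
  exact (measureReal_hits_eq_empty (M.behaviorLaw T) .of_discrete).trans
    (by rw [Fintype.card_fin]; rfl)

theorem measureReal_count_deviation_le {s : ℝ} (hs : 0 < s) :
    (M.dataLaw T N).real {𝒟 | s * N < |(count 𝒟 t a : ℝ) - N * M.priceProb T M.behavior t a|} ≤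
      1 / s ^ 2 / N := by
  have h := measureReal_card_hits_deviation_le (ι := Fin N) (M.behaviorLaw T) (A := posts L t a)
    .of_discrete hs
  simp only [Fintype.card_fin, ← count_eq_card_hits] at h
  exact h

/-- Two Chernoff bounds with exponents `±√(log n / n)`, where `n` is the number of observations. -/
theorem measureReal_hits_eq_and_delta_lt_le {lmax : ℝ≥0} (hl : M.lam t a ≤ lmax) {c : ℝ}
    (hc : (lmax : ℝ) + 2 ≤ c) {I : Finset (Fin N)} (hI : I.Nonempty) :
    (M.dataLaw T N).real {𝒟 | hits (posts L t a) 𝒟 = I ∧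
        delta c 𝒟 t a < |lamHat 𝒟 t a - M.lam t a|} ≤
      (I.card : ℝ)⁻¹ * (M.dataLaw T N).real {𝒟 | hits (posts L t a) 𝒟 = I} := by
  rcases (Nat.succ_le_of_lt hI.card_pos).eq_or_lt with hone | htwo
  · rw [← hone, Nat.succ_eq_add_one, zero_add, Nat.cast_one, inv_one, one_mul]
    exact measureReal_mono fun 𝒟 h => h.1
  set n := I.card with hn
  set θ := Real.sqrt (Real.log n / n) with hθ
  have hθ2 : θ ^ 2 = Real.log n / n :=
    Real.sq_sqrt (div_nonneg (Real.log_natCast_nonneg n) n.cast_nonneg)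
  have hl' : (M.lam t a : ℝ) + 2 ≤ c := le_trans (by gcongr) hc
  let tail (ϑ : ℝ) : Set (Data T N L 𝒜) := {𝒟 | hits (posts L t a) 𝒟 = I ∧
    n * (c * (Real.log n / n)) ≤ ϑ * ∑ i ∈ I, (((𝒟 i t).2.2 : ℝ) - M.lam t a)}
  have htail : ∀ ϑ, ϑ ^ 2 = Real.log n / n → (M.dataLaw T N).real (tail ϑ) ≤
      (n : ℝ)⁻¹ / 2 * (M.dataLaw T N).real {𝒟 | hits (posts L t a) 𝒟 = I} := fun ϑ hϑ =>
    (M.measureReal_hits_posts_eq_and_le t a ϑ _ I).trans (mul_le_mul_of_nonneg_right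
      (exp_chernoff_exponent_le htwo (NNReal.coe_nonneg _) hl' hϑ) measureReal_nonneg)
  have hsub : {𝒟 : Data T N L 𝒜 | hits (posts L t a) 𝒟 = I ∧
      delta c 𝒟 t a < |lamHat 𝒟 t a - M.lam t a|} ⊆ tail θ ∪ tail (-θ) := by
    rintro 𝒟 ⟨h, hd⟩
    have hcount : count 𝒟 t a = n := by rw [count_eq_card_hits, h]
    have hsum := count_mul_lamHat_sub (𝒟 := 𝒟) (t := t) (a := a) (by omega) (M.lam t a)
    rw [h, hcount] at hsum
    have hd' : c * θ < |lamHat 𝒟 t a - M.lam t a| := by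
      simpa only [delta, rate, hcount] using hd
    have hr : n * (c * (Real.log n / n)) = θ * (n * (c * θ)) := by rw [← hθ2]; ring
    have hθ0 : 0 ≤ θ := Real.sqrt_nonneg _
    refine (lt_abs.1 hd').imp (fun hlt => ⟨h, ?_⟩) fun hlt => ⟨h, ?_⟩
    · rw [hr, ← hsum]
      gcongr
    · rw [hr, ← hsum, neg_mul, ← mul_neg, ← mul_neg]
      gcongr
  calc _ ≤ _ := measureReal_mono hsub
    _ ≤ _ := measureReal_union_le _ _
    _ ≤ _ := add_le_add (htail θ hθ2) (htail (-θ) (by rw [neg_sq, hθ2]))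
    _ = _ := by ring

theorem measureReal_le_count_and_delta_lt_le {lmax : ℝ≥0} (hl : M.lam t a ≤ lmax) {c : ℝ}
    (hc : (lmax : ℝ) + 2 ≤ c) {m : ℕ} (hm : 0 < m) :
    (M.dataLaw T N).real
        {𝒟 | m ≤ count 𝒟 t a ∧ delta c 𝒟 t a < |lamHat 𝒟 t a - M.lam t a|} ≤
      ∫ 𝒟, (if m ≤ count 𝒟 t a then (count 𝒟 t a : ℝ)⁻¹ else 0) ∂(M.dataLaw T N) := by
  simp only [count_eq_card_hits]
  exact measureReal_le_integral_hits (M.behaviorLaw T) .of_discrete (fun I => m ≤ I.card)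
    (f := fun I => (I.card : ℝ)⁻¹) (E := {𝒟 | delta c 𝒟 t a < |lamHat 𝒟 t a - M.lam t a|})
    fun I hI => M.measureReal_hits_eq_and_delta_lt_le t a hl hc
      (Finset.card_pos.1 (hm.trans_le hI))

end Model

/-! ### Confidence intervals -/

section ConfidenceIntervals

variable {𝒟 : Data T N L 𝒜} {t : Fin T} {a b : 𝒜}

theorem mem_observed : a ∈ observed 𝒟 t ↔ 0 < count 𝒟 t a := by
  simp [observed]

theorem mem_obsAbove : b ∈ obsAbove 𝒟 t a ↔ 0 < count 𝒟 t b ∧ a ≤ b := by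
  simp [obsAbove, mem_observed]

theorem mem_obsBelow : b ∈ obsBelow 𝒟 t a ↔ 0 < count 𝒟 t b ∧ b ≤ a := by
  simp [obsBelow, mem_observed]

theorem exists_count_pos (hN : 1 ≤ N) (𝒟 : Data T N L 𝒜) (t : Fin T) :
    ∃ a, 0 < count 𝒟 t a :=
  ⟨(𝒟 ⟨0, hN⟩ t).2.1, Finset.card_pos.2 ⟨⟨0, hN⟩, by simp⟩⟩

theorem rate_nonneg (𝒟 : Data T N L 𝒜) (t : Fin T) (a : 𝒜) : 0 ≤ rate 𝒟 t a :=
  Real.sqrt_nonneg _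

theorem lmin_le_lamLower (c : ℝ) (lmin : ℝ≥0) (𝒟 : Data T N L 𝒜) (t : Fin T) (a : 𝒜) :
    (lmin : ℝ) ≤ lamLower c lmin 𝒟 t a := by
  unfold lamLower
  split_ifs with h
  · obtain ⟨b, hb⟩ := h
    exact (le_max_right _ _).trans
      (Finset.le_sup' (fun a' => max (lamHat 𝒟 t a' - delta c 𝒟 t a') (lmin : ℝ)) hb)
  · exact le_rfl

theorem nonneg_of_lamLower_le {c : ℝ} {lmin : ℝ≥0} {l : ℝ} (hl : lamLower c lmin 𝒟 t a ≤ l) :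
    0 ≤ l :=
  lmin.coe_nonneg.trans ((lmin_le_lamLower c lmin 𝒟 t a).trans hl)

theorem lamUpper_le_lmax (c : ℝ) (lmax : ℝ≥0) (𝒟 : Data T N L 𝒜) (t : Fin T) (a : 𝒜) :
    lamUpper c lmax 𝒟 t a ≤ lmax := by
  unfold lamUpper
  split_ifs with h
  · obtain ⟨b, hb⟩ := h
    exact (Finset.inf'_le (fun a' => min (lamHat 𝒟 t a' + delta c 𝒟 t a') (lmax : ℝ)) hb).trans
      (min_le_right _ _)
  · exact le_rfl

theorem lamHat_sub_delta_le_lamLower (c : ℝ) (lmin : ℝ≥0) (hb : b ∈ obsAbove 𝒟 t a) :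
    lamHat 𝒟 t b - delta c 𝒟 t b ≤ lamLower c lmin 𝒟 t a := by
  rw [lamLower, dif_pos ⟨b, hb⟩]
  exact (le_max_left _ _).trans
    (Finset.le_sup' (fun a' => max (lamHat 𝒟 t a' - delta c 𝒟 t a') (lmin : ℝ)) hb)

theorem lamUpper_le_lamHat_add_delta (c : ℝ) (lmax : ℝ≥0) (hb : b ∈ obsBelow 𝒟 t a) :
    lamUpper c lmax 𝒟 t a ≤ lamHat 𝒟 t b + delta c 𝒟 t b := by
  rw [lamUpper, dif_pos ⟨b, hb⟩]
  exact (Finset.inf'_le (fun a' => min (lamHat 𝒟 t a' + delta c 𝒟 t a') (lmax : ℝ)) hb).trans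
    (min_le_left _ _)

/-- The estimates of the observed demand parameters are within their confidence radii. -/
def Accurate (M : Model L 𝒜) (c : ℝ) (𝒟 : Data T N L 𝒜) : Prop :=
  ∀ t a, 0 < count 𝒟 t a → |lamHat 𝒟 t a - M.lam t a| ≤ delta c 𝒟 t a

namespace Accurate

variable {M : Model L 𝒜} {c : ℝ} {lmin lmax : ℝ≥0} (h : Accurate M c 𝒟)

include h

theorem sub_le_lamLower (lmin : ℝ≥0) (hb : b ∈ obsAbove 𝒟 t a) :
    M.lam t b - 2 * delta c 𝒟 t b ≤ lamLower c lmin 𝒟 t a := by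
  have := lamHat_sub_delta_le_lamLower c lmin hb
  have := (abs_le.1 (h t b (mem_obsAbove.1 hb).1)).1
  linarith

theorem lamUpper_le_add (lmax : ℝ≥0) (hb : b ∈ obsBelow 𝒟 t a) :
    lamUpper c lmax 𝒟 t a ≤ M.lam t b + 2 * delta c 𝒟 t b := by
  have := lamUpper_le_lamHat_add_delta c lmax hb
  have := (abs_le.1 (h t b (mem_obsBelow.1 hb).1)).2
  linarith

theorem abs_sub_le_two_mul_delta (ha : 0 < count 𝒟 t a) {l : ℝ}
    (hl : l ∈ Set.Icc (lamLower c lmin 𝒟 t a) (lamUpper c lmax 𝒟 t a)) :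
    |l - M.lam t a| ≤ 2 * delta c 𝒟 t a := by
  have := h.sub_le_lamLower lmin (mem_obsAbove.2 ⟨ha, le_refl a⟩)
  have := h.lamUpper_le_add lmax (mem_obsBelow.2 ⟨ha, le_refl a⟩)
  rw [abs_le]
  constructor <;> linarith [hl.1, hl.2]

theorem lamUpper_sub_lamLower_le_eta (hN : 1 ≤ N) :
    lamUpper c lmax 𝒟 t a - lamLower c lmin 𝒟 t a ≤ eta M c lmax 𝒟 t a := by
  have hlow := nonneg_of_lamLower_le (le_refl (lamLower c lmin 𝒟 t a))
  have hup := lamUpper_le_lmax c lmax 𝒟 t a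
  unfold eta
  split_ifs with hU hL hL
  · linarith [h.lamUpper_le_add lmax (Finset.max'_mem _ hU),
      h.sub_le_lamLower lmin (Finset.min'_mem _ hL)]
  · linarith [h.lamUpper_le_add lmax (Finset.max'_mem _ hU)]
  · linarith [h.sub_le_lamLower lmin (Finset.min'_mem _ hL)]
  · obtain ⟨b, hb⟩ := exists_count_pos hN 𝒟 t
    rcases le_total a b with hab | hab
    · exact absurd ⟨b, mem_obsAbove.2 ⟨hb, hab⟩⟩ hL
    · exact absurd ⟨b, mem_obsBelow.2 ⟨hb, hab⟩⟩ hU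

variable (hM : M.Admissible T lmin lmax) (t a)

include hM

theorem lamLower_le : lamLower c lmin 𝒟 t a ≤ M.lam t a := by
  unfold lamLower
  split_ifs with hne
  · refine Finset.sup'_le _ _ fun b hb => max_le ?_ (hM.lower t t.isLt a)
    rw [mem_obsAbove] at hb
    have := (abs_le.1 (h t b hb.1)).2
    have : (M.lam t b : ℝ) ≤ M.lam t a := hM.mono t t.isLt hb.2
    linarith
  · exact hM.lower t t.isLt a

theorem le_lamUpper : M.lam t a ≤ lamUpper c lmax 𝒟 t a := by
  unfold lamUpper
  split_ifs with hne
  · refine Finset.le_inf' _ _ fun b hb => le_min ?_ (hM.upper t t.isLt a)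
    rw [mem_obsBelow] at hb
    have := (abs_le.1 (h t b hb.1)).1
    have : (M.lam t a : ℝ) ≤ M.lam t b := hM.mono t t.isLt hb.2
    linarith
  · exact hM.upper t t.isLt a

theorem mem_Icc :
    (M.lam t a : ℝ) ∈ Set.Icc (lamLower c lmin 𝒟 t a) (lamUpper c lmax 𝒟 t a) :=
  ⟨h.lamLower_le t a hM, h.le_lamUpper t a hM⟩

theorem abs_sub_le_eta (hN : 1 ≤ N) {l : ℝ}
    (hl : l ∈ Set.Icc (lamLower c lmin 𝒟 t a) (lamUpper c lmax 𝒟 t a)) :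
    |l - M.lam t a| ≤ eta M c lmax 𝒟 t a := by
  have hm := h.mem_Icc t a hM
  have := h.lamUpper_sub_lamLower_le_eta (c := c) (lmin := lmin) (lmax := lmax) (t := t) (a := a) hN
  rw [abs_le]
  constructor <;> linarith [hl.1, hl.2, hm.1, hm.2]

end Accurate

end ConfidenceIntervals

/-! ### The pessimistic value function -/

section PessimisticValue

variable (c : ℝ) (lmin lmax : ℝ≥0) (𝒟 : Data T N L 𝒜) {K : ℝ}

section WorstBellman

variable {V : Fin (L + 1) → ℝ} (hV : ValueBound K V) (t : Fin T) {a : 𝒜} (ha : 0 ≤ (a : ℝ))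
  (haK : (a : ℝ) ≤ K)

include hV ha haK

theorem worstBellman_le_bellman (x : Fin (L + 1)) {l : ℝ}
    (hl : l ∈ Set.Icc (lamLower c lmin 𝒟 t a) (lamUpper c lmax 𝒟 t a)) :
    worstBellman c lmin lmax 𝒟 t V x a ≤ bellman l V x a := by
  refine csInf_le ⟨0, ?_⟩ ⟨l, hl, rfl⟩
  rintro _ ⟨l', hl', rfl⟩
  exact (hV.bellman ha haK (nonneg_of_lamLower_le hl'.1) x).1

theorem ValueBound.worstBellman : ValueBound K fun x => worstBellman c lmin lmax 𝒟 t V x a := by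
  refine fun x => ⟨Real.sInf_nonneg ?_, ?_⟩
  · rintro _ ⟨l, hl, rfl⟩
    exact (hV.bellman ha haK (nonneg_of_lamLower_le hl.1) x).1
  rcases (Set.Icc (lamLower c lmin 𝒟 t a) (lamUpper c lmax 𝒟 t a)).eq_empty_or_nonempty
    with hempty | ⟨l, hl⟩
  · simp only [OfflinePricing.worstBellman, hempty, Set.image_empty, Real.sInf_empty]
    exact mul_nonneg (ha.trans haK) (Nat.cast_nonneg _)
  · exact (worstBellman_le_bellman c lmin lmax 𝒟 hV t ha haK x hl).trans
      (hV.bellman ha haK (nonneg_of_lamLower_le hl.1) x).2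

end WorstBellman

theorem pessValue_of_lt (t : Fin T) (x : Fin (L + 1)) :
    pessValue c lmin lmax 𝒟 t x = ⨆ a, pessQ c lmin lmax 𝒟 t x a := by
  rw [pessValue, dif_pos t.isLt]
  rfl

theorem pessValue_of_le {t : ℕ} (ht : T ≤ t) : pessValue c lmin lmax 𝒟 t = 0 := by
  funext x
  rw [pessValue, dif_neg ht.not_gt]
  rfl

theorem pessQ_le_pessValue (t : Fin T) (x : Fin (L + 1)) (a : 𝒜) :
    pessQ c lmin lmax 𝒟 t x a ≤ pessValue c lmin lmax 𝒟 t x := by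
  rw [pessValue_of_lt]
  exact le_ciSup (f := pessQ c lmin lmax 𝒟 t x) (Set.finite_range _).bddAbove a

variable (h𝒜 : ∀ a ∈ 𝒜, 0 ≤ a ∧ a ≤ K)

include h𝒜

theorem valueBound_pessValue [Nonempty 𝒜] (t : ℕ) : ValueBound K (pessValue c lmin lmax 𝒟 t) := by
  obtain ⟨a₀⟩ := ‹Nonempty 𝒜›
  rcases le_total T t with hT | hT
  · rw [pessValue_of_le c lmin lmax 𝒟 hT]
    exact valueBound_zero ((h𝒜 a₀ a₀.2).1.trans (h𝒜 a₀ a₀.2).2)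
  induction hT using Nat.decreasingInduction with
  | self =>
    rw [pessValue_of_le c lmin lmax 𝒟 le_rfl]
    exact valueBound_zero ((h𝒜 a₀ a₀.2).1.trans (h𝒜 a₀ a₀.2).2)
  | of_succ t ht ih =>
    intro x
    have hQ (a : 𝒜) := ih.worstBellman c lmin lmax 𝒟 ⟨t, ht⟩ (h𝒜 a a.2).1 (h𝒜 a a.2).2 x
    have : Nonempty 𝒜 := ⟨a₀⟩
    rw [pessValue_of_lt c lmin lmax 𝒟 ⟨t, ht⟩ x]
    exact ⟨Real.iSup_nonneg fun a => (hQ a).1, ciSup_le fun a => (hQ a).2⟩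

variable {c lmin lmax 𝒟} {M : Model L 𝒜} (h : Accurate M c 𝒟) (hM : M.Admissible T lmin lmax)

include h hM

theorem pessValue_le_bellman {act : ℕ → Fin (L + 1) → 𝒜} (hact : IsPessimistic c lmin lmax 𝒟 act)
    (t : Fin T) (x : Fin (L + 1)) : pessValue c lmin lmax 𝒟 t x ≤
      bellman (M.lam t (act t x)) (pessValue c lmin lmax 𝒟 (t + 1)) x (act t x) := by
  have : Nonempty 𝒜 := ⟨act 0 0⟩
  rw [pessValue_of_lt]
  exact (ciSup_le fun a => hact t x a).trans
    (worstBellman_le_bellman c lmin lmax 𝒟 (valueBound_pessValue c lmin lmax 𝒟 h𝒜 _) t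
      (h𝒜 _ (act t x).2).1 (h𝒜 _ (act t x).2).2 x (h.mem_Icc t _ hM))

theorem bellman_sub_pessValue_le (t : Fin T) (x : Fin (L + 1)) {a : 𝒜} {r : ℝ}
    (hr : ∀ l ∈ Set.Icc (lamLower c lmin 𝒟 t a) (lamUpper c lmax 𝒟 t a),
      |M.lam t a - l| ≤ r) :
    bellman (M.lam t a) (pessValue c lmin lmax 𝒟 (t + 1)) x a - pessValue c lmin lmax 𝒟 t x ≤
      K * L ^ 2 * r := by
  have : Nonempty 𝒜 := ⟨a⟩
  obtain ⟨ha, haK⟩ := h𝒜 a a.2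
  have hK : 0 ≤ K := ha.trans haK
  suffices bellman (M.lam t a) (pessValue c lmin lmax 𝒟 (t + 1)) x a - K * L ^ 2 * r ≤
      pessQ c lmin lmax 𝒟 t x a by
    linarith [pessQ_le_pessValue c lmin lmax 𝒟 t x a]
  refine le_csInf ⟨_, _, h.mem_Icc t a hM, rfl⟩ ?_
  rintro _ ⟨l, hl, rfl⟩
  rw [sub_le_comm]
  calc _ ≤ K * L ^ 2 * |M.lam t a - l| := (le_abs_self _).trans <|
        (valueBound_pessValue c lmin lmax 𝒟 h𝒜 _).abs_bellman_sub_le ha haK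
          (M.lam t a).coe_nonneg (nonneg_of_lamLower_le hl.1) x
    _ ≤ K * L ^ 2 * r := by
        have := hr l hl
        gcongr

end PessimisticValue

/-! ### The regret of the pessimistic policy -/

section RegretBound

variable (M : Model L 𝒜) (c : ℝ) (lmax : ℝ≥0) (πs : Policy L 𝒜)
  (𝒟 : Data T N L 𝒜)

theorem estimationTerm_eq : estimationTerm M πs 𝒟 = ∑ t : Fin T, ∑ a,
    (covered M T πs t).indicator (fun a => M.priceProb T πs t a * rate 𝒟 t a) a := by
  classical
  refine Finset.sum_congr rfl fun t _ => (M.integral_price M.behavior t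
    (g := (covered M T πs t).indicator
      (fun a => M.priceProb T πs t a / M.priceProb T M.behavior t a * rate 𝒟 t a))).trans ?_
  refine Finset.sum_congr rfl fun a _ => ?_
  by_cases hcov : a ∈ covered M T πs t
  · rw [Set.indicator_of_mem hcov, Set.indicator_of_mem hcov]
    rcases (M.priceProb_nonneg πs t a).eq_or_lt with hzero | hpos
    · simp [← hzero]
    · have := (hcov hpos).ne'
      field_simp
  · rw [Set.indicator_of_notMem hcov, Set.indicator_of_notMem hcov, mul_zero]

theorem identificationTerm_eq : identificationTerm M c lmax πs 𝒟 = ∑ t : Fin T, ∑ a,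
    (covered M T πs t)ᶜ.indicator (fun a => M.priceProb T πs t a * eta M c lmax 𝒟 t a) a := by
  refine Finset.sum_congr rfl fun t _ => (M.integral_price πs t
    (g := (covered M T πs t)ᶜ.indicator (fun a => eta M c lmax 𝒟 t a))).trans ?_
  exact Finset.sum_congr rfl fun a _ => (Set.indicator_mul_right _ _ _).symm

open Classical in
/-- The error in the demand parameter of the price `a` that is charged to period `t`: twice the
confidence radius for a covered price, the width `eta` of the identified set otherwise. -/
def errorBound (t : Fin T) (a : 𝒜) : ℝ :=
  if a ∈ covered M T πs t then 2 * delta c 𝒟 t a else eta M c lmax 𝒟 t a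

theorem sum_priceProb_mul_errorBound :
    ∑ t : Fin T, ∑ a, M.priceProb T πs t a * errorBound M c lmax πs 𝒟 t a =
      2 * c * estimationTerm M πs 𝒟 + identificationTerm M c lmax πs 𝒟 := by
  simp only [estimationTerm_eq, identificationTerm_eq, Finset.mul_sum, ← Finset.sum_add_distrib]
  refine Finset.sum_congr rfl fun t _ => Finset.sum_congr rfl fun a _ => ?_
  by_cases hcov : a ∈ covered M T πs t
  · rw [errorBound, if_pos hcov, Set.indicator_of_mem hcov,
      Set.indicator_of_notMem (Set.notMem_compl_iff.2 hcov), delta]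
    ring
  · rw [errorBound, if_neg hcov, Set.indicator_of_notMem hcov, Set.indicator_of_mem hcov]
    ring

theorem estimationTerm_nonneg : 0 ≤ estimationTerm M πs 𝒟 := by
  rw [estimationTerm_eq]
  exact Finset.sum_nonneg fun t _ => Finset.sum_nonneg fun a _ => Set.indicator_nonneg
    (fun a _ => mul_nonneg (M.priceProb_nonneg πs t a) (rate_nonneg 𝒟 t a)) a

variable {M c lmax 𝒟} {lmin : ℝ≥0}

section Accurate

variable (h : Accurate M c 𝒟) (hM : M.Admissible T lmin lmax) (hN : 1 ≤ N)

include h hM hN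

theorem identificationTerm_nonneg : 0 ≤ identificationTerm M c lmax πs 𝒟 := by
  rw [identificationTerm_eq]
  exact Finset.sum_nonneg fun t _ => Finset.sum_nonneg fun a _ => Set.indicator_nonneg
    (fun a _ => mul_nonneg (M.priceProb_nonneg πs t a)
      ((abs_nonneg _).trans (h.abs_sub_le_eta t a hM hN (h.mem_Icc t a hM)))) a

theorem regretBound_nonneg : 0 ≤ regretBound M c lmax πs 𝒟 :=
  add_nonneg (estimationTerm_nonneg M πs 𝒟) (identificationTerm_nonneg πs h hM hN)

variable (hobs : ∀ t a, 0 < M.priceProb T M.behavior t a → 0 < count 𝒟 t a)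

include hobs

theorem Accurate.abs_sub_le_errorBound {t : Fin T} {a : 𝒜} (ha : 0 < M.priceProb T πs t a)
    {l : ℝ} (hl : l ∈ Set.Icc (lamLower c lmin 𝒟 t a) (lamUpper c lmax 𝒟 t a)) :
    |l - M.lam t a| ≤ errorBound M c lmax πs 𝒟 t a := by
  unfold errorBound
  split_ifs with hcov
  · exact h.abs_sub_le_two_mul_delta (hobs t a (hcov ha)) hl
  · exact h.abs_sub_le_eta t a hM hN hl

end Accurate

variable {K : ℝ} (h𝒜 : ∀ a ∈ 𝒜, 0 ≤ a ∧ a ≤ K) (h : Accurate M c 𝒟)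
  (hM : M.Admissible T lmin lmax)

include h𝒜 h hM

theorem integral_pessValue_le_integral_totalReward {act : ℕ → Fin (L + 1) → 𝒜}
    (hact : IsPessimistic c lmin lmax 𝒟 act) :
    ∫ x, pessValue c lmin lmax 𝒟 0 x ∂M.start.toMeasure ≤
      ∫ w, totalReward w ∂(M.trajLaw T M.start (markovPolicy act)) := by
  have : Nonempty 𝒜 := ⟨act 0 0⟩
  rw [M.integral_totalReward_eq_add_sum_bellman_sub M.start (markovPolicy act) T
    (fun t => (valueBound_pessValue c lmin lmax 𝒟 h𝒜 t).apply_zero)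
    (pessValue_of_le c lmin lmax 𝒟 le_rfl), le_add_iff_nonneg_right]
  refine Finset.sum_nonneg fun t ht => ?_
  rw [M.integral_jointLaw_markovPolicy M.start act t (fun z =>
    bellman (M.lam t z.2) (pessValue c lmin lmax 𝒟 (t + 1)) z.1 z.2 -
      pessValue c lmin lmax 𝒟 t z.1)]
  exact integral_nonneg fun x =>
    sub_nonneg.2 (pessValue_le_bellman h𝒜 h hM hact ⟨t, Finset.mem_range.1 ht⟩ x)

variable (hN : 1 ≤ N) (hobs : ∀ t a, 0 < M.priceProb T M.behavior t a → 0 < count 𝒟 t a)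

include hN hobs

theorem integral_bellman_sub_pessValue_le (t : Fin T) :
    ∫ z, (bellman (M.lam t z.2) (pessValue c lmin lmax 𝒟 (t + 1)) z.1 z.2 -
        pessValue c lmin lmax 𝒟 t z.1) ∂(M.jointLaw M.start πs t).toMeasure ≤
      K * L ^ 2 * ∑ a, M.priceProb T πs t a * errorBound M c lmax πs 𝒟 t a := by
  rw [← M.integral_jointLaw_snd πs t (errorBound M c lmax πs 𝒟 t), ← integral_const_mul,
    PMF.integral_eq_sum, PMF.integral_eq_sum]
  refine Finset.sum_le_sum fun z _ => ?_
  rcases (ENNReal.toReal_nonneg (a := M.jointLaw M.start πs t z)).eq_or_lt with hzero | hpos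
  · simp only [← hzero, zero_smul, le_refl]
  refine smul_le_smul_of_nonneg_left (bellman_sub_pessValue_le h𝒜 h hM t z.1 fun l hl => ?_) hpos.le
  rw [abs_sub_comm]
  exact h.abs_sub_le_errorBound πs hM hN hobs
    (hpos.trans_le (M.toReal_jointLaw_le_priceProb πs t z)) hl

theorem integral_totalReward_le_integral_pessValue_add [Nonempty 𝒜] :
    ∫ w, totalReward w ∂(M.trajLaw T M.start πs) ≤
      ∫ x, pessValue c lmin lmax 𝒟 0 x ∂M.start.toMeasure +
        K * L ^ 2 * (2 * c * estimationTerm M πs 𝒟 + identificationTerm M c lmax πs 𝒟) := by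
  rw [M.integral_totalReward_eq_add_sum_bellman_sub M.start πs T
    (fun t => (valueBound_pessValue c lmin lmax 𝒟 h𝒜 t).apply_zero)
    (pessValue_of_le c lmin lmax 𝒟 le_rfl), Finset.sum_range, ← sum_priceProb_mul_errorBound,
    Finset.mul_sum]
  gcongr with t
  exact integral_bellman_sub_pessValue_le πs h𝒜 h hM hN hobs t

theorem regret_le_of_accurate (hc : 0 ≤ c) {πs : Policy L 𝒜} (hπ : M.IsOptimal T πs)
    {act : ℕ → Fin (L + 1) → 𝒜} (hact : IsPessimistic c lmin lmax 𝒟 act) :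
    M.regret T (markovPolicy act) ≤ K * L ^ 2 * (2 * c + 1) * regretBound M c lmax πs 𝒟 := by
  have : Nonempty 𝒜 := ⟨act 0 0⟩
  have hK : 0 ≤ K := (h𝒜 _ (act 0 0).2).1.trans (h𝒜 _ (act 0 0).2).2
  have hlow := integral_pessValue_le_integral_totalReward h𝒜 h hM hact
  have hup := integral_totalReward_le_integral_pessValue_add πs h𝒜 h hM hN hobs
  calc M.regret T (markovPolicy act)
      ≤ K * L ^ 2 * (2 * c * estimationTerm M πs 𝒟 + identificationTerm M c lmax πs 𝒟) := by
        rw [hπ.regret_eq_sub]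
        linarith
    _ ≤ K * L ^ 2 * ((2 * c + 1) * regretBound M c lmax πs 𝒟) := by
        have hF := estimationTerm_nonneg M πs 𝒟
        have hS := mul_nonneg hc (identificationTerm_nonneg πs h hM hN)
        gcongr
        rw [regretBound]
        linarith
    _ = _ := (mul_assoc _ _ _).symm

end RegretBound

section Probability

theorem integral_sum_inv_count (M : Model L 𝒜) (t : Fin T) :
    ∫ 𝒟, ∑ a ∈ observed 𝒟 t, (count 𝒟 t a : ℝ)⁻¹ ∂(M.dataLaw T N) =
      ∑ a, ∫ 𝒟, (count 𝒟 t a : ℝ)⁻¹ ∂(M.dataLaw T N) := by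
  rw [← integral_finsetSum]
  · congr 1
    funext 𝒟
    refine Finset.sum_subset (Finset.subset_univ _) fun a _ ha => ?_
    rw [mem_observed, not_lt, Nat.le_zero] at ha
    rw [ha, Nat.cast_zero, inv_zero]
  · refine fun a _ => integrable_of_forall_abs_le _ (K := 1) fun 𝒟 => ?_
    rw [abs_of_nonneg (by positivity)]
    exact Nat.cast_inv_le_one _

theorem measureReal_delta_lt_le_integral_inv_count (M : Model L 𝒜) (t : Fin T) (a : 𝒜)
    {lmax : ℝ≥0} (hl : M.lam t a ≤ lmax) {c : ℝ} (hc : (lmax : ℝ) + 2 ≤ c) :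
    (M.dataLaw T N).real {𝒟 | 0 < count 𝒟 t a ∧ delta c 𝒟 t a < |lamHat 𝒟 t a - M.lam t a|} ≤
      ∫ 𝒟, (count 𝒟 t a : ℝ)⁻¹ ∂(M.dataLaw T N) := by
  refine (M.measureReal_le_count_and_delta_lt_le t a hl hc one_pos).trans_eq ?_
  congr 1
  funext 𝒟
  split_ifs with hpos
  · rfl
  · rw [Nat.lt_one_iff.1 (not_le.1 hpos), Nat.cast_zero, inv_zero]

variable {M : Model L 𝒜} {lmin lmax : ℝ≥0} (hM : M.Admissible T lmin lmax) {c : ℝ}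
  (hc : (lmax : ℝ) + 2 ≤ c)

include hM hc

theorem one_sub_le_measureReal_accurate :
    1 - ∑ t : Fin T, ((∫ 𝒟, ∑ a ∈ observed 𝒟 t, (count 𝒟 t a : ℝ)⁻¹ ∂(M.dataLaw T N)) +
        M.kappa T N t) ≤
      (M.dataLaw T N).real {𝒟 | Accurate M c 𝒟 ∧
        ∀ t a, 0 < M.priceProb T M.behavior t a → 0 < count 𝒟 t a} := by
  classical
  rw [sub_le_comm, ← probReal_compl_eq_one_sub .of_discrete]
  let P (t : Fin T) : Finset 𝒜 := {a | 0 < M.priceProb T M.behavior t a}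
  have hsub : {𝒟 : Data T N L 𝒜 | Accurate M c 𝒟 ∧
      ∀ t a, 0 < M.priceProb T M.behavior t a → 0 < count 𝒟 t a}ᶜ ⊆
      ⋃ t ∈ Finset.univ,
        ((⋃ a ∈ Finset.univ,
          {𝒟 | 0 < count 𝒟 t a ∧ delta c 𝒟 t a < |lamHat 𝒟 t a - M.lam t a|}) ∪
        ⋃ a ∈ P t, {𝒟 | count 𝒟 t a = 0}) := by
    intro 𝒟 h𝒟
    by_contra hcon
    refine h𝒟 ⟨fun t a hpos => ?_, fun t a hpos => ?_⟩ <;> by_contra hlt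
    · exact hcon (Set.mem_biUnion (Finset.mem_univ t) (Or.inl
        (Set.mem_biUnion (Finset.mem_univ a) ⟨hpos, not_le.1 hlt⟩)))
    · exact hcon (Set.mem_biUnion (Finset.mem_univ t) (Or.inr
        (Set.mem_biUnion (x := a) (by simpa [P] using hpos) (by simpa using hlt))))
  refine (measureReal_mono hsub (measure_ne_top _ _)).trans
    ((measureReal_biUnion_finset_le _ _).trans (Finset.sum_le_sum fun t _ => ?_))
  refine (measureReal_union_le _ _).trans (add_le_add ?_ ?_)
  · rw [integral_sum_inv_count]
    exact (measureReal_biUnion_finset_le _ _).trans (Finset.sum_le_sum fun a _ =>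
      measureReal_delta_lt_le_integral_inv_count M t a (hM.upper t t.isLt a) hc)
  · exact (measureReal_biUnion_finset_le _ _).trans_eq
      (Finset.sum_congr rfl fun a _ => M.measureReal_count_eq_zero t a)

theorem one_sub_le_measureReal_regret_le {K : ℝ} (h𝒜 : ∀ a ∈ 𝒜, 0 ≤ a ∧ a ≤ K)
    {πs : Policy L 𝒜} (hπ : M.IsOptimal T πs) (hN : 1 ≤ N) {C : ℝ}
    (hC : K * L ^ 2 * (2 * c + 1) ≤ C) :
    1 - ∑ t : Fin T, ((∫ 𝒟, ∑ a ∈ observed 𝒟 t, (count 𝒟 t a : ℝ)⁻¹ ∂(M.dataLaw T N)) +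
        M.kappa T N t) ≤
      (M.dataLaw T N).real {𝒟 | ∀ act, IsPessimistic c lmin lmax 𝒟 act →
        M.regret T (markovPolicy act) ≤ C * regretBound M c lmax πs 𝒟} := by
  refine (one_sub_le_measureReal_accurate hM hc).trans (measureReal_mono ?_)
  rintro 𝒟 ⟨hacc, hobs⟩ act hact
  have hc0 : 0 ≤ c := le_trans (by positivity) hc
  exact (regret_le_of_accurate h𝒜 hacc hM hN hobs hc0 hπ hact).trans
    (mul_le_mul_of_nonneg_right hC (regretBound_nonneg πs hacc hM hN))

end Probability

/-! ### Typical data -/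

theorem count_le (𝒟 : Data T N L 𝒜) (t : Fin T) (a : 𝒜) : count 𝒟 t a ≤ N :=
  (Finset.card_le_univ _).trans_eq (Fintype.card_fin N)

namespace Model

/-- The observations of price `a` in period `t` are typical: their number is within `s * N` of its
mean and vanishes for a price that is never posted, and the demand estimate is within its confidence
radius as soon as it rests on `s * N` observations. -/
structure Typical (M : Model L 𝒜) (c s : ℝ) (𝒟 : Data T N L 𝒜) (t : Fin T) (a : 𝒜) : Prop where
  abs_count_sub_le : |(count 𝒟 t a : ℝ) - N * M.priceProb T M.behavior t a| ≤ s * N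
  count_eq_zero : M.priceProb T M.behavior t a = 0 → count 𝒟 t a = 0
  abs_lamHat_sub_le : s * N ≤ count 𝒟 t a → |lamHat 𝒟 t a - M.lam t a| ≤ delta c 𝒟 t a

variable (M : Model L 𝒜) (t : Fin T) (a : 𝒜)

theorem measureReal_count_ne_zero (h : M.priceProb T M.behavior t a = 0) :
    (M.dataLaw T N).real {𝒟 | count 𝒟 t a ≠ 0} = 0 := by
  have hcompl := probReal_compl_eq_one_sub (μ := M.dataLaw T N)
    (s := {𝒟 | count 𝒟 t a = 0}) .of_discrete
  rwa [measureReal_count_eq_zero, h, sub_zero, one_pow, sub_self] at hcompl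

theorem measureReal_le_count_and_delta_lt_le_inv {lmax : ℝ≥0} (hl : M.lam t a ≤ lmax) {c : ℝ}
    (hc : (lmax : ℝ) + 2 ≤ c) {r : ℝ} (hr : 0 < r) :
    (M.dataLaw T N).real
      {𝒟 | r ≤ count 𝒟 t a ∧ delta c 𝒟 t a < |lamHat 𝒟 t a - M.lam t a|} ≤ r⁻¹ := by
  have hinv : ∀ 𝒟 : Data T N L 𝒜,
      (if ⌈r⌉₊ ≤ count 𝒟 t a then (count 𝒟 t a : ℝ)⁻¹ else 0) ≤ r⁻¹ := fun 𝒟 => by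
    split_ifs with h
    · exact inv_anti₀ hr (Nat.ceil_le.1 h)
    · positivity
  have hnonneg : ∀ 𝒟 : Data T N L 𝒜,
      0 ≤ if ⌈r⌉₊ ≤ count 𝒟 t a then (count 𝒟 t a : ℝ)⁻¹ else 0 := fun 𝒟 => by positivity
  simp only [← Nat.ceil_le]
  refine (M.measureReal_le_count_and_delta_lt_le t a hl hc (Nat.ceil_pos.2 hr)).trans ?_
  refine (integral_mono (integrable_of_forall_abs_le _ (K := r⁻¹) fun 𝒟 => ?_)
    (integrable_const _) hinv).trans (by simp)
  exact (abs_of_nonneg (hnonneg 𝒟)).trans_le (hinv 𝒟)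

theorem measureReal_not_typical_le {lmax : ℝ≥0} (hl : M.lam t a ≤ lmax) {c : ℝ}
    (hc : (lmax : ℝ) + 2 ≤ c) {s : ℝ} (hs : 0 < s) (hN : 1 ≤ N) :
    (M.dataLaw T N).real {𝒟 | ¬ M.Typical c s 𝒟 t a} ≤ (1 / s ^ 2 + 1 / s) / N := by
  let deviates : Set (Data T N L 𝒜) :=
    {𝒟 | s * N < |(count 𝒟 t a : ℝ) - N * M.priceProb T M.behavior t a|}
  let appears : Set (Data T N L 𝒜) := {𝒟 | M.priceProb T M.behavior t a = 0 ∧ count 𝒟 t a ≠ 0}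
  let misleads : Set (Data T N L 𝒜) :=
    {𝒟 | s * N ≤ count 𝒟 t a ∧ delta c 𝒟 t a < |lamHat 𝒟 t a - M.lam t a|}
  have hsub : {𝒟 : Data T N L 𝒜 | ¬ M.Typical c s 𝒟 t a} ⊆ deviates ∪ appears ∪ misleads := by
    intro 𝒟 h
    by_contra hnot
    simp only [deviates, appears, misleads, Set.mem_union, Set.mem_ofPred_eq, not_or, not_lt,
      not_and, not_not] at hnot
    exact h ⟨hnot.1.1, hnot.1.2, hnot.2⟩
  have happears : (M.dataLaw T N).real appears = 0 := by
    by_cases hp : M.priceProb T M.behavior t a = 0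
    · simpa only [appears, hp, true_and] using M.measureReal_count_ne_zero t a hp
    · simp only [appears, hp, false_and, Set.ofPred_false, measureReal_empty]
  have hsN : 0 < s * N := by positivity
  calc (M.dataLaw T N).real {𝒟 | ¬ M.Typical c s 𝒟 t a}
      ≤ (M.dataLaw T N).real (deviates ∪ appears ∪ misleads) := measureReal_mono hsub
    _ ≤ (M.dataLaw T N).real deviates + (M.dataLaw T N).real appears +
        (M.dataLaw T N).real misleads := (measureReal_union_le _ _).trans
          (add_le_add_left (measureReal_union_le _ _) _)
    _ ≤ 1 / s ^ 2 / N + 0 + (s * N)⁻¹ := add_le_add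
          (add_le_add (M.measureReal_count_deviation_le t a hs) happears.le)
          (M.measureReal_le_count_and_delta_lt_le_inv t a hl hc hsN)
    _ = (1 / s ^ 2 + 1 / s) / N := by field_simp; ring

theorem one_sub_le_measureReal_typical {lmax : ℝ≥0} (hM : ∀ t < T, ∀ a, M.lam t a ≤ lmax) {c : ℝ}
    (hc : (lmax : ℝ) + 2 ≤ c) {s : ℝ} (hs : 0 < s) (hN : 1 ≤ N) :
    1 - T * 𝒜.card * (1 / s ^ 2 + 1 / s) / N ≤
      (M.dataLaw T N).real {𝒟 | ∀ t a, M.Typical c s 𝒟 t a} := by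
  have hcompl : {𝒟 : Data T N L 𝒜 | ∀ t a, M.Typical c s 𝒟 t a}ᶜ =
      ⋃ z ∈ (Finset.univ : Finset (Fin T × 𝒜)), {𝒟 | ¬ M.Typical c s 𝒟 z.1 z.2} := by
    ext 𝒟
    simp only [Set.mem_compl_iff, Set.mem_ofPred_eq, not_forall, Finset.mem_univ, Set.iUnion_true,
      Set.mem_iUnion, Prod.exists]
  have hle : (M.dataLaw T N).real {𝒟 | ∀ t a, M.Typical c s 𝒟 t a}ᶜ ≤
      T * 𝒜.card * (1 / s ^ 2 + 1 / s) / N := by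
    rw [hcompl]
    refine (measureReal_biUnion_finset_le _ _).trans ((Finset.sum_le_sum fun z _ =>
      M.measureReal_not_typical_le z.1 z.2 (hM z.1 z.1.isLt z.2) hc hs hN).trans_eq ?_)
    rw [Finset.sum_const, Finset.card_univ, Fintype.card_prod, Fintype.card_fin, Fintype.card_coe,
      nsmul_eq_mul]
    push_cast
    ring
  rw [probReal_compl_eq_one_sub .of_discrete] at hle
  linarith

theorem eventually_one_sub_le_measureReal_typical {M : ℕ → Model L 𝒜} {lmax : ℝ≥0}
    (hM : ∀ N, ∀ t < T, ∀ a, (M N).lam t a ≤ lmax) {c : ℝ} (hc : (lmax : ℝ) + 2 ≤ c) {s : ℝ}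
    (hs : 0 < s) {ε : ℝ} (hε : 0 < ε) :
    ∀ᶠ N in Filter.atTop,
      1 - ε ≤ ((M N).dataLaw T N).real {𝒟 | ∀ t a, (M N).Typical c s 𝒟 t a} := by
  have hsmall := (tendsto_const_div_atTop_nhds_zero_nat
    (T * 𝒜.card * (1 / s ^ 2 + 1 / s))).eventually_le_const hε
  filter_upwards [hsmall, Filter.eventually_ge_atTop 1] with N hN hN1
  exact (sub_le_sub_left hN 1).trans ((M N).one_sub_le_measureReal_typical (hM N) hc hs hN1)

end Model

/-! ### Selling a single unit in the last period -/

theorem exp_neg_mul_le_integral_nextLevel (l : ℝ≥0) {V : Fin (L + 1) → ℝ} (hV : ∀ x, 0 ≤ V x)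
    (x : Fin (L + 1)) :
    Real.exp (-l) * V x ≤ ∫ d, V (nextLevel x d) ∂(poissonMeasure l) := by
  have hnext : nextLevel x 0 = x := by ext; simp [nextLevel]
  calc Real.exp (-l) * V x
      = ∫ d in {0}, V (nextLevel x d) ∂(poissonMeasure l) := by
        rw [integral_singleton, poissonMeasure_real_singleton, hnext]
        simp
    _ ≤ _ := setIntegral_le_integral (integrable_nextLevel _ V x) (ae_of_all _ fun d => hV _)

namespace Model

theorem exp_pow_mul_le_levelLaw (M : Model L 𝒜) (s : PMF (Fin (L + 1))) (π : Policy L 𝒜)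
    {lmax : ℝ≥0} {n : ℕ} (hM : ∀ t < n, ∀ a, M.lam t a ≤ lmax) (x : Fin (L + 1)) :
    Real.exp (-lmax) ^ n * (s x).toReal ≤ (M.levelLaw s π n x).toReal := by
  have hint : ∀ p : PMF (Fin (L + 1)),
      (p x).toReal = ∫ y, ({x} : Set (Fin (L + 1))).indicator 1 y ∂p.toMeasure := fun p => by
    rw [integral_indicator_one .of_discrete, measureReal_def,
      PMF.toMeasure_apply_singleton _ _ .of_discrete]
  have hind : ∀ y, 0 ≤ ({x} : Set (Fin (L + 1))).indicator (1 : Fin (L + 1) → ℝ) y :=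
    Set.indicator_nonneg fun _ _ => zero_le_one
  induction n with
  | zero => rw [levelLaw_zero, pow_zero, one_mul]
  | succ n ih =>
    have hprev := ih fun t ht => hM t (by omega)
    rw [hint (M.levelLaw s π n), integral_levelLaw] at hprev
    rw [hint (M.levelLaw s π (n + 1)), integral_levelLaw_succ, pow_succ', mul_assoc]
    refine (mul_le_mul_of_nonneg_left hprev (Real.exp_pos _).le).trans ?_
    rw [← integral_const_mul]
    refine integral_mono .of_finite .of_finite fun z => ?_
    refine le_trans ?_ (exp_neg_mul_le_integral_nextLevel _ hind z.1)
    have hl : (M.lam n z.2 : ℝ) ≤ lmax := hM n (by omega) z.2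
    exact mul_le_mul_of_nonneg_right (Real.exp_le_exp.2 (neg_le_neg hl)) (hind z.1)

end Model

/-- The expected revenue, in the last period, of posting price `a` with one unit in stock and demand
parameter `l`. -/
def unitRevenue (l a : ℝ) : ℝ := a * (1 - Real.exp (-l))

theorem unitRevenue_le_unitRevenue {a : ℝ} (ha : 0 ≤ a) {l l' : ℝ} (h : l ≤ l') :
    unitRevenue l a ≤ unitRevenue l' a :=
  mul_le_mul_of_nonneg_left (sub_le_sub_left (Real.exp_le_exp.2 (neg_le_neg h)) 1) ha

theorem pessQ_last {c : ℝ} {lmin lmax : ℝ≥0} {𝒟 : Data T N L 𝒜} {t : Fin T} (ht : (t : ℕ) + 1 = T)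
    {x : Fin (L + 1)} (hx : (x : ℕ) = 1) {a : 𝒜} (ha : 0 ≤ (a : ℝ))
    (hΩ : lamLower c lmin 𝒟 t a ≤ lamUpper c lmax 𝒟 t a) :
    pessQ c lmin lmax 𝒟 t x a = unitRevenue (lamLower c lmin 𝒟 t a) a := by
  have hbellman : (fun l : ℝ => bellman l (pessValue c lmin lmax 𝒟 ((t : ℕ) + 1)) x (a : ℝ)) =
      fun l => unitRevenue l a := by
    funext l
    rw [bellman_of_val_eq_one _ _ hx, pessValue_of_le c lmin lmax 𝒟 ht.ge, unitRevenue]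
    exact add_eq_left.2 (zero_mul _)
  rw [pessQ, worstBellman, hbellman]
  refine IsLeast.csInf_eq ⟨⟨_, Set.left_mem_Icc.2 hΩ, rfl⟩, ?_⟩
  rintro _ ⟨l, hl, rfl⟩
  exact unitRevenue_le_unitRevenue ha hl.1

namespace Model

theorem unitRevenue_sub_le_gap (M : Model L 𝒜) {t : ℕ} (ht : t + 1 = T) {x : Fin (L + 1)}
    (hx : (x : ℕ) = 1) (a b : 𝒜) :
    unitRevenue (M.lam t b) b - unitRevenue (M.lam t a) a ≤ M.gap T t (x, a) := by
  have hbellman : ∀ l a : ℝ, bellman l (M.optVal T (t + 1)) x a = unitRevenue l a := fun l a => by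
    rw [bellman_of_val_eq_one l _ hx, ht, M.optVal_self, unitRevenue]
    exact add_eq_left.2 (zero_mul _)
  have hb := M.gap_nonneg (T := T) (t := t) (by omega) (x, b)
  simp only [gap, hbellman] at hb ⊢
  linarith

theorem exp_pow_mul_unitRevenue_sub_le_regret [Nonempty 𝒜] (M : Model L 𝒜) {lmax : ℝ≥0}
    (hM : ∀ t < T, ∀ a, M.lam t a ≤ lmax) {x : Fin (L + 1)} (hstart : M.start = PMF.pure x)
    (hx : (x : ℕ) = 1) {t : ℕ} (ht : t + 1 = T) (act : ℕ → Fin (L + 1) → 𝒜) (b : 𝒜) :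
    Real.exp (-lmax) ^ T *
        (unitRevenue (M.lam t b) b - unitRevenue (M.lam t (act t x)) (act t x)) ≤
      M.regret T (markovPolicy act) := by
  have htT : t < T := by omega
  have hsurvive := M.exp_pow_mul_le_levelLaw M.start (markovPolicy act)
    (fun i hi => hM i (hi.trans htT)) x
  rw [hstart, PMF.pure_apply, if_pos rfl, ENNReal.toReal_one, mul_one, ← hstart] at hsurvive
  have hexp : Real.exp (-lmax) ^ T ≤ Real.exp (-(lmax : ℝ)) ^ t :=
    pow_le_pow_of_le_one (Real.exp_pos _).le (Real.exp_le_one_iff.2 (by simp)) htT.le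
  have hgap := M.gap_nonneg (T := T) htT (x, act t x)
  calc _ ≤ Real.exp (-lmax) ^ T * M.gap T t (x, act t x) :=
        mul_le_mul_of_nonneg_left (M.unitRevenue_sub_le_gap ht hx _ b) (by positivity)
    _ ≤ (M.levelLaw M.start (markovPolicy act) t x).toReal * M.gap T t (x, act t x) :=
        mul_le_mul_of_nonneg_right (hexp.trans hsurvive) hgap
    _ ≤ _ := M.levelLaw_mul_gap_le_regret htT act x

end Model

/-! ### Processes with independent prices -/

namespace Model

/-- The process with initial inventory `x`, demand parameters `lam` in every period, and prices
drawn independently from `q`. -/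
def iid (x : Fin (L + 1)) (lam : 𝒜 → ℝ≥0) (q : PMF 𝒜) : Model L 𝒜 where
  start := PMF.pure x
  lam := fun _ => lam
  behavior := fun _ _ _ => q

theorem priceProb_iid (x : Fin (L + 1)) (lam : 𝒜 → ℝ≥0) (q : PMF 𝒜) (t : Fin T) (a : 𝒜) :
    (iid x lam q).priceProb T (iid x lam q).behavior t a = (q a).toReal := by
  have hq : ((iid x lam q).jointLaw (iid x lam q).start (iid x lam q).behavior t).map Prod.snd
      = q := by
    simp only [jointLaw, PMF.map_bind, PMF.map_comp, Function.comp_def, iid]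
    exact (congrArg _ (funext fun _ => PMF.map_id q)).trans (PMF.bind_const _ _)
  rw [priceProb_eq, hq]

theorem behaviorLaw_iid_congr (x : Fin (L + 1)) {lam lam' : 𝒜 → ℝ≥0} {q : PMF 𝒜}
    (h : ∀ a ∈ q.support, lam a = lam' a) :
    (iid x lam q).behaviorLaw T = (iid x lam' q).behaviorLaw T := by
  have hpath : ∀ n, (iid x lam q).pathPMF (PMF.pure x) (fun _ _ _ => q) n =
      (iid x lam' q).pathPMF (PMF.pure x) (fun _ _ _ => q) n := fun n => by
    induction n with
    | zero => rfl
    | succ n ih =>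
      simp only [pathPMF, ih]
      congr 1
      funext y
      ext z
      simp only [PMF.bind_apply]
      refine tsum_congr fun a => ?_
      by_cases ha : q a = 0
      · rw [ha, zero_mul, zero_mul]
      · simp only [iid, h a ha]
  exact congrArg (fun p => (p.map Prod.fst).toMeasure) (hpath T)

end Model

/-- The law that gives `b` probability `p` and `a` probability `1 - p`. -/
def twoPoint {α : Type*} (a b : α) (p : ℝ≥0) (hp : p ≤ 1) : PMF α :=
  (PMF.ofFintype (fun heads : Bool => cond heads (p : ℝ≥0∞) (1 - p)) (by simp [hp])).map
    fun heads => cond heads b a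

section TwoPoint

variable {α : Type*} {a b : α} (p : ℝ≥0) (hp : p ≤ 1)

theorem twoPoint_right (hab : a ≠ b) : (twoPoint a b p hp b).toReal = p := by
  simp [twoPoint, PMF.map_apply, hab.symm]

theorem twoPoint_left (hab : a ≠ b) : (twoPoint a b p hp a).toReal = 1 - p := by
  simp [twoPoint, PMF.map_apply, hab, ENNReal.toReal_sub_of_le, hp]

theorem support_twoPoint_subset : (twoPoint a b p hp).support ⊆ {a, b} := by
  rw [twoPoint, PMF.support_map]
  rintro _ ⟨(_ | _), -, rfl⟩ <;> simp

end TwoPoint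

/-! ### The rate `√(log n / n)` -/

/-- The rate of a demand estimate that rests on `n` observations. -/
def logRate (n : ℕ) : ℝ := Real.sqrt (Real.log n / n)

theorem logRate_nonneg (n : ℕ) : 0 ≤ logRate n := Real.sqrt_nonneg _

theorem logRate_pos {n : ℕ} (hn : 2 ≤ n) : 0 < logRate n := by
  have : (1 : ℝ) < n := by exact_mod_cast hn
  exact Real.sqrt_pos.2 (div_pos (Real.log_pos this) (by linarith))

theorem logRate_anti {m n : ℕ} (hm : 3 ≤ m) (hmn : m ≤ n) : logRate n ≤ logRate m := by
  have hm' : Real.exp 1 ≤ m := Real.exp_one_lt_three.le.trans (by exact_mod_cast hm)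
  have hmn' : (m : ℝ) ≤ n := by exact_mod_cast hmn
  exact Real.sqrt_le_sqrt (Real.log_div_self_antitoneOn hm' (hm'.trans hmn') hmn')

theorem logRate_le_mul {m n : ℕ} {k : ℝ} (hk : 0 < k) (hn : 1 ≤ n) (hmn : m ≤ n)
    (h : n ≤ k ^ 2 * m) : logRate m ≤ k * logRate n := by
  have hn0 : (0 : ℝ) < n := by exact_mod_cast hn
  have hm0 : (0 : ℝ) < m := pos_of_mul_pos_right (hn0.trans_le h) (by positivity)
  have : 0 ≤ Real.log n := Real.log_natCast_nonneg n
  rw [logRate, logRate, ← Real.sqrt_sq hk.le, ← Real.sqrt_mul (by positivity)]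
  refine Real.sqrt_le_sqrt ?_
  rw [mul_div_assoc', div_le_div_iff₀ hm0 hn0]
  calc Real.log m * n ≤ Real.log n * (k ^ 2 * m) := by gcongr
    _ = k ^ 2 * Real.log n * m := by ring

/-- Rarer observations slow the rate down by any factor, since `m ^ 2 ≥ n` keeps `log m`
comparable to `log n`. -/
theorem mul_logRate_le {m n : ℕ} {k : ℝ} (hk : 0 < k) (hn : 1 ≤ n) (h : 2 * k ^ 2 * m ≤ n)
    (hmn : n ≤ m ^ 2) : k * logRate n ≤ logRate m := by
  have hn0 : (0 : ℝ) < n := by exact_mod_cast hn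
  have hm0 : (0 : ℝ) < m := by
    have : m ≠ 0 := by rintro rfl; omega
    positivity
  have hlog : Real.log n ≤ 2 * Real.log m := by
    have := Real.log_le_log hn0 (show (n : ℝ) ≤ (m : ℝ) ^ 2 by exact_mod_cast hmn)
    rwa [Real.log_pow, Nat.cast_ofNat] at this
  have : 0 ≤ Real.log m := Real.log_natCast_nonneg m
  rw [logRate, logRate, ← Real.sqrt_sq hk.le, ← Real.sqrt_mul (by positivity)]
  refine Real.sqrt_le_sqrt ?_
  rw [mul_div_assoc', div_le_div_iff₀ hn0 hm0]
  calc k ^ 2 * Real.log n * m ≤ k ^ 2 * (2 * Real.log m) * m := by gcongr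
    _ = Real.log m * (2 * k ^ 2 * m) := by ring
    _ ≤ _ := by gcongr

theorem tendsto_logRate : Filter.Tendsto logRate Filter.atTop (nhds 0) := by
  have h : Filter.Tendsto (fun x : ℝ => Real.log x / x) Filter.atTop (nhds 0) :=
    Real.isLittleO_log_id_atTop.tendsto_div_nhds_zero
  have hsqrt := (h.comp tendsto_natCast_atTop_atTop).sqrt
  rwa [Real.sqrt_zero] at hsqrt

theorem eventually_mul_logRate_le (K : ℝ) {ε : ℝ} (hε : 0 < ε) :
    ∀ᶠ n in Filter.atTop, K * logRate n ≤ ε := by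
  have h := tendsto_logRate.const_mul K
  rw [mul_zero] at h
  exact h.eventually_le_const hε

/-! ### Attaining the estimation term -/

section FullCoverage

variable {M : Model L 𝒜} {𝒟 : Data T N L 𝒜} {πs : Policy L 𝒜} {r : ℝ}

theorem covered_eq_univ {t : Fin T} (h : ∀ a, 0 < M.priceProb T M.behavior t a)
    (πs : Policy L 𝒜) : covered M T πs t = Set.univ :=
  Set.eq_univ_of_forall fun a _ => h a

theorem identificationTerm_eq_zero (h : ∀ t a, 0 < M.priceProb T M.behavior t a) (c : ℝ)
    (lmax : ℝ≥0) (πs : Policy L 𝒜) (𝒟 : Data T N L 𝒜) :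
    identificationTerm M c lmax πs 𝒟 = 0 := by
  simp only [identificationTerm_eq, covered_eq_univ (h _), Set.compl_univ, Set.indicator_empty,
    Finset.sum_const_zero]

theorem estimationTerm_le (hr : 0 ≤ r)
    (h : ∀ t, ∀ a ∈ covered M T πs t, 0 < M.priceProb T πs t a → rate 𝒟 t a ≤ r) :
    estimationTerm M πs 𝒟 ≤ T * r := by
  have hterm : ∀ t a, (covered M T πs t).indicator
      (fun a => M.priceProb T πs t a * rate 𝒟 t a) a ≤ M.priceProb T πs t a * r := fun t a => by
    have hnonneg := M.priceProb_nonneg πs t a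
    refine Set.indicator_apply_le' (fun hcov => ?_) fun _ => mul_nonneg hnonneg hr
    rcases hnonneg.eq_or_lt with hzero | hpos
    · rw [← hzero, zero_mul, zero_mul]
    · exact mul_le_mul_of_nonneg_left (h t a hcov hpos) hnonneg
  rw [estimationTerm_eq]
  calc _ ≤ ∑ t : Fin T, ∑ a, M.priceProb T πs t a * r :=
        Finset.sum_le_sum fun t _ => Finset.sum_le_sum fun a _ => hterm t a
    _ = T * r := by
        simp only [← Finset.sum_mul, M.sum_priceProb, one_mul, Finset.sum_const, Finset.card_univ,
          Fintype.card_fin, nsmul_eq_mul]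

theorem le_estimationTerm (hM : ∀ t a, 0 < M.priceProb T M.behavior t a) (πs : Policy L 𝒜)
    (t : Fin T) (h : ∀ a, r ≤ rate 𝒟 t a) : r ≤ estimationTerm M πs 𝒟 := by
  simp only [estimationTerm_eq, covered_eq_univ (hM _), Set.indicator_univ]
  calc r = ∑ a, M.priceProb T πs t a * r := by
        rw [← Finset.sum_mul, M.sum_priceProb, one_mul]
    _ ≤ ∑ a, M.priceProb T πs t a * rate 𝒟 t a := Finset.sum_le_sum fun a _ =>
        mul_le_mul_of_nonneg_left (h a) (M.priceProb_nonneg πs t a)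
    _ ≤ _ := Finset.single_le_sum (f := fun t => ∑ a, M.priceProb T πs t a * rate 𝒟 t a)
        (fun t _ => Finset.sum_nonneg fun a _ =>
          mul_nonneg (M.priceProb_nonneg πs t a) (rate_nonneg 𝒟 t a)) (Finset.mem_univ t)

end FullCoverage

section UnitRevenue

variable {a : ℝ} (ha : 0 ≤ a) {u : ℝ} (l : ℝ)
include ha

theorem mul_exp_neg_mul_le_unitRevenue_sub :
    a * (Real.exp (-l) * u) ≤ unitRevenue l a - unitRevenue (l - u) a := by
  have hexp : Real.exp (-(l - u)) = Real.exp (-l) * Real.exp u := by rw [← Real.exp_add]; ring_nf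
  calc a * (Real.exp (-l) * u) ≤ a * (Real.exp (-l) * (Real.exp u - 1)) := by
        have := Real.add_one_le_exp u
        gcongr
        linarith
    _ = _ := by rw [unitRevenue, unitRevenue, hexp]; ring

theorem unitRevenue_sub_le_mul_exp_neg_mul (hu : 0 ≤ u) (hu1 : u ≤ 1) :
    unitRevenue l a - unitRevenue (l - u) a ≤ a * (Real.exp (-l) * (2 * u)) := by
  have hexp : Real.exp (-(l - u)) = Real.exp (-l) * Real.exp u := by rw [← Real.exp_add]; ring_nf
  calc unitRevenue l a - unitRevenue (l - u) a = a * (Real.exp (-l) * (Real.exp u - 1)) := by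
        rw [unitRevenue, unitRevenue, hexp]; ring
    _ ≤ _ := by
        have := (abs_le.1 (Real.abs_exp_sub_one_sub_id_le (abs_le.2 ⟨by linarith, hu1⟩))).2
        gcongr
        nlinarith

end UnitRevenue

theorem unitRevenue_lt_unitRevenue_of_eq {a₁ a₂ l₁ l₂ u : ℝ} (ha₁ : 0 < a₁) (ha : a₁ < a₂)
    (hl : l₂ ≤ l₁) (h : unitRevenue l₁ a₁ = unitRevenue l₂ a₂) (hu : 0 < u) (hu1 : 4 * u ≤ 1) :
    unitRevenue (l₂ - 24 * u) a₂ < unitRevenue (l₁ - 4 * u) a₁ := by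
  have hleft := unitRevenue_sub_le_mul_exp_neg_mul ha₁.le l₁ (by positivity) hu1
  have hright := mul_exp_neg_mul_le_unitRevenue_sub (ha₁.trans ha).le l₂ (u := 24 * u)
  have hlt : a₁ * (Real.exp (-l₁) * (2 * (4 * u))) < a₂ * (Real.exp (-l₂) * (24 * u)) := by
    calc a₁ * (Real.exp (-l₁) * (2 * (4 * u))) < a₂ * (Real.exp (-l₁) * (2 * (4 * u))) := by
          gcongr
      _ ≤ a₂ * (Real.exp (-l₂) * (24 * u)) := by
          have := ha₁.trans ha
          have : 2 * (4 * u) ≤ 24 * u := by linarith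
          gcongr
  linarith

theorem exists_lt_unitRevenue_eq {a₂ l₁ l₂ : ℝ} (ha₂ : 0 < a₂) (hl₂ : 0 < l₂) (hl : l₂ < l₁) :
    ∃ a₁, 0 < a₁ ∧ a₁ < a₂ ∧ unitRevenue l₁ a₁ = unitRevenue l₂ a₂ := by
  have hpos₁ : 0 < 1 - Real.exp (-l₁) := sub_pos.2 (Real.exp_lt_one_iff.2 (by linarith))
  have hpos₂ : 0 < 1 - Real.exp (-l₂) := sub_pos.2 (Real.exp_lt_one_iff.2 (by linarith))
  refine ⟨unitRevenue l₂ a₂ / (1 - Real.exp (-l₁)), div_pos (mul_pos ha₂ hpos₂) hpos₁, ?_,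
    div_mul_cancel₀ _ hpos₁.ne'⟩
  rw [div_lt_iff₀ hpos₁]
  exact mul_lt_mul_of_pos_left
    (sub_lt_sub_left (Real.exp_lt_exp.2 (neg_lt_neg hl)) 1) ha₂

namespace Model

/-- A process with two prices `A₁ < A₂`, the second of which is posted rarely. With one unit in
stock in the last period `A₂` is the better price, by as much as the excess `ε` of its demand
parameter over `l`. -/
structure RarePrice (M : Model L 𝒜) (T : ℕ) (x : Fin (L + 1)) (A₁ A₂ : 𝒜) (l ε : ℝ) : Prop where
  eq_or_eq : ∀ b, b = A₁ ∨ b = A₂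
  pos : 0 < (A₁ : ℝ)
  lt : A₁ < A₂
  start_eq : M.start = PMF.pure x
  val_eq_one : (x : ℕ) = 1
  priceProb_left : ∀ t : Fin T, M.priceProb T M.behavior t A₁ = 9999 / 10000
  priceProb_right : ∀ t : Fin T, M.priceProb T M.behavior t A₂ = 1 / 10000
  lam_right : ∀ t < T, (M.lam t A₂ : ℝ) = l + ε
  unitRevenue_left : ∀ t < T, unitRevenue (M.lam t A₁) A₁ = unitRevenue l A₂

namespace RarePrice

variable {M : Model L 𝒜} {x : Fin (L + 1)} {A₁ A₂ : 𝒜} {l ε : ℝ}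
  (h : M.RarePrice T x A₁ A₂ l ε) {𝒟 : Data T N L 𝒜} {c : ℝ} {t : Fin T}
include h

theorem le_priceProb (t : Fin T) (a : 𝒜) : 1 / 10000 ≤ M.priceProb T M.behavior t a := by
  rcases h.eq_or_eq a with rfl | rfl
  · rw [h.priceProb_left]; norm_num
  · rw [h.priceProb_right]

theorem priceProb_pos (t : Fin T) (a : 𝒜) : 0 < M.priceProb T M.behavior t a :=
  (h.le_priceProb t a).trans_lt' (by norm_num)

theorem le_count {a : 𝒜} (htyp : M.Typical c (1 / 20000) 𝒟 t a) :
    (N : ℝ) / 20000 ≤ count 𝒟 t a := by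
  have hcount := (abs_le.1 htyp.abs_count_sub_le).1
  have hprob := mul_le_mul_of_nonneg_left (h.le_priceProb t a) N.cast_nonneg
  linarith

theorem rate_le {a : 𝒜} (htyp : M.Typical c (1 / 20000) 𝒟 t a) (hN : 1 ≤ N) :
    rate 𝒟 t a ≤ 200 * logRate N :=
  logRate_le_mul (by norm_num) hN (count_le 𝒟 t a) (by linarith [h.le_count htyp])

theorem logRate_le_rate {a : 𝒜} (htyp : M.Typical c (1 / 20000) 𝒟 t a) (hN : 60000 ≤ N) :
    logRate N ≤ rate 𝒟 t a := by
  have hcount : (3 : ℝ) ≤ count 𝒟 t a := by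
    have : (60000 : ℝ) ≤ N := by exact_mod_cast hN
    linarith [h.le_count htyp]
  exact logRate_anti (by exact_mod_cast hcount) (count_le 𝒟 t a)

theorem rate_left_le (htyp : M.Typical c (1 / 20000) 𝒟 t A₁) (hN : 1 ≤ N) :
    rate 𝒟 t A₁ ≤ 2 * logRate N := by
  have hcount := (abs_le.1 htyp.abs_count_sub_le).1
  rw [h.priceProb_left] at hcount
  exact logRate_le_mul two_pos hN (count_le 𝒟 t A₁) (by linarith)

theorem mul_logRate_le_rate_right (htyp : M.Typical c (1 / 20000) 𝒟 t A₂)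
    (hN : 400000000 ≤ N) : 50 * logRate N ≤ rate 𝒟 t A₂ := by
  have hcount := (abs_le.1 htyp.abs_count_sub_le).2
  rw [h.priceProb_right] at hcount
  have hsq : (N : ℝ) ≤ (count 𝒟 t A₂ : ℝ) ^ 2 := by
    have hN' : (400000000 : ℝ) ≤ N := by exact_mod_cast hN
    nlinarith [h.le_count htyp]
  exact mul_logRate_le (by norm_num) (by omega) (by linarith) (by exact_mod_cast hsq)

theorem accurate (hc : 0 ≤ c) (htyp : ∀ t a, M.Typical (c / 2) (1 / 20000) 𝒟 t a) :
    Accurate M c 𝒟 := fun t a _ => by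
  refine ((htyp t a).abs_lamHat_sub_le (by linarith [h.le_count (htyp t a)])).trans ?_
  exact mul_le_mul_of_nonneg_right (by linarith) (rate_nonneg 𝒟 t a)

theorem sub_le_lamLower_left (hc : 0 ≤ c)
    (htyp : ∀ t a, M.Typical (c / 2) (1 / 20000) 𝒟 t a) (lmin : ℝ≥0) (hN : 1 ≤ N) :
    M.lam t A₁ - 4 * (c * logRate N) ≤ lamLower c lmin 𝒟 t A₁ := by
  have hcount : (0 : ℝ) < count 𝒟 t A₁ :=
    (h.le_count (htyp t A₁)).trans_lt' (by positivity)
  refine le_trans ?_ ((h.accurate hc htyp).sub_le_lamLower lmin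
    (mem_obsAbove.2 ⟨by exact_mod_cast hcount, le_refl A₁⟩))
  have := mul_le_mul_of_nonneg_left (h.rate_left_le (htyp t A₁) hN) hc
  rw [delta]
  linarith

theorem lamLower_right_le (hc : 0 ≤ c) (htyp : M.Typical (c / 2) (1 / 20000) 𝒟 t A₂)
    {lmin : ℝ≥0} (hε : ε ≤ c * logRate N) (hl : lmin + 24 * (c * logRate N) ≤ l)
    (hN : 400000000 ≤ N) : lamLower c lmin 𝒟 t A₂ ≤ l - 24 * (c * logRate N) := by
  have hlmin : (lmin : ℝ) ≤ l - 24 * (c * logRate N) := by linarith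
  have hest : lamHat 𝒟 t A₂ - delta c 𝒟 t A₂ ≤ l - 24 * (c * logRate N) := by
    have hacc := (abs_le.1 (htyp.abs_lamHat_sub_le (by linarith [h.le_count htyp]))).2
    have hrate := mul_le_mul_of_nonneg_left (h.mul_logRate_le_rate_right htyp hN) hc
    rw [h.lam_right t t.isLt, delta] at hacc
    rw [delta]
    linarith
  rw [lamLower]
  split_ifs with hne
  · refine Finset.sup'_le _ _ fun b hb => max_le ?_ hlmin
    obtain rfl : b = A₂ := (h.eq_or_eq b).resolve_left fun hb₁ =>
      (mem_obsAbove.1 hb).2.not_gt (hb₁ ▸ h.lt)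
    exact hest
  · exact hlmin

/-- The confidence radius of the rare price exceeds its advantage, so pessimism avoids it. -/
theorem act_eq {lmin lmax : ℝ≥0} (hM : M.Admissible T lmin lmax) (hc : 0 < c)
    (htyp : ∀ t a, M.Typical (c / 2) (1 / 20000) 𝒟 t a) (hε0 : 0 ≤ ε) (hε : ε ≤ c * logRate N)
    (hl : lmin + 24 * (c * logRate N) ≤ l) (h1 : 4 * (c * logRate N) ≤ 1) (hN : 400000000 ≤ N)
    (ht : (t : ℕ) + 1 = T) {act : ℕ → Fin (L + 1) → 𝒜}
    (hact : IsPessimistic c lmin lmax 𝒟 act) : act t x = A₁ := by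
  refine (h.eq_or_eq _).resolve_right fun hact₂ => ?_
  have hA₂ : 0 < (A₂ : ℝ) := h.pos.trans h.lt
  have hΩ : ∀ a, lamLower c lmin 𝒟 t a ≤ lamUpper c lmax 𝒟 t a := fun a =>
    ((h.accurate hc.le htyp).mem_Icc t a hM).1.trans
      ((h.accurate hc.le htyp).mem_Icc t a hM).2
  have hlam : l ≤ M.lam t A₁ := by
    have hmono : (M.lam t A₂ : ℝ) ≤ M.lam t A₁ := hM.mono t t.isLt h.lt.le
    rw [h.lam_right t t.isLt] at hmono
    linarith
  have hlt := unitRevenue_lt_unitRevenue_of_eq h.pos h.lt hlam (h.unitRevenue_left t t.isLt)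
    (mul_pos hc (logRate_pos (by omega))) h1
  have hq := hact t x A₁
  rw [hact₂, pessQ_last ht h.val_eq_one h.pos.le (hΩ A₁),
    pessQ_last ht h.val_eq_one hA₂.le (hΩ A₂)] at hq
  have hleft := unitRevenue_le_unitRevenue h.pos.le
    (h.sub_le_lamLower_left hc.le htyp lmin (by omega) (t := t))
  have hright := unitRevenue_le_unitRevenue hA₂.le
    (h.lamLower_right_le hc.le (htyp t A₂) hε hl hN)
  linarith

theorem le_regret {lmax : ℝ≥0} (hM : ∀ t < T, ∀ a, M.lam t a ≤ lmax) (hε : 0 ≤ ε) {t : ℕ}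
    (ht : t + 1 = T) {act : ℕ → Fin (L + 1) → 𝒜} (hact : act t x = A₁) :
    Real.exp (-lmax) ^ T * (A₂ * (Real.exp (-lmax) * ε)) ≤ M.regret T (markovPolicy act) := by
  have : Nonempty 𝒜 := ⟨A₁⟩
  have htT : t < T := by omega
  have hA₂ : 0 ≤ (A₂ : ℝ) := (h.pos.trans h.lt).le
  refine le_trans ?_ (M.exp_pow_mul_unitRevenue_sub_le_regret hM h.start_eq h.val_eq_one ht
    act A₂)
  have hrev := mul_exp_neg_mul_le_unitRevenue_sub hA₂ (l + ε) (u := ε)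
  have hexp : Real.exp (-(lmax : ℝ)) ≤ Real.exp (-(l + ε)) := by
    rw [← h.lam_right t htT]
    exact Real.exp_le_exp.2 (neg_le_neg (hM t htT A₂))
  rw [hact, h.unitRevenue_left t htT, h.lam_right t htT]
  rw [add_sub_cancel_right] at hrev
  gcongr
  exact hrev.trans' (by gcongr)

theorem regretBound_le (htyp : ∀ t a, M.Typical c (1 / 20000) 𝒟 t a) (hN : 1 ≤ N)
    (c' : ℝ) (lmax : ℝ≥0) (πs : Policy L 𝒜) :
    regretBound M c' lmax πs 𝒟 ≤ T * (200 * logRate N) := by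
  rw [regretBound, identificationTerm_eq_zero h.priceProb_pos, add_zero]
  exact estimationTerm_le (mul_nonneg (by norm_num) (logRate_nonneg N)) fun t a _ _ =>
    h.rate_le (htyp t a) hN

/-- The regret grows with the excess `c * logRate N` of the missed price, as does the estimation
term. -/
theorem mul_regretBound_le_regret (hε : ε = c * logRate N) {lmin lmax : ℝ≥0}
    (hM : M.Admissible T lmin lmax) (hc : 0 < c)
    (htyp : ∀ t a, M.Typical (c / 2) (1 / 20000) 𝒟 t a)
    (hl : lmin + 24 * (c * logRate N) ≤ l) (h1 : 4 * (c * logRate N) ≤ 1) (hN : 400000000 ≤ N)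
    (hT : 1 ≤ T) {c' : ℝ} (hc'0 : 0 ≤ c')
    (hc' : c' * (T * 200) ≤ Real.exp (-lmax) ^ T * (A₂ * (Real.exp (-lmax) * c)))
    (πs : Policy L 𝒜) {act : ℕ → Fin (L + 1) → 𝒜} (hact : IsPessimistic c lmin lmax 𝒟 act) :
    c' * regretBound M c lmax πs 𝒟 ≤ M.regret T (markovPolicy act) := by
  subst hε
  have hr := logRate_nonneg N
  have hε : 0 ≤ c * logRate N := mul_nonneg hc.le hr
  let t : Fin T := ⟨T - 1, by omega⟩
  have ht : (t : ℕ) + 1 = T := Nat.sub_add_cancel hT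
  calc c' * regretBound M c lmax πs 𝒟 ≤ c' * (T * (200 * logRate N)) :=
        mul_le_mul_of_nonneg_left (h.regretBound_le htyp (by omega) c lmax πs) hc'0
    _ = c' * (T * 200) * logRate N := by ring
    _ ≤ Real.exp (-lmax) ^ T * (A₂ * (Real.exp (-lmax) * c)) * logRate N := by gcongr
    _ = Real.exp (-lmax) ^ T * (A₂ * (Real.exp (-lmax) * (c * logRate N))) := by ring
    _ ≤ _ := h.le_regret hM.upper hε ht (h.act_eq hM hc htyp hε le_rfl hl h1 hN ht hact)

end RarePrice

theorem admissible_iid {lmin lmax : ℝ≥0} {lam : 𝒜 → ℝ≥0} (hanti : StrictAnti lam)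
    (hlam : ∀ a, lmin ≤ lam a ∧ lam a ≤ lmax) (x : Fin (L + 1)) (q : PMF 𝒜) (T : ℕ) :
    (iid x lam q).Admissible T lmin lmax :=
  ⟨fun _ _ a => (hlam a).1, fun _ _ a => (hlam a).2, fun _ _ => hanti.antitone⟩

end Model

theorem exists_rarePrice_of_unitRevenue_eq {A₁ A₂ : 𝒜} (heq : ∀ b, b = A₁ ∨ b = A₂)
    (hpos : 0 < (A₁ : ℝ)) (hA : A₁ < A₂) {lmin lmax l₁ l ε : ℝ≥0} (hlmin : lmin ≤ l)
    (hlt : l + ε < l₁) (hlmax : l₁ ≤ lmax) (hrev : unitRevenue l₁ A₁ = unitRevenue l A₂)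
    {x : Fin (L + 1)} (hx : (x : ℕ) = 1) (T : ℕ) :
    ∃ M : Model L 𝒜, M.Admissible T lmin lmax ∧ (∀ t < T, StrictAnti (M.lam t)) ∧
      M.RarePrice T x A₁ A₂ l ε := by
  classical
  let lam : 𝒜 → ℝ≥0 := fun a => if a = A₁ then l₁ else l + ε
  have hlam₁ : lam A₁ = l₁ := if_pos rfl
  have hlam₂ : lam A₂ = l + ε := if_neg hA.ne'
  have hanti : StrictAnti lam := fun a b hab => by
    rcases heq a with rfl | rfl <;> rcases heq b with rfl | rfl
    · exact absurd hab (lt_irrefl _)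
    · rwa [hlam₁, hlam₂]
    · exact absurd hab hA.asymm
    · exact absurd hab (lt_irrefl _)
  have hbounds : ∀ a, lmin ≤ lam a ∧ lam a ≤ lmax := fun a => by
    rcases heq a with rfl | rfl
    · rw [hlam₁]
      exact ⟨(hlmin.trans le_self_add).trans hlt.le, hlmax⟩
    · rw [hlam₂]
      exact ⟨hlmin.trans le_self_add, hlt.le.trans hlmax⟩
  have hp : (1 / 10000 : ℝ≥0) ≤ 1 := div_le_one_of_le₀ (by norm_num) (by positivity)
  refine ⟨Model.iid x lam (twoPoint A₁ A₂ (1 / 10000) hp),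
    Model.admissible_iid hanti hbounds x _ T, fun _ _ => hanti, heq, hpos, hA, rfl, hx,
    fun t => ?_, fun t => ?_, fun _ _ => ?_, fun _ _ => ?_⟩
  · rw [Model.priceProb_iid, twoPoint_left _ _ hA.ne]
    norm_num
  · rw [Model.priceProb_iid, twoPoint_right _ _ hA.ne]
    norm_num
  · exact (congrArg _ hlam₂).trans (NNReal.coe_add l ε)
  · exact (congrArg (unitRevenue · A₁) (congrArg _ hlam₁)).trans hrev

theorem exists_rarePrice {lmin lmax : ℝ≥0} (hlt : lmin < lmax) (hL : 1 ≤ L) {abar : ℝ}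
    (habar : 0 < abar) (T : ℕ) :
    ∃ (𝒜 : Finset ℝ) (x : Fin (L + 1)) (A₁ A₂ : 𝒜) (l D : ℝ), (∀ a ∈ 𝒜, 0 < a ∧ a ≤ abar) ∧
      0 < D ∧ lmin + D ≤ l ∧ ∀ ε ∈ Set.Icc 0 D, ∃ M : Model L 𝒜, M.Admissible T lmin lmax ∧
        (∀ t < T, StrictAnti (M.lam t)) ∧ M.RarePrice T x A₁ A₂ l ε := by
  classical
  obtain ⟨d, hd, rfl⟩ : ∃ d : ℝ≥0, 0 < d ∧ lmin + 4 * d = lmax :=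
    ⟨(lmax - lmin) / 4, div_pos (tsub_pos_of_lt hlt) (by norm_num), by
      rw [mul_div_cancel₀ _ (by norm_num), add_tsub_cancel_of_le hlt.le]⟩
  obtain ⟨a₁, ha₁, ha₁bar, hrev⟩ := exists_lt_unitRevenue_eq habar
    (l₁ := (lmin + 3 * d : ℝ≥0)) (l₂ := (lmin + d : ℝ≥0)) (NNReal.coe_pos.2 (by positivity))
    (NNReal.coe_lt_coe.2 (by gcongr; exact lt_mul_of_one_lt_left hd (by norm_num)))
  let A₁ : ({a₁, abar} : Finset ℝ) := ⟨a₁, by simp⟩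
  let A₂ : ({a₁, abar} : Finset ℝ) := ⟨abar, by simp⟩
  have hA : A₁ < A₂ := ha₁bar
  have heq : ∀ b, b = A₁ ∨ b = A₂ := fun b => by
    simpa only [Finset.mem_insert, Finset.mem_singleton, Subtype.ext_iff] using b.2
  refine ⟨{a₁, abar}, ⟨1, by omega⟩, A₁, A₂, (lmin + d : ℝ≥0), d, ?_, hd, (by simp), ?_⟩
  · simp [ha₁, ha₁bar.le, habar]
  rintro ε ⟨hε0, hεD⟩
  lift ε to ℝ≥0 using hε0
  refine exists_rarePrice_of_unitRevenue_eq heq ha₁ hA le_self_add ?_ ?_ hrev rfl T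
  · calc lmin + d + ε ≤ lmin + d + d := by gcongr; exact hεD
      _ < lmin + d + d + d := lt_add_of_pos_right _ hd
      _ = lmin + 3 * d := by ring
  · gcongr
    norm_num

/-- Two prices that are equally good up to `c * logRate N`: pessimism misses the better one, which
is posted too rarely, and loses as much as the estimation term. -/
theorem estimationTerm_attainable {lmin lmax : ℝ≥0} (hlt : lmin < lmax) {c : ℝ}
    (hc : 2 * ((lmax : ℝ) + 2) ≤ c) (hL : 1 ≤ L) {abar : ℝ} (habar : 0 < abar) (hT : 1 ≤ T) :
    ∃ k : ℝ, 0 < k ∧ ∀ c' : ℝ, 0 < c' → c' ≤ k →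
      ∃ (𝒜 : Finset ℝ) (M : ℕ → Model L 𝒜),
        (∀ a ∈ 𝒜, 0 < a ∧ a ≤ abar) ∧
        (∀ N, (M N).Admissible T lmin lmax ∧ (∀ t < T, StrictAnti ((M N).lam t)) ∧
          ∀ πs, (M N).IsOptimal T πs → ∀ (t : Fin T) (a : 𝒜),
            c' * (M N).priceProb T πs t a ≤ (M N).priceProb T (M N).behavior t a) ∧
        ∀ ε : ℝ, 0 < ε → ∃ N₀ : ℕ, ∀ N, N₀ ≤ N → ∀ πs, (M N).IsOptimal T πs →
          1 - ε ≤ ((M N).dataLaw T N).real {𝒟 |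
            c' * Real.sqrt (Real.log N / N) ≤ estimationTerm (M N) πs 𝒟 ∧
            ∀ act, IsPessimistic c lmin lmax 𝒟 act →
              c' * regretBound (M N) c lmax πs 𝒟 ≤ (M N).regret T (markovPolicy act)} := by
  have hc0 : 0 < c := hc.trans_lt' (by positivity)
  obtain ⟨𝒜, x, A₁, A₂, l, D, h𝒜, hD, hl, hex⟩ := exists_rarePrice hlt hL habar T
  let advantage : ℕ → ℝ := fun N => min (c * logRate N) D
  choose M hadm hanti hrare using fun N => hex (advantage N)
    ⟨le_min (mul_nonneg hc0.le (logRate_nonneg N)) hD.le, min_le_right _ _⟩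
  have hA₂ : 0 < (A₂ : ℝ) := (h𝒜 A₂ A₂.2).1
  let κ := Real.exp (-lmax) ^ T * (A₂ * (Real.exp (-lmax) * c)) / (T * 200)
  have : 0 < κ := by positivity
  refine ⟨min κ (1 / 10000), by positivity, fun c' hc'0 hc' => ⟨𝒜, M, h𝒜, fun N =>
    ⟨hadm N, hanti N, fun πs _ t a => ?_⟩, fun ε hε => Filter.eventually_atTop.1 ?_⟩⟩
  · calc c' * (M N).priceProb T πs t a ≤ 1 / 10000 * 1 := mul_le_mul
          (hc'.trans (min_le_right _ _)) measureReal_le_one ((M N).priceProb_nonneg πs t a)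
          (by norm_num)
      _ ≤ _ := (mul_one _).trans_le ((hrare N).le_priceProb t a)
  have htyp := Model.eventually_one_sub_le_measureReal_typical (fun N => (hadm N).upper)
    (c := c / 2) (by linarith) (s := 1 / 20000) (by norm_num) hε
  filter_upwards [htyp, Filter.eventually_ge_atTop 400000000,
    eventually_mul_logRate_le (24 * c) hD, eventually_mul_logRate_le (4 * c) one_pos]
    with N htyp hN hD' h1 πs _
  rw [mul_assoc] at hD' h1
  have hadv : advantage N = c * logRate N :=
    min_eq_left (by linarith [mul_nonneg hc0.le (logRate_nonneg N)])
  refine htyp.trans (measureReal_mono fun 𝒟 h𝒟 => ⟨?_, fun act hact => ?_⟩)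
  · have hc'1 : c' ≤ 1 := (hc'.trans (min_le_right _ _)).trans (by norm_num)
    exact (mul_le_of_le_one_left (logRate_nonneg N) hc'1).trans (le_estimationTerm
      (hrare N).priceProb_pos πs ⟨0, hT⟩ fun a => (hrare N).logRate_le_rate (h𝒟 _ a) (by omega))
  · exact (hrare N).mul_regretBound_le_regret hadv (hadm N) hc0 h𝒟 (by linarith) h1 hN hT hc'0.le
      ((le_div_iff₀ (by positivity)).1 (hc'.trans (min_le_left _ _))) πs hact

/-! ### Attaining the identification term -/

namespace Model

/-- A process with three prices `A₁ < A₀ < A₂`, the middle one never posted. The demand parameters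
of the outer two are `l + v` and `l`; with one unit in stock in the last period `A₀` is better than
both by at least `g`. -/
structure HiddenPrice (M : Model L 𝒜) (T : ℕ) (x : Fin (L + 1)) (A₁ A₀ A₂ : 𝒜) (l v g : ℝ) :
    Prop where
  eq_or_eq_or_eq : ∀ b, b = A₁ ∨ b = A₀ ∨ b = A₂
  pos : 0 < (A₁ : ℝ)
  left_lt : A₁ < A₀
  lt_right : A₀ < A₂
  start_eq : M.start = PMF.pure x
  val_eq_one : (x : ℕ) = 1
  priceProb_left : ∀ t : Fin T, M.priceProb T M.behavior t A₁ = 1 / 2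
  priceProb_hidden : ∀ t : Fin T, M.priceProb T M.behavior t A₀ = 0
  priceProb_right : ∀ t : Fin T, M.priceProb T M.behavior t A₂ = 1 / 2
  lam_left : ∀ t < T, (M.lam t A₁ : ℝ) = l + v
  lam_right : ∀ t < T, (M.lam t A₂ : ℝ) = l
  gain_pos : 0 < g
  gain_le : ∀ t < T, ∀ b ≠ A₀, g ≤ unitRevenue (M.lam t A₀) A₀ - unitRevenue (M.lam t b) b

namespace HiddenPrice

variable {M : Model L 𝒜} {x : Fin (L + 1)} {A₁ A₀ A₂ : 𝒜} {l v g : ℝ}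
  (h : M.HiddenPrice T x A₁ A₀ A₂ l v g) {𝒟 : Data T N L 𝒜} {c : ℝ} {t : Fin T} {lmin lmax : ℝ≥0}
include h

theorem le_priceProb (hM : ∀ t < T, ∀ a, M.lam t a ≤ lmax) (ht : (t : ℕ) + 1 = T)
    {πs : Policy L 𝒜} (hπ : M.IsOptimal T πs) :
    Real.exp (-lmax) ^ T ≤ M.priceProb T πs t A₀ := by
  have : Nonempty 𝒜 := ⟨A₀⟩
  have hzero : ∀ b ≠ A₀, M.jointLaw M.start πs t (x, b) = 0 := fun b hb =>
    hπ.jointLaw_eq_zero_of_gap_pos t.isLt (h.gain_pos.trans_le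
      ((h.gain_le t t.isLt b hb).trans (M.unitRevenue_sub_le_gap ht h.val_eq_one b A₀)))
  have hlevel : M.levelLaw M.start πs t x = M.jointLaw M.start πs t (x, A₀) := by
    rw [← map_fst_jointLaw, PMF.map_apply, tsum_eq_single (x, A₀), if_pos rfl]
    rintro ⟨y, b⟩ hne
    split_ifs with hy
    · subst hy
      exact hzero b fun hb => hne (by rw [hb])
    · rfl
  have hsurvive := M.exp_pow_mul_le_levelLaw M.start πs (fun i hi => hM i (hi.trans t.isLt)) x
  rw [hlevel, h.start_eq, PMF.pure_apply, if_pos rfl, ENNReal.toReal_one, mul_one, ← h.start_eq]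
    at hsurvive
  calc Real.exp (-lmax) ^ T ≤ Real.exp (-(lmax : ℝ)) ^ (t : ℕ) :=
        pow_le_pow_of_le_one (Real.exp_pos _).le (Real.exp_le_one_iff.2 (by simp)) t.isLt.le
    _ ≤ _ := hsurvive
    _ ≤ _ := M.toReal_jointLaw_le_priceProb πs t (x, A₀)

theorem exp_pow_mul_le_regret (hM : ∀ t < T, ∀ a, M.lam t a ≤ lmax) {t : ℕ} (ht : t + 1 = T)
    {act : ℕ → Fin (L + 1) → 𝒜} (hact : act t x ≠ A₀) :
    Real.exp (-lmax) ^ T * g ≤ M.regret T (markovPolicy act) := by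
  have : Nonempty 𝒜 := ⟨A₀⟩
  exact (mul_le_mul_of_nonneg_left (h.gain_le t (by omega) _ hact) (by positivity)).trans
    (M.exp_pow_mul_unitRevenue_sub_le_regret hM h.start_eq h.val_eq_one ht act A₀)

theorem identificationTerm_eq_sum (πs : Policy L 𝒜) :
    identificationTerm M c lmax πs 𝒟 =
      ∑ t : Fin T, M.priceProb T πs t A₀ * eta M c lmax 𝒟 t A₀ := by
  rw [identificationTerm_eq]
  refine Finset.sum_congr rfl fun t _ => ?_
  rw [Finset.sum_eq_single A₀ (fun b _ hb => ?_) (fun hA₀ => absurd (Finset.mem_univ _) hA₀)]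
  · refine Set.indicator_apply_eq_self.2 fun hcov => ?_
    have hle : M.priceProb T πs t A₀ ≤ 0 := not_lt.1 fun hpos =>
      (Set.notMem_compl_iff.1 hcov hpos).ne' (h.priceProb_hidden t)
    rw [hle.antisymm (M.priceProb_nonneg πs t A₀), zero_mul]
  · have hpos : 0 < M.priceProb T M.behavior t b := by
      rcases h.eq_or_eq_or_eq b with rfl | rfl | rfl
      · rw [h.priceProb_left]; norm_num
      · exact absurd rfl hb
      · rw [h.priceProb_right]; norm_num
    have hcov : b ∈ covered M T πs t := fun _ => hpos
    exact Set.indicator_of_notMem (Set.notMem_compl_iff.2 hcov) _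

section TypicalPeriod

variable (htyp : ∀ a, M.Typical c (1 / 4) 𝒟 t a)
include htyp

theorem count_hidden : count 𝒟 t A₀ = 0 :=
  (htyp A₀).count_eq_zero (h.priceProb_hidden t)

theorem le_count {a : 𝒜} (ha : a ≠ A₀) : (N : ℝ) / 4 ≤ count 𝒟 t a := by
  have hcount := (abs_le.1 (htyp a).abs_count_sub_le).1
  have hprob : M.priceProb T M.behavior t a = 1 / 2 := by
    rcases h.eq_or_eq_or_eq a with rfl | rfl | rfl
    · exact h.priceProb_left t
    · exact absurd rfl ha
    · exact h.priceProb_right t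
  rw [hprob] at hcount
  linarith

theorem count_pos_iff (hN : 1 ≤ N) {a : 𝒜} : 0 < count 𝒟 t a ↔ a ≠ A₀ := by
  refine ⟨?_, fun ha => ?_⟩
  · rintro hpos rfl
    exact hpos.ne' (h.count_hidden htyp)
  · have : (0 : ℝ) < count 𝒟 t a := (h.le_count htyp ha).trans_lt' (by positivity)
    exact_mod_cast this

theorem rate_le (hN : 1 ≤ N) {a : 𝒜} (ha : a ≠ A₀) : rate 𝒟 t a ≤ 2 * logRate N :=
  logRate_le_mul two_pos hN (count_le 𝒟 t a) (by linarith [h.le_count htyp ha])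

theorem obsAbove_hidden (hN : 1 ≤ N) : obsAbove 𝒟 t A₀ = {A₂} := by
  ext b
  rw [mem_obsAbove, h.count_pos_iff htyp hN, Finset.mem_singleton]
  refine ⟨fun ⟨hne, hle⟩ => ?_, ?_⟩
  · exact (h.eq_or_eq_or_eq b).elim (fun hb => absurd (hb ▸ hle) h.left_lt.not_ge)
      (Or.resolve_left · hne)
  · rintro rfl
    exact ⟨h.lt_right.ne', h.lt_right.le⟩

theorem obsAbove_right (hN : 1 ≤ N) : obsAbove 𝒟 t A₂ = {A₂} := by
  ext b
  rw [mem_obsAbove, h.count_pos_iff htyp hN, Finset.mem_singleton]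
  refine ⟨fun ⟨hne, hle⟩ => ?_, ?_⟩
  · exact (h.eq_or_eq_or_eq b).elim
      (fun hb => absurd (hb ▸ hle) (h.left_lt.trans h.lt_right).not_ge) (Or.resolve_left · hne)
  · rintro rfl
    exact ⟨h.lt_right.ne', le_rfl⟩

theorem obsBelow_hidden (hN : 1 ≤ N) : obsBelow 𝒟 t A₀ = {A₁} := by
  ext b
  rw [mem_obsBelow, h.count_pos_iff htyp hN, Finset.mem_singleton]
  refine ⟨fun ⟨hne, hle⟩ => ?_, ?_⟩
  · exact (h.eq_or_eq_or_eq b).resolve_right fun hb =>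
      hb.elim hne fun hb => absurd (hb ▸ hle) h.lt_right.not_ge
  · rintro rfl
    exact ⟨h.left_lt.ne, h.left_lt.le⟩

theorem lamLower_hidden (hN : 1 ≤ N) :
    lamLower c lmin 𝒟 t A₀ = lamLower c lmin 𝒟 t A₂ := by
  simp only [lamLower, h.obsAbove_hidden htyp hN, h.obsAbove_right htyp hN]

theorem eta_eq (hN : 1 ≤ N) :
    eta M c lmax 𝒟 t A₀ = v + 2 * delta c 𝒟 t A₁ + 2 * delta c 𝒟 t A₂ := by
  simp only [eta, h.obsAbove_hidden htyp hN, h.obsBelow_hidden htyp hN,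
    Finset.singleton_nonempty, dif_pos, Finset.max'_singleton, Finset.min'_singleton,
    h.lam_left t t.isLt, h.lam_right t t.isLt]
  ring

theorem eta_mem_Icc (hc : 0 ≤ c) (hN : 1 ≤ N) (hv : 8 * c * logRate N ≤ v) :
    eta M c lmax 𝒟 t A₀ ∈ Set.Icc v (2 * v) := by
  have hleft := mul_le_mul_of_nonneg_left (h.rate_le htyp hN h.left_lt.ne) hc
  have hright := mul_le_mul_of_nonneg_left (h.rate_le htyp hN h.lt_right.ne') hc
  have hleft0 := mul_nonneg hc (rate_nonneg 𝒟 t A₁)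
  have hright0 := mul_nonneg hc (rate_nonneg 𝒟 t A₂)
  rw [h.eta_eq htyp hN, delta, delta]
  constructor <;> linarith

end TypicalPeriod

variable (htyp : ∀ t a, M.Typical c (1 / 4) 𝒟 t a) (hN : 1 ≤ N)
include htyp hN

theorem accurate : Accurate M c 𝒟 := fun t a ha => by
  have hcount := h.le_count (htyp t) ((h.count_pos_iff (htyp t) hN).1 ha)
  exact (htyp t a).abs_lamHat_sub_le (by linarith)

theorem lamLower_right_pos (hc : 0 ≤ c) (hl : 4 * c * logRate N < l) :
    0 < lamLower c lmin 𝒟 t A₂ := by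
  refine lt_of_lt_of_le ?_ ((h.accurate htyp hN).sub_le_lamLower lmin
    (mem_obsAbove.2 ⟨(h.count_pos_iff (htyp t) hN).2 h.lt_right.ne', le_refl A₂⟩))
  have := mul_le_mul_of_nonneg_left (h.rate_le (htyp t) hN h.lt_right.ne') hc
  rw [h.lam_right t t.isLt, delta]
  linarith

/-- The hidden price inherits its lower confidence bound from the more expensive `A₂`, so pessimism
prefers `A₂`. -/
theorem act_ne (hM : M.Admissible T lmin lmax) (hc : 0 ≤ c) (hl : 4 * c * logRate N < l)
    (ht : (t : ℕ) + 1 = T) {act : ℕ → Fin (L + 1) → 𝒜} (hact : IsPessimistic c lmin lmax 𝒟 act) :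
    act t x ≠ A₀ := by
  intro hact₀
  have hlt : (A₀ : ℝ) < A₂ := h.lt_right
  have hA₀ : 0 < (A₀ : ℝ) := h.pos.trans h.left_lt
  have hΩ : ∀ a, lamLower c lmin 𝒟 t a ≤ lamUpper c lmax 𝒟 t a := fun a =>
    ((h.accurate htyp hN).mem_Icc t a hM).1.trans ((h.accurate htyp hN).mem_Icc t a hM).2
  have hq := hact t x A₂
  rw [hact₀, pessQ_last ht h.val_eq_one hA₀.le (hΩ A₀),
    pessQ_last ht h.val_eq_one (hA₀.trans hlt).le (hΩ A₂),
    h.lamLower_hidden (htyp t) hN] at hq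
  have hsell : 0 < 1 - Real.exp (-lamLower c lmin 𝒟 t A₂) :=
    sub_pos.2 (Real.exp_lt_one_iff.2 (neg_lt_zero.2 (h.lamLower_right_pos htyp hN hc hl)))
  exact (mul_lt_mul_of_pos_right hlt hsell).not_ge hq

theorem estimationTerm_le_mul_logRate (πs : Policy L 𝒜) :
    estimationTerm M πs 𝒟 ≤ T * (2 * logRate N) := by
  refine estimationTerm_le (mul_nonneg two_pos.le (logRate_nonneg N)) fun t a hcov hpos =>
    h.rate_le (htyp t) hN ?_
  rintro rfl
  exact (hcov hpos).ne' (h.priceProb_hidden t)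

variable (hc : 0 ≤ c) (hv : 8 * c * logRate N ≤ v)
include hc hv

theorem identificationTerm_le (lmax : ℝ≥0) (πs : Policy L 𝒜) :
    identificationTerm M c lmax πs 𝒟 ≤ T * (2 * v) := by
  rw [h.identificationTerm_eq_sum]
  calc _ ≤ ∑ _t : Fin T, 2 * v := Finset.sum_le_sum fun t _ => ?_
    _ = T * (2 * v) := by rw [Finset.sum_const, Finset.card_univ, Fintype.card_fin, nsmul_eq_mul]
  have heta := h.eta_mem_Icc (lmax := lmax) (htyp t) hc hN hv
  have hv0 : 0 ≤ v := le_trans (by have := logRate_nonneg N; positivity) hv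
  exact (mul_le_of_le_one_left (hv0.trans heta.1) measureReal_le_one).trans heta.2

theorem le_identificationTerm (hM : ∀ t < T, ∀ a, M.lam t a ≤ lmax) (hT : 1 ≤ T)
    {πs : Policy L 𝒜} (hπ : M.IsOptimal T πs) :
    Real.exp (-lmax) ^ T * v ≤ identificationTerm M c lmax πs 𝒟 := by
  have hv0 : 0 ≤ v := le_trans (by have := logRate_nonneg N; positivity) hv
  have heta : ∀ t, v ≤ eta M c lmax 𝒟 t A₀ := fun t => (h.eta_mem_Icc (htyp t) hc hN hv).1
  let t : Fin T := ⟨T - 1, by omega⟩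
  have ht : (t : ℕ) + 1 = T := Nat.sub_add_cancel hT
  rw [h.identificationTerm_eq_sum]
  calc Real.exp (-lmax) ^ T * v ≤ M.priceProb T πs t A₀ * eta M c lmax 𝒟 t A₀ :=
        mul_le_mul (h.le_priceProb hM ht hπ) (heta t) hv0 (M.priceProb_nonneg πs t A₀)
    _ ≤ _ := Finset.single_le_sum
        (f := fun t => M.priceProb T πs t A₀ * eta M c lmax 𝒟 t A₀)
        (fun t _ => mul_nonneg (M.priceProb_nonneg πs t A₀) (hv0.trans (heta t)))
        (Finset.mem_univ t)

theorem mul_regretBound_le_regret (hM : M.Admissible T lmin lmax) (hT : 1 ≤ T)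
    (hl : 4 * c * logRate N < l) (hv2 : 2 * logRate N ≤ v) {c' : ℝ} (hc'0 : 0 ≤ c')
    (hc' : c' * (3 * T * v) ≤ Real.exp (-lmax) ^ T * g) (πs : Policy L 𝒜)
    {act : ℕ → Fin (L + 1) → 𝒜} (hact : IsPessimistic c lmin lmax 𝒟 act) :
    c' * regretBound M c lmax πs 𝒟 ≤ M.regret T (markovPolicy act) := by
  have hbound : regretBound M c lmax πs 𝒟 ≤ 3 * T * v := by
    calc _ ≤ T * (2 * logRate N) + T * (2 * v) :=
          add_le_add (h.estimationTerm_le_mul_logRate htyp hN πs)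
            (h.identificationTerm_le htyp hN hc hv lmax πs)
      _ ≤ T * v + T * (2 * v) := by gcongr
      _ = _ := by ring
  let t : Fin T := ⟨T - 1, by omega⟩
  have ht : (t : ℕ) + 1 = T := Nat.sub_add_cancel hT
  exact ((mul_le_mul_of_nonneg_left hbound hc'0).trans hc').trans
    (h.exp_pow_mul_le_regret hM.upper ht (h.act_ne htyp hN hM hc hl ht hact))

end HiddenPrice

end Model

theorem exists_strictAnti_of_eq_or_eq_or_eq {α β : Type*} [LinearOrder α] [Preorder β] {a b c : α}
    (h : ∀ x, x = a ∨ x = b ∨ x = c) (hab : a < b) (hbc : b < c) {p q r : β} (hqp : q < p)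
    (hrq : r < q) : ∃ f : α → β, StrictAnti f ∧ f a = p ∧ f b = q ∧ f c = r := by
  let f : α → β := fun x => if x = a then p else if x = b then q else r
  have ha : f a = p := if_pos rfl
  have hb : f b = q := (if_neg hab.ne').trans (if_pos rfl)
  have hc : f c = r := (if_neg (hab.trans hbc).ne').trans (if_neg hbc.ne')
  refine ⟨f, fun x y hxy => ?_, ha, hb, hc⟩
  rcases h x with rfl | rfl | rfl <;> rcases h y with rfl | rfl | rfl
  · exact absurd hxy (lt_irrefl _)
  · rwa [ha, hb]
  · exact (hc.trans_lt (hrq.trans hqp)).trans_eq ha.symm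
  · exact absurd hxy hab.asymm
  · exact absurd hxy (lt_irrefl _)
  · rwa [hb, hc]
  · exact absurd hxy (hab.trans hbc).asymm
  · exact absurd hxy hbc.asymm
  · exact absurd hxy (lt_irrefl _)

theorem exists_le_unitRevenue_sub {a₂ l v lmax : ℝ} (ha₂ : 0 < a₂) (hl : 0 < l) (hv : 0 < v)
    (hv1 : v ≤ 1) (hlmax : l + v ≤ lmax) :
    ∃ a₁ a₀, 0 < a₁ ∧ a₁ < a₀ ∧ a₀ < a₂ ∧
      a₂ * Real.exp (-lmax) / 4 * v ≤ unitRevenue (l + v / 2) a₀ - unitRevenue (l + v) a₁ ∧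
      a₂ * Real.exp (-lmax) / 4 * v ≤ unitRevenue (l + v / 2) a₀ - unitRevenue l a₂ := by
  set E := Real.exp (-lmax)
  have hE : 0 < E := Real.exp_pos _
  have hsell : 0 < 1 - Real.exp (-l) := sub_pos.2 (Real.exp_lt_one_iff.2 (neg_lt_zero.2 hl))
  have hloss : ∀ a, 0 ≤ a → ∀ u, unitRevenue u a ≤ a := fun a ha u =>
    mul_le_of_le_one_right ha (sub_le_self 1 (Real.exp_pos _).le)
  have hdiscount : 0 < a₂ * E / 4 * v := by positivity
  have hright : a₂ * E / 4 * v ≤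
      unitRevenue (l + v / 2) (a₂ - a₂ * E / 4 * v) - unitRevenue l a₂ := by
    have hgain := mul_exp_neg_mul_le_unitRevenue_sub ha₂.le (l + v / 2) (u := v / 2)
    rw [add_sub_cancel_right] at hgain
    have hexp : a₂ * (E * (v / 2)) ≤ a₂ * (Real.exp (-(l + v / 2)) * (v / 2)) := by
      have : E ≤ Real.exp (-(l + v / 2)) := Real.exp_le_exp.2 (by linarith)
      gcongr
    have hsplit : unitRevenue (l + v / 2) (a₂ - a₂ * E / 4 * v) =
        unitRevenue (l + v / 2) a₂ - unitRevenue (l + v / 2) (a₂ * E / 4 * v) := sub_mul _ _ _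
    linarith [hloss _ hdiscount.le (l + v / 2)]
  have hleft := hloss (unitRevenue l a₂) (mul_pos ha₂ hsell).le (l + v)
  refine ⟨unitRevenue l a₂, a₂ - a₂ * E / 4 * v, mul_pos ha₂ hsell, ?_, sub_lt_self _ hdiscount,
    by linarith, hright⟩
  have hE_lt : E / 4 * v < Real.exp (-l) := by
    calc E / 4 * v ≤ E / 4 := mul_le_of_le_one_right (by positivity) hv1
      _ < E := by linarith
      _ ≤ Real.exp (-l) := Real.exp_le_exp.2 (by linarith)
  calc unitRevenue l a₂ < a₂ * (1 - E / 4 * v) :=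
        mul_lt_mul_of_pos_left (sub_lt_sub_left hE_lt 1) ha₂
    _ = _ := by ring

theorem Model.hiddenPrice_iid {A₁ A₀ A₂ : 𝒜} (heq : ∀ b, b = A₁ ∨ b = A₀ ∨ b = A₂)
    (hpos : 0 < (A₁ : ℝ)) (h₁ : A₁ < A₀) (h₂ : A₀ < A₂) {lam : 𝒜 → ℝ≥0} {l v g : ℝ}
    (hlam₁ : lam A₁ = l + v) (hlam₂ : lam A₂ = l) (hg : 0 < g)
    (hleft : g ≤ unitRevenue (lam A₀) A₀ - unitRevenue (lam A₁) A₁)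
    (hright : g ≤ unitRevenue (lam A₀) A₀ - unitRevenue (lam A₂) A₂)
    {x : Fin (L + 1)} (hx : (x : ℕ) = 1) (hp : (1 / 2 : ℝ≥0) ≤ 1) (T : ℕ) :
    (iid x lam (twoPoint A₁ A₂ (1 / 2) hp)).HiddenPrice T x A₁ A₀ A₂ l v g := by
  have hA₁₂ : A₁ ≠ A₂ := (h₁.trans h₂).ne
  refine ⟨heq, hpos, h₁, h₂, rfl, hx, fun t => ?_, fun t => ?_, fun t => ?_, fun _ _ => hlam₁,
    fun _ _ => hlam₂, hg, fun _ _ b hb => ?_⟩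
  · rw [priceProb_iid, twoPoint_left _ _ hA₁₂]
    norm_num
  · have hnot : A₀ ∉ (twoPoint A₁ A₂ (1 / 2) hp).support := fun hA₀ =>
      (support_twoPoint_subset _ _ hA₀).elim h₁.ne' h₂.ne
    rw [priceProb_iid, (PMF.apply_eq_zero_iff _ _).2 hnot, ENNReal.toReal_zero]
  · rw [priceProb_iid, twoPoint_right _ _ hA₁₂]
    norm_num
  · rcases heq b with rfl | rfl | rfl
    · exact hleft
    · exact absurd rfl hb
    · exact hright

theorem exists_hiddenPrice_of_le {A₁ A₀ A₂ : 𝒜} (heq : ∀ b, b = A₁ ∨ b = A₀ ∨ b = A₂)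
    (hpos : 0 < (A₁ : ℝ)) (h₁ : A₁ < A₀) (h₂ : A₀ < A₂) {lmin lmax l v : ℝ≥0} (hlmin : lmin ≤ l)
    (hlmax : l + v ≤ lmax) (hv : 0 < v) {g : ℝ} (hg : 0 < g)
    (hleft : g ≤ unitRevenue (l + v / 2) A₀ - unitRevenue (l + v) A₁)
    (hright : g ≤ unitRevenue (l + v / 2) A₀ - unitRevenue l A₂)
    {x : Fin (L + 1)} (hx : (x : ℕ) = 1) (hT : 1 ≤ T) :
    ∃ M₀ M : Model L 𝒜,
      M₀.Admissible T lmin lmax ∧ (∀ t < T, StrictAnti (M₀.lam t)) ∧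
      M.Admissible T lmin lmax ∧ (∀ t < T, StrictAnti (M.lam t)) ∧
      M.behaviorLaw T = M₀.behaviorLaw T ∧ (∃ t < T, M.lam t ≠ M₀.lam t) ∧
      M.HiddenPrice T x A₁ A₀ A₂ l v g := by
  have hv2 : v / 2 < v := NNReal.half_lt_self hv.ne'
  have hv4 : v / 4 < v / 2 := by
    rw [div_lt_div_iff_of_pos_left hv (by norm_num) (by norm_num)]; norm_num
  have hlam := fun u (hu : 0 < u) (huv : u < v) => exists_strictAnti_of_eq_or_eq_or_eq heq h₁ h₂
    (p := l + v) (q := l + u) (r := l) (by gcongr) (lt_add_of_pos_right l hu)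
  obtain ⟨lam₀, hanti₀, h₀₁, h₀₀, h₀₂⟩ := hlam (v / 4) (by positivity) (hv4.trans hv2)
  obtain ⟨lam, hanti, hlam₁, hlam₀, hlam₂⟩ := hlam (v / 2) (by positivity) hv2
  have hbounds : ∀ {f : 𝒜 → ℝ≥0}, StrictAnti f → f A₁ = l + v → f A₂ = l →
      ∀ a, lmin ≤ f a ∧ f a ≤ lmax := fun {f} hf hf₁ hf₂ a => by
    have ha : A₁ ≤ a ∧ a ≤ A₂ := by
      rcases heq a with rfl | rfl | rfl
      exacts [⟨le_rfl, (h₁.trans h₂).le⟩, ⟨h₁.le, h₂.le⟩, ⟨(h₁.trans h₂).le, le_rfl⟩]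
    exact ⟨(hlmin.trans_eq hf₂.symm).trans (hf.antitone ha.2),
      (hf.antitone ha.1).trans (hf₁.trans_le hlmax)⟩
  have hp : (1 / 2 : ℝ≥0) ≤ 1 := div_le_one_of_le₀ (by norm_num) (by positivity)
  refine ⟨Model.iid x lam₀ (twoPoint A₁ A₂ (1 / 2) hp), Model.iid x lam (twoPoint A₁ A₂ (1 / 2) hp),
    Model.admissible_iid hanti₀ (hbounds hanti₀ h₀₁ h₀₂) x _ T, fun _ _ => hanti₀,
    Model.admissible_iid hanti (hbounds hanti hlam₁ hlam₂) x _ T, fun _ _ => hanti,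
    Model.behaviorLaw_iid_congr x fun a ha => ?_, ⟨0, hT, fun h => ?_⟩,
    Model.hiddenPrice_iid heq hpos h₁ h₂ (by simp [hlam₁]) (by simp [hlam₂]) hg ?_ ?_ hx hp T⟩
  · rcases support_twoPoint_subset _ _ ha with rfl | rfl
    · rw [hlam₁, h₀₁]
    · rw [hlam₂, h₀₂]
  · refine hv4.ne (add_left_cancel (a := l) ?_)
    rw [← h₀₀, ← hlam₀]
    exact (congrFun h A₀).symm
  · simpa [hlam₀, hlam₁] using hleft
  · simpa [hlam₀, hlam₂] using hright

theorem exists_hiddenPrice {lmin lmax : ℝ≥0} (hlt : lmin < lmax) (hL : 1 ≤ L) {abar : ℝ}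
    (habar : 0 < abar) (hT : 1 ≤ T) :
    ∃ l v₀ : ℝ, 0 < l ∧ 0 < v₀ ∧ ∀ v, 0 < v → v ≤ v₀ →
      ∃ (𝒜 : Finset ℝ) (x : Fin (L + 1)) (A₁ A₀ A₂ : 𝒜) (M₀ M : Model L 𝒜),
        (∀ a ∈ 𝒜, 0 < a ∧ a ≤ abar) ∧
        M₀.Admissible T lmin lmax ∧ (∀ t < T, StrictAnti (M₀.lam t)) ∧
        M.Admissible T lmin lmax ∧ (∀ t < T, StrictAnti (M.lam t)) ∧
        M.behaviorLaw T = M₀.behaviorLaw T ∧ (∃ t < T, M.lam t ≠ M₀.lam t) ∧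
        M.HiddenPrice T x A₁ A₀ A₂ l v (abar * Real.exp (-lmax) / 4 * v) := by
  classical
  obtain ⟨l, hlmin, hlmax⟩ := exists_between hlt
  have hl : (0 : ℝ) < l := NNReal.coe_pos.2 (hlmin.trans_le' (by positivity))
  have hlmax' : (l : ℝ) < lmax := hlmax
  refine ⟨l, min (lmax - l) 1, hl, lt_min (sub_pos.2 hlmax') one_pos, fun v hv hv₀ => ?_⟩
  have hlv : l + v ≤ lmax := le_sub_iff_add_le'.1 (hv₀.trans (min_le_left _ _))
  obtain ⟨a₁, a₀, ha₁, ha₁₀, ha₀, hleft, hright⟩ :=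
    exists_le_unitRevenue_sub habar hl hv (hv₀.trans (min_le_right _ _)) hlv
  lift v to ℝ≥0 using hv.le
  let A₁ : ({a₁, a₀, abar} : Finset ℝ) := ⟨a₁, by simp⟩
  let A₀ : ({a₁, a₀, abar} : Finset ℝ) := ⟨a₀, by simp⟩
  let A₂ : ({a₁, a₀, abar} : Finset ℝ) := ⟨abar, by simp⟩
  have heq : ∀ b, b = A₁ ∨ b = A₀ ∨ b = A₂ := fun b => by
    simpa only [Finset.mem_insert, Finset.mem_singleton, Subtype.ext_iff] using b.2
  obtain ⟨M₀, M, hM⟩ := exists_hiddenPrice_of_le (A₁ := A₁) (A₀ := A₀) (A₂ := A₂) heq ha₁ ha₁₀ ha₀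
    hlmin.le hlv hv (by positivity) hleft hright (x := (⟨1, by omega⟩ : Fin (L + 1))) rfl hT
  refine ⟨{a₁, a₀, abar}, ⟨1, by omega⟩, A₁, A₀, A₂, M₀, M, ?_, hM⟩
  simp only [Finset.mem_insert, Finset.mem_singleton, forall_eq_or_imp, forall_eq]
  exact ⟨⟨ha₁, (ha₁₀.trans ha₀).le⟩, ⟨ha₁.trans ha₁₀, ha₀.le⟩, habar, le_rfl⟩

/-- The best of three prices is never posted: the data do not reveal its demand, pessimism avoids
it, and the loss is of the order of the width of its identified interval. -/
theorem identificationTerm_attainable {lmin lmax : ℝ≥0} (hlt : lmin < lmax) {c : ℝ}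
    (hc : (lmax : ℝ) + 2 ≤ c) (hL : 1 ≤ L) {abar : ℝ} (habar : 0 < abar) (hT : 1 ≤ T) :
    ∃ k : ℝ, 0 < k ∧ ∀ c' : ℝ, 0 < c' → c' ≤ k → ∃ w₀ : ℝ, 0 < w₀ ∧ ∀ w : ℝ, 0 < w → w ≤ w₀ →
      ∃ (𝒜 : Finset ℝ) (M₀ M : Model L 𝒜),
        (∀ a ∈ 𝒜, 0 < a ∧ a ≤ abar) ∧
        M₀.Admissible T lmin lmax ∧ (∀ t < T, StrictAnti (M₀.lam t)) ∧
        M.Admissible T lmin lmax ∧ (∀ t < T, StrictAnti (M.lam t)) ∧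
        M.behaviorLaw T = M₀.behaviorLaw T ∧ (∃ t < T, M.lam t ≠ M₀.lam t) ∧
        ∀ ε : ℝ, 0 < ε → ∃ N₀ : ℕ, ∀ N, N₀ ≤ N → ∀ πs, M.IsOptimal T πs →
          1 - ε ≤ (M₀.dataLaw T N).real {𝒟 |
            c' * w ≤ identificationTerm M c lmax πs 𝒟 ∧
            identificationTerm M c lmax πs 𝒟 ≤ w ∧
            ∀ act, IsPessimistic c lmin lmax 𝒟 act →
              c' * regretBound M c lmax πs 𝒟 ≤ M.regret T (markovPolicy act)} := by
  have hc0 : 0 ≤ c := hc.trans' (by positivity)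
  have : (0 : ℝ) < T := by exact_mod_cast hT
  obtain ⟨l, v₀, hl, hv₀, hex⟩ := exists_hiddenPrice (L := L) hlt hL habar hT
  let ρ := Real.exp (-lmax) ^ T
  let κ₁ := ρ / (2 * T)
  let κ₂ := ρ * (abar * Real.exp (-lmax) / 4) / (3 * T)
  refine ⟨min κ₁ κ₂, by positivity, fun c' hc'0 hc' => ⟨2 * T * v₀, by positivity,
    fun w hw hw₀ => ?_⟩⟩
  obtain ⟨v, rfl⟩ : ∃ v, w = 2 * T * v := ⟨w / (2 * T), by field_simp⟩
  have hv : 0 < v := pos_of_mul_pos_right hw (by positivity)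
  have hκ₁ : c' * (2 * T) ≤ ρ := (le_div_iff₀ (by positivity)).1 (hc'.trans (min_le_left _ _))
  have hκ₂ : c' * (3 * T) ≤ ρ * (abar * Real.exp (-lmax) / 4) :=
    (le_div_iff₀ (by positivity)).1 (hc'.trans (min_le_right _ _))
  obtain ⟨𝒜, x, A₁, A₀, A₂, M₀, M, h𝒜, hM₀, hanti₀, hM, hanti, hlaw, hne, hidden⟩ :=
    hex v hv (le_of_mul_le_mul_left hw₀ (by positivity))
  refine ⟨𝒜, M₀, M, h𝒜, hM₀, hanti₀, hM, hanti, hlaw, hne, fun ε hε =>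
    Filter.eventually_atTop.1 ?_⟩
  have htyp := Model.eventually_one_sub_le_measureReal_typical (M := fun _ => M)
    (fun _ => hM.upper) hc (s := 1 / 4) (by norm_num) hε
  filter_upwards [htyp, Filter.eventually_ge_atTop 1, eventually_mul_logRate_le (4 * c)
    (half_pos hl), eventually_mul_logRate_le (8 * c) hv, eventually_mul_logRate_le 2 hv]
    with N htyp hN hlN hvN hv2 πs hπ
  simp only [Model.dataLaw, hlaw] at htyp
  refine htyp.trans (measureReal_mono fun 𝒟 h𝒟 => ⟨?_, ?_, fun act hact => ?_⟩)
  · calc c' * (2 * T * v) = c' * (2 * T) * v := by ring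
      _ ≤ ρ * v := by gcongr
      _ ≤ _ := hidden.le_identificationTerm h𝒟 hN hc0 hvN hM.upper hT hπ
  · exact (hidden.identificationTerm_le h𝒟 hN hc0 hvN lmax πs).trans_eq (by ring)
  · refine hidden.mul_regretBound_le_regret h𝒟 hN hc0 hvN hM hT (by linarith) hv2 hc'0.le ?_ πs hact
    calc c' * (3 * T * v) = c' * (3 * T) * v := by ring
      _ ≤ ρ * (abar * Real.exp (-lmax) / 4) * v := by gcongr
      _ = _ := by ring

end OfflinePricing

end

theorem theorem1 (lmax : ℝ≥0) :
    ∃ c₀ : ℝ, 0 < c₀ ∧ ∀ c : ℝ, c₀ ≤ c → ∀ lmin : ℝ≥0, lmin ≤ lmax → ∀ (L : ℕ) (abar : ℝ),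
    -- the regret bound
    (∃ C : ℝ, 0 < C ∧
      ∀ (T N : ℕ) (𝒜 : Finset ℝ) (M : OfflinePricing.Model L 𝒜) (πs : OfflinePricing.Policy L 𝒜),
        (∀ a ∈ 𝒜, 0 ≤ a ∧ a ≤ abar) → M.Admissible T lmin lmax → M.IsOptimal T πs → 1 ≤ N →
        1 - ∑ t : Fin T, ((∫ 𝒟, ∑ a ∈ OfflinePricing.observed 𝒟 t,
              (OfflinePricing.count 𝒟 t a : ℝ)⁻¹ ∂(M.dataLaw T N)) + M.kappa T N t)
          ≤ (M.dataLaw T N).real {𝒟 | ∀ act, OfflinePricing.IsPessimistic c lmin lmax 𝒟 act →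
              M.regret T (OfflinePricing.markovPolicy act)
                ≤ C * OfflinePricing.regretBound M c lmax πs 𝒟}) ∧
    -- attainability, for every horizon
    (lmin < lmax → 1 ≤ L → 0 < abar → ∀ T : ℕ, 1 ≤ T → ∃ c' : ℝ, 0 < c' ∧
      -- of the estimation term, under partial coverage
      (∃ (𝒜 : Finset ℝ) (M : ℕ → OfflinePricing.Model L 𝒜),
        (∀ a ∈ 𝒜, 0 < a ∧ a ≤ abar) ∧
        (∀ N, (M N).Admissible T lmin lmax ∧ (∀ t < T, StrictAnti ((M N).lam t)) ∧
          ∀ πs, (M N).IsOptimal T πs → ∀ (t : Fin T) (a : 𝒜),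
            c' * (M N).priceProb T πs t a ≤ (M N).priceProb T (M N).behavior t a) ∧
        ∀ ε : ℝ, 0 < ε → ∃ N₀ : ℕ, ∀ N, N₀ ≤ N → ∀ πs, (M N).IsOptimal T πs →
          1 - ε ≤ ((M N).dataLaw T N).real {𝒟 |
            c' * Real.sqrt (Real.log N / N) ≤ OfflinePricing.estimationTerm (M N) πs 𝒟 ∧
            ∀ act, OfflinePricing.IsPessimistic c lmin lmax 𝒟 act →
              c' * OfflinePricing.regretBound (M N) c lmax πs 𝒟
                ≤ (M N).regret T (OfflinePricing.markovPolicy act)}) ∧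
      -- of the identification term, at every small scale `w`, by a process `M` that the
      -- distribution of the data does not distinguish from another process `M₀`
      (∃ w₀ : ℝ, 0 < w₀ ∧ ∀ w : ℝ, 0 < w → w ≤ w₀ →
        ∃ (𝒜 : Finset ℝ) (M₀ M : OfflinePricing.Model L 𝒜),
          (∀ a ∈ 𝒜, 0 < a ∧ a ≤ abar) ∧
          M₀.Admissible T lmin lmax ∧ (∀ t < T, StrictAnti (M₀.lam t)) ∧
          M.Admissible T lmin lmax ∧ (∀ t < T, StrictAnti (M.lam t)) ∧
          M.behaviorLaw T = M₀.behaviorLaw T ∧ (∃ t < T, M.lam t ≠ M₀.lam t) ∧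
          ∀ ε : ℝ, 0 < ε → ∃ N₀ : ℕ, ∀ N, N₀ ≤ N → ∀ πs, M.IsOptimal T πs →
            1 - ε ≤ (M₀.dataLaw T N).real {𝒟 |
              c' * w ≤ OfflinePricing.identificationTerm M c lmax πs 𝒟 ∧
              OfflinePricing.identificationTerm M c lmax πs 𝒟 ≤ w ∧
              ∀ act, OfflinePricing.IsPessimistic c lmin lmax 𝒟 act →
                c' * OfflinePricing.regretBound M c lmax πs 𝒟
                  ≤ M.regret T (OfflinePricing.markovPolicy act)})) := by
  refine ⟨2 * (lmax + 2), by positivity, fun c hc lmin _ L abar => ?_⟩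
  have hc' : (lmax : ℝ) + 2 ≤ c := by linarith [lmax.coe_nonneg]
  refine ⟨?_, fun hlt hL habar T hT => ?_⟩
  · have hc0 : 0 ≤ c := hc'.trans' (by positivity)
    exact ⟨|abar| * L ^ 2 * (2 * c + 1) + 1, by positivity, fun T N 𝒜 M πs h𝒜 hM hπ hN =>
      OfflinePricing.one_sub_le_measureReal_regret_le hM hc'
        (fun a ha => ⟨(h𝒜 a ha).1, (h𝒜 a ha).2.trans (le_abs_self abar)⟩) hπ hN
        (le_add_of_nonneg_right zero_le_one)⟩
  · obtain ⟨k₁, hk₁, hest⟩ := OfflinePricing.estimationTerm_attainable hlt hc hL habar hT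
    obtain ⟨k₂, hk₂, hident⟩ := OfflinePricing.identificationTerm_attainable hlt hc' hL habar hT
    exact ⟨min k₁ k₂, lt_min hk₁ hk₂, hest _ (lt_min hk₁ hk₂) (min_le_left _ _),
      hident _ (lt_min hk₁ hk₂) (min_le_right _ _)⟩
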